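/- **Setting.** Fix $\alpha\in(0,1)$. For each $n\ge 1$ let $\mathcal L_n$ be the law of $(\boldsymbol X,\boldsymbol Y,\boldsymbol Z)\in\mathbb R\times\mathbb R\times\mathbb R^{p_n}$, with $\boldsymbol X,\boldsymbol Y$ integrable and $\boldsymbol X\perp\!\!\!\perp \boldsymbol Y\mid \boldsymbol Z$, and let $(X,Y,Z)=\{(X_i,Y_i,Z_i)\}_{i\le n}$ be i.i.d. from $\mathcal L_n$. Put $\mu_{n,x}(z)=\mathbb E_{\mathcal L_n}[\boldsymbol X\mid \boldsymbol Z=z]$, $\mu_{n,y}(z)=\mathbb E_{\mathcal L_n}[\boldsymbol Y\mid \boldsymbol Z=z]$. Let $\widehat{\mathcal L}_n(\cdot\mid z)$ be a conditional law of $\boldsymbol X$ given $\boldsymbol Z=z$ learned from $(X,Z)$ (the learned law applied at $Z_i$ may also depend on the index $i$), with mean $\widehat\mu_{n,x}(z)$ and variance $\mathrm{Var}_{\widehat{\mathcal L}_n}[\boldsymbol X\mid \boldsymbol Z=z]$, and let $\widehat\mu_{n,y}(\cdot)$ be a regression function learned from $(Y,Z)$. Given $(X,Y,Z)$, let $\widetilde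 X_i\sim\widehat{\mathcal L}_n(\cdot\mid Z_i)$ be independent, $i\le n$. For $x\in\mathbb R^n$ put $$T_n(x)=\frac1{\sqrt n}\sum_{i=1}^n (x_i-\widehat\mu_{n,x}(Z_i))(Y_i-\widehat\mu_{n,y}(Z_i)).$$ With $R_i=(X_i-\widehat\mu_{n,x}(Z_i))(Y_i-\widehat\mu_{n,y}(Z_i))$, define $$(\widehat S_n^{\mathrm{dCRT}})^2=\mathrm{Var}[T_n(\widetilde X)\mid X,Y,Z]=\frac1n\sum_{i=1}^n\mathrm{Var}_{\widehat{\mathcal L}_n}[X_i\mid Z_i](Y_i-\widehat\mu_{n,y}(Z_i))^2,\qquad (\widehat S_n^{\mathrm{GCM}})^2=\frac1n\sum_i R_i^2-\Big(\frac1n\sum_i R_i\Big)^2,$$ $$\phi_n^{\mathrm{dCRT}}=\mathbf 1\{T_n(X)>\mathbb Q_{1-\alpha}[T_n(\widetilde X)\mid X,Y,Z]\},\qquad \phi_n^{\mathrm{GCM}}=\mathbf 1\{T_n(X)/\widehat S_n^{\mathrm{GCM}}>z_{1-\alpha}\},$$ where $\mathbb Q_{q}[W\mid\mathcal F]=\inf\{t:\mathbb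 P[W\le t\mid\mathcal F]\ge q\}$ and $z_{1-\alpha}$ is the $(1-\alpha)$-quantile of $N(0,1)$. **Theorem.** Suppose that the following hold. * (SP1′) $E_{n,x}E_{n,y}=o_P(n^{-1/2})$ and $E'_{n,x},E'_{n,y},\widehat E'_{n,y}=o_P(1)$, where $E_{n,x}^2=\frac1n\sum_i(\widehat\mu_{n,x}(Z_i)-\mu_{n,x}(Z_i))^2$, $E_{n,y}^2=\frac1n\sum_i(\widehat\mu_{n,y}(Z_i)-\mu_{n,y}(Z_i))^2$, $(E'_{n,x})^2=\frac1n\sum_i(\widehat\mu_{n,x}(Z_i)-\mu_{n,x}(Z_i))^2\,\mathrm{Var}_{\mathcal L_n}[Y_i\mid Z_i]$, $(E'_{n,y})^2=\frac1n\sum_i(\widehat\mu_{n,y}(Z_i)-\mu_{n,y}(Z_i))^2\,\mathrm{Var}_{\mathcal L_n}[X_i\mid Z_i]$, and $(\widehat E'_{n,y})^2$ is the same as $(E'_{n,y})^2$ with $\mathrm{Var}_{\widehat{\mathcal L}_n}[X_i\mid Z_i]$ in place of $\mathrm{Var}_{\mathcal L_n}[X_i\mid Z_i]$. * (SP2) For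 some $c_1,c_2,\delta>0$: $\inf_n\mathbb E_{\mathcal L_n}[(\boldsymbol X-\mu_{n,x}(\boldsymbol Z))^2(\boldsymbol Y-\mu_{n,y}(\boldsymbol Z))^2]>c_1$ and $\sup_n\mathbb E_{\mathcal L_n}[|(\boldsymbol X-\mu_{n,x}(\boldsymbol Z))(\boldsymbol Y-\mu_{n,y}(\boldsymbol Z))|^{2+\delta}]<c_2$. * (NDG2) For all $n$ and $i\le n$, almost surely $\mathrm{Var}_{\widehat{\mathcal L}_n}[X_i\mid Z_i]$, $(Y_i-\widehat\mu_{n,y}(Z_i))^2$ and $(Y_i-\mu_{n,y}(Z_i))^2$ all lie in $(0,\infty)$. * (Variance consistency) $\frac1n\sum_i(\mathrm{Var}_{\widehat{\mathcal L}_n}[X_i\mid Z_i]-\mathrm{Var}_{\mathcal L_n}[X_i\mid Z_i])\mathrm{Var}_{\mathcal L_n}[Y_i\mid Z_i]\to0$ in probability. * (Lyap-2) For some $\delta>0$ (not necessarily that of (SP2)), $\frac1{n^{1+\delta/2}}\sum_i\mathbb E_{\mathcal L_n}[|Y_i-\mu_{n,y}(Z_i)|^{2+\delta}\mid Z_i]\;\mathbb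 E_{\widehat{\mathcal L}_n}[|\widetilde X_i-\widehat\mu_{n,x}(Z_i)|^{2+\delta}\mid X,Z]\to0$ in probability. Then $$\frac{(\widehat S_n^{\mathrm{dCRT}})^2}{(\widehat S_n^{\mathrm{GCM}})^2}\to1\ \text{in probability},\qquad\text{and}\qquad \lim_{n\to\infty}\mathbb P_{\mathcal L_n}[\phi_n^{\mathrm{dCRT}}=\phi_n^{\mathrm{GCM}}]=1.$$ -/

import Mathlib

open MeasureTheory ProbabilityTheory Filter Topology
open scoped ENNReal

namespace DCRT

noncomputable section

/-! ### Observations, samples, fitted objects -/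

/-- A covariate vector `Z ∈ ℝᵏ`. -/
abbrev Cov (k : ℕ) : Type := Fin k → ℝ

/-- One observation `(X, Y, Z) ∈ ℝ × ℝ × ℝᵏ`. -/
abbrev Obs (k : ℕ) : Type := ℝ × ℝ × Cov k

/-- A sample of `n` observations. -/
abbrev Sample (n k : ℕ) : Type := Fin n → Obs k

/-- The data a regression on `Z` is fitted to: `n` real responses (the `Xᵢ` or the `Yᵢ`) and `n`
covariate vectors. -/
abbrev RegData (n k : ℕ) : Type := (Fin n → ℝ) × (Fin n → Cov k)

/-- The coordinate `X` of an observation. -/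
def obsX {k : ℕ} (o : Obs k) : ℝ := o.1

/-- The coordinate `Y` of an observation. -/
def obsY {k : ℕ} (o : Obs k) : ℝ := o.2.1

/-- The coordinate `Z` of an observation. -/
def obsZ {k : ℕ} (o : Obs k) : Cov k := o.2.2

theorem measurable_obsZ {k : ℕ} : Measurable (obsZ (k := k)) := measurable_snd.snd

/-- The `(X, Z)` part of the sample. -/
def dataXZ {n k : ℕ} (d : Sample n k) : RegData n k :=
  (fun i => obsX (d i), fun i => obsZ (d i))

/-- The `(Y, Z)` part of the sample. -/
def dataYZ {n k : ℕ} (d : Sample n k) : RegData n k :=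
  (fun i => obsY (d i), fun i => obsZ (d i))

/-- The law of `n` i.i.d. observations from `L`. -/
def sampleLaw (n : ℕ) {k : ℕ} (L : Measure (Obs k)) : Measure (Sample n k) :=
  Measure.pi fun _ => L

/-- A learned conditional law of `X` given `Z`: for the `(X, Z)`-data and a value `z` of the
covariate, a law on `ℝ`, measurably in both. The learned law used for the `i`-th observation may
depend on `i`; an ordinary fitted conditional law is one that is constant in `i`. -/
abbrev LawHat (n k : ℕ) : Type := Fin n → Kernel (RegData n k × Cov k) ℝ

/-- A fitted regression function for `E[Y | Z]`: for the `(Y, Z)`-data, a function of `z`. -/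
abbrev RegHat (n k : ℕ) : Type := RegData n k → Cov k → ℝ

/-- The learned conditional law of `Xᵢ` given `Zᵢ`, on a given sample. -/
def learnedLaw {n k : ℕ} (Q : LawHat n k) (d : Sample n k) (i : Fin n) : Measure ℝ :=
  Q i (dataXZ d, obsZ (d i))

/-- The fitted value `μ̂ₓ(Zᵢ)`: the mean of the learned conditional law of `Xᵢ` given `Zᵢ`. -/
def fitX {n k : ℕ} (Q : LawHat n k) (d : Sample n k) (i : Fin n) : ℝ :=
  ∫ x, x ∂(learnedLaw Q d i)

/-- The fitted value `μ̂_y(Zᵢ)`. -/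
def fitY {n k : ℕ} (m : RegHat n k) (d : Sample n k) (i : Fin n) : ℝ :=
  m (dataYZ d) (obsZ (d i))

/-! ### True conditional laws and moments -/

/-- The conditional law of `X` given `Z = z`. -/
def condLawX {k : ℕ} (L : Measure (Obs k)) [IsFiniteMeasure L] (z : Cov k) : Measure ℝ :=
  condDistrib obsX obsZ L z

/-- The conditional law of `Y` given `Z = z`. -/
def condLawY {k : ℕ} (L : Measure (Obs k)) [IsFiniteMeasure L] (z : Cov k) : Measure ℝ :=
  condDistrib obsY obsZ L z

/-- `μₓ(z) = E[X | Z = z]`. -/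
def meanX {k : ℕ} (L : Measure (Obs k)) [IsFiniteMeasure L] (z : Cov k) : ℝ :=
  ∫ x, x ∂(condLawX L z)

/-- `μ_y(z) = E[Y | Z = z]`. -/
def meanY {k : ℕ} (L : Measure (Obs k)) [IsFiniteMeasure L] (z : Cov k) : ℝ :=
  ∫ y, y ∂(condLawY L z)

/-- `E[|W - c| ^ q]` in `[0, ∞]`, for `W` with law `ν`. -/
def absMoment (ν : Measure ℝ) (c q : ℝ) : ℝ≥0∞ :=
  ∫⁻ w, ENNReal.ofReal (|w - c| ^ q) ∂ν

/-- The null hypothesis: `X` and `Y` are conditionally independent given `Z` under `L`. -/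
def IsNull {k : ℕ} (L : Measure (Obs k)) [IsFiniteMeasure L] : Prop :=
  CondIndepFun (MeasurableSpace.comap obsZ inferInstance) measurable_obsZ.comap_le obsX obsY L

/-! ### Convergence in probability -/

/-- `Wₙ → c` in probability, where `Wₙ` lives on its own probability space `(Ωₙ, Pₙ)`. -/
def ConvInProb {Ω : ℕ → Type} [∀ n, MeasurableSpace (Ω n)] (P : ∀ n, Measure (Ω n))
    (W : ∀ n, Ω n → ℝ) (c : ℝ) : Prop :=
  ∀ ε : ℝ, 0 < ε → Tendsto (fun n => P n {ω | ε ≤ |W n ω - c|}) atTop (𝓝 0)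

/-- `Wₙ → 0` in probability, for `Wₙ` with values in `[0, ∞]`. -/
def ConvInProbZero {Ω : ℕ → Type} [∀ n, MeasurableSpace (Ω n)] (P : ∀ n, Measure (Ω n))
    (W : ∀ n, Ω n → ℝ≥0∞) : Prop :=
  ∀ ε : ℝ≥0∞, 0 < ε → Tendsto (fun n => P n {ω | ε ≤ W n ω}) atTop (𝓝 0)

/-! ### The dCRT-hat and the GCM test -/

/-- `n^{-1/2} ∑ᵢ (xᵢ - μ̂ₓ(Zᵢ)) (Yᵢ - μ̂_y(Zᵢ))`, for an arbitrary vector `x` in the place of the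
predictors; the fitted values are those of the original sample. -/
def statAt {n k : ℕ} (Q : LawHat n k) (m : RegHat n k) (d : Sample n k) (x : Fin n → ℝ) : ℝ :=
  (1 / √(n : ℝ)) * ∑ i, (x i - fitX Q d i) * (obsY (d i) - fitY m d i)

/-- The dCRT-hat test statistic. -/
def dcrtStat {n k : ℕ} (Q : LawHat n k) (m : RegHat n k) (d : Sample n k) : ℝ :=
  statAt Q m d fun i => obsX (d i)

/-- The law of the resampled predictors given the sample: `X̃ᵢ` independent, drawn from the learned
conditional law of `Xᵢ` given `Zᵢ`. -/
def resampleLaw {n k : ℕ} (Q : LawHat n k) (d : Sample n k) : Measure (Fin n → ℝ) :=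
  Measure.pi fun i => learnedLaw Q d i

/-- The resampling variance: the variance of the resampled statistic given the sample. -/
def dcrtVar {n k : ℕ} (Q : LawHat n k) (m : RegHat n k) (d : Sample n k) : ℝ :=
  Var[statAt Q m d; resampleLaw Q d]

/-- The `q`-quantile `inf {t | P[W ≤ t] ≥ q}` of a law `ν` on `ℝ`. -/
def quantile (ν : Measure ℝ) (q : ℝ) : ℝ :=
  sInf {t : ℝ | q ≤ ν.real (Set.Iic t)}

/-- The dCRT-hat at level `α` with infinitely many resamples: reject when the statistic exceeds the
`1 - α` quantile of the resampling distribution. -/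
def dcrtTest {n k : ℕ} (α : ℝ) (Q : LawHat n k) (m : RegHat n k) (d : Sample n k) : ℝ :=
  if quantile ((resampleLaw Q d).map (statAt Q m d)) (1 - α) < dcrtStat Q m d then 1 else 0

/-- The product of residuals `(Xᵢ - μ̂ₓ(Zᵢ)) (Yᵢ - μ̂_y(Zᵢ))`. -/
def residProd {n k : ℕ} (Q : LawHat n k) (m : RegHat n k) (d : Sample n k) (i : Fin n) : ℝ :=
  (obsX (d i) - fitX Q d i) * (obsY (d i) - fitY m d i)

/-- The GCM variance estimate: the empirical variance of the products of residuals. -/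
def gcmVar {n k : ℕ} (Q : LawHat n k) (m : RegHat n k) (d : Sample n k) : ℝ :=
  (1 / (n : ℝ)) * ∑ i, residProd Q m d i ^ 2 - ((1 / (n : ℝ)) * ∑ i, residProd Q m d i) ^ 2

/-- The GCM test statistic. -/
def gcmStat {n k : ℕ} (Q : LawHat n k) (m : RegHat n k) (d : Sample n k) : ℝ :=
  (1 / √(gcmVar Q m d)) * ((1 / √(n : ℝ)) * ∑ i, residProd Q m d i)

/-- The GCM test at level `α`: reject when the GCM statistic exceeds the `1 - α` quantile of the
standard normal law. -/
def gcmTest {n k : ℕ} (α : ℝ) (Q : LawHat n k) (m : RegHat n k) (d : Sample n k) : ℝ :=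
  if quantile (gaussianReal 0 1) (1 - α) < gcmStat Q m d then 1 else 0

/-! ### Estimation errors -/

/-- `Eₙₓ = ((1/n) ∑ᵢ (μ̂ₓ(Zᵢ) - μₓ(Zᵢ))²)^{1/2}`. -/
def errX {n k : ℕ} (L : Measure (Obs k)) [IsFiniteMeasure L] (Q : LawHat n k) (d : Sample n k) :
    ℝ :=
  √((1 / (n : ℝ)) * ∑ i, (fitX Q d i - meanX L (obsZ (d i))) ^ 2)

/-- `E_{n,y} = ((1/n) ∑ᵢ (μ̂_y(Zᵢ) - μ_y(Zᵢ))²)^{1/2}`. -/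
def errY {n k : ℕ} (L : Measure (Obs k)) [IsFiniteMeasure L] (m : RegHat n k) (d : Sample n k) :
    ℝ :=
  √((1 / (n : ℝ)) * ∑ i, (fitY m d i - meanY L (obsZ (d i))) ^ 2)

/-- `E'ₙₓ = ((1/n) ∑ᵢ (μ̂ₓ(Zᵢ) - μₓ(Zᵢ))² Var[Yᵢ | Zᵢ])^{1/2}`, in `[0, ∞]`. -/
def errX' {n k : ℕ} (L : Measure (Obs k)) [IsFiniteMeasure L] (Q : LawHat n k) (d : Sample n k) :
    ℝ≥0∞ :=
  ((n : ℝ≥0∞)⁻¹ * ∑ i, ENNReal.ofReal ((fitX Q d i - meanX L (obsZ (d i))) ^ 2) *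
    eVar[id; condLawY L (obsZ (d i))]) ^ (1 / 2 : ℝ)

/-- `E'_{n,y} = ((1/n) ∑ᵢ (μ̂_y(Zᵢ) - μ_y(Zᵢ))² Var[Xᵢ | Zᵢ])^{1/2}`, in `[0, ∞]`. -/
def errY' {n k : ℕ} (L : Measure (Obs k)) [IsFiniteMeasure L] (m : RegHat n k) (d : Sample n k) :
    ℝ≥0∞ :=
  ((n : ℝ≥0∞)⁻¹ * ∑ i, ENNReal.ofReal ((fitY m d i - meanY L (obsZ (d i))) ^ 2) *
    eVar[id; condLawX L (obsZ (d i))]) ^ (1 / 2 : ℝ)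

/-- As `errY'`, with the variance of the learned law in the place of `Var[Xᵢ | Zᵢ]`. -/
def errYHat' {n k : ℕ} (L : Measure (Obs k)) [IsFiniteMeasure L] (Q : LawHat n k) (m : RegHat n k)
    (d : Sample n k) : ℝ≥0∞ :=
  ((n : ℝ≥0∞)⁻¹ * ∑ i, ENNReal.ofReal ((fitY m d i - meanY L (obsZ (d i))) ^ 2) *
    eVar[id; learnedLaw Q d i]) ^ (1 / 2 : ℝ)

/-! ### Conditions on a sequence of laws and of fitted objects

Samples of size `n = 0` carry no condition. -/

/-- (SP1') `Eₙₓ E_{n,y} = o_P(n^{-1/2})`, and `E'ₙₓ`, `E'_{n,y}`, `Ê'_{n,y}` are `o_P(1)`. -/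
def SP1' {p : ℕ → ℕ} (L : ∀ n, Measure (Obs (p n))) [∀ n, IsFiniteMeasure (L n)]
    (Q : ∀ n, LawHat n (p n)) (m : ∀ n, RegHat n (p n)) : Prop :=
  ConvInProb (fun n => sampleLaw n (L n))
      (fun n d => √(n : ℝ) * (errX (L n) (Q n) d * errY (L n) (m n) d)) 0 ∧
    ConvInProbZero (fun n => sampleLaw n (L n)) (fun n d => errX' (L n) (Q n) d) ∧
    ConvInProbZero (fun n => sampleLaw n (L n)) (fun n d => errY' (L n) (m n) d) ∧
    ConvInProbZero (fun n => sampleLaw n (L n)) (fun n d => errYHat' (L n) (Q n) (m n) d)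

/-- (SP2) `inf_n E[(X - μₓ(Z))² (Y - μ_y(Z))²] > c₁` and
`sup_n E[|(X - μₓ(Z)) (Y - μ_y(Z))| ^ (2 + δ)] < c₂` for some `c₁, c₂, δ > 0`. -/
def SP2 {p : ℕ → ℕ} (L : ∀ n, Measure (Obs (p n))) [∀ n, IsFiniteMeasure (L n)] : Prop :=
  ∃ c₁ c₂ δ : ℝ, 0 < c₁ ∧ 0 < c₂ ∧ 0 < δ ∧
    (ENNReal.ofReal c₁ < ⨅ n ≥ 1, ∫⁻ o, ENNReal.ofReal
      ((obsX o - meanX (L n) (obsZ o)) ^ 2 * (obsY o - meanY (L n) (obsZ o)) ^ 2) ∂(L n)) ∧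
    (⨆ n ≥ 1, ∫⁻ o, ENNReal.ofReal
      (|(obsX o - meanX (L n) (obsZ o)) * (obsY o - meanY (L n) (obsZ o))| ^ (2 + δ)) ∂(L n))
        < ENNReal.ofReal c₂

/-- (NDG2) Almost surely, for every `i`, the learned law of `Xᵢ` has positive finite variance, and
`(Yᵢ - μ̂_y(Zᵢ))²` and `(Yᵢ - μ_y(Zᵢ))²` are positive (being real numbers, they are finite). -/
def NDG2 {p : ℕ → ℕ} (L : ∀ n, Measure (Obs (p n))) [∀ n, IsFiniteMeasure (L n)]
    (Q : ∀ n, LawHat n (p n)) (m : ∀ n, RegHat n (p n)) : Prop :=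
  ∀ n ≥ 1, ∀ᵐ d ∂(sampleLaw n (L n)), ∀ i : Fin n,
    0 < eVar[id; learnedLaw (Q n) d i] ∧ eVar[id; learnedLaw (Q n) d i] < ∞ ∧
      0 < (obsY (d i) - fitY (m n) d i) ^ 2 ∧ 0 < (obsY (d i) - meanY (L n) (obsZ (d i))) ^ 2

/-- Variance consistency:
`(1/n) ∑ᵢ (Var̂[Xᵢ | Zᵢ] - Var[Xᵢ | Zᵢ]) Var[Yᵢ | Zᵢ] → 0` in probability. -/
def VarConsistent {p : ℕ → ℕ} (L : ∀ n, Measure (Obs (p n))) [∀ n, IsFiniteMeasure (L n)]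
    (Q : ∀ n, LawHat n (p n)) : Prop :=
  ConvInProb (fun n => sampleLaw n (L n))
    (fun n d => (1 / (n : ℝ)) * ∑ i, (Var[id; learnedLaw (Q n) d i] -
      Var[id; condLawX (L n) (obsZ (d i))]) * Var[id; condLawY (L n) (obsZ (d i))]) 0

/-- (Lyap-2) For some `δ > 0`, `n^{-(1 + δ/2)} ∑ᵢ E[|Yᵢ - μ_y(Zᵢ)|^{2+δ} | Zᵢ]
Ê[|X̃ᵢ - μ̂ₓ(Zᵢ)|^{2+δ} | X, Z] → 0` in probability. -/
def Lyap2 {p : ℕ → ℕ} (L : ∀ n, Measure (Obs (p n))) [∀ n, IsFiniteMeasure (L n)]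
    (Q : ∀ n, LawHat n (p n)) : Prop :=
  ∃ δ : ℝ, 0 < δ ∧ ConvInProbZero (fun n => sampleLaw n (L n))
    (fun n d => (∑ i, absMoment (condLawY (L n) (obsZ (d i))) (meanY (L n) (obsZ (d i))) (2 + δ) *
      absMoment (learnedLaw (Q n) d i) (fitX (Q n) d i) (2 + δ)) /
        ENNReal.ofReal ((n : ℝ) ^ (1 + δ / 2)))

end

end DCRT

open DCRT

/-!
Why the theorem is true.

Write `ε = X - μₓ(Z)` and `ξ = Y - μ_y(Z)` for the errors and `s² = E[(ε ξ)²]`, which is bounded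
away from zero and from infinity.

*The statistic.* A product of residuals is `ε ξ` minus terms with a bias `μ̂ - μ` as a factor. In
the normalised sum the product of the two biases is negligible by Cauchy-Schwarz. A mixed term such
as `∑ (μ̂ₓ - μₓ)(Zᵢ) ξᵢ / √n` has, given `(X, Z)`, independent centred summands, because `μ̂ₓ` does not
depend on `Y`; its conditional variance is `(E'ₙₓ)²`, so that it is negligible by Chebyshev
(`tendsto_linear_of_refresh`). Hence the statistic is `∑ εᵢ ξᵢ / √n + o_P(1)`
(`SP1'.tendsto_dcrtStat_sub`), and Lyapunov's theorem gives its limit law, `N(0, s²)`.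

*The two variances.* Both are `s² + o_P(1)`. For the GCM variance this is the law of large numbers
for `(ε ξ)²` (`ErrBounds.tendsto_gcmVar`). The resampling variance is, up to a term controlled by
`Ê'_{n,y}`, the mean of `Var̂[Xᵢ | Zᵢ] ξᵢ²`. Given `(X, Z)`, a truncated weak law, for which the
Lyapunov condition is more than enough, replaces `ξᵢ²` by its conditional mean `Var[Yᵢ | Zᵢ]`;
variance consistency replaces the learned variance by the true one; and by conditional independence
the mean of `Var[Xᵢ | Zᵢ] Var[Yᵢ | Zᵢ]` has expectation `s²` (`ErrBounds.tendsto_dcrtVar`).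

*The two tests.* By Lyapunov's theorem given the sample, the resampled statistic is asymptotically
`N(0, s²)` as well, so that its quantile is `s z + o_P(1)` with `z` the normal quantile
(`ErrBounds.eventually_quantile_mem`); the critical value of the GCM test is too
(`ErrBounds.eventually_gcm_critical`). The tests disagree only if the statistic lies between the two
critical values, which is unlikely since its limit law has a bounded density
(`ErrBounds.eventually_tests_eq`).

Conditioning on `(X, Z)` is expressed by a resampling identity, `IsRefresh`: under the null
hypothesis, drawing `Y` anew from its conditional law given `Z` does not change the law of an
observation, although it leaves `X` and `Z` in place. For an i.i.d. sample it then suffices to prove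
a limit statement for the redrawn sample, given the original one (`tendsto_zero_of_refresh`).
-/

namespace DCRT

/-! ### Convergence in probability as convergence along a filter -/

/-- The filter of events of probability tending to one, on the disjoint union of the probability
spaces `(Ωₙ, Pₙ)`. Convergence in probability is convergence along this filter, so that the
calculus of limits applies to it. The events need not be measurable. -/
def whp {Ω : ℕ → Type} [∀ n, MeasurableSpace (Ω n)] (P : ∀ n, Measure (Ω n)) :
    Filter (Σ n, Ω n) where
  sets := {S | Tendsto (fun n => P n {ω | (⟨n, ω⟩ : Σ n, Ω n) ∉ S}) atTop (𝓝 0)}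
  univ_sets := by simp
  sets_of_superset {S T} hS hST := by
    refine tendsto_of_tendsto_of_tendsto_of_le_of_le tendsto_const_nhds hS (fun _ => zero_le) ?_
    exact fun n => measure_mono fun ω hω h => hω (hST h)
  inter_sets {S T} hS hT := by
    have h := Tendsto.add hS hT
    rw [add_zero] at h
    refine tendsto_of_tendsto_of_tendsto_of_le_of_le tendsto_const_nhds h (fun _ => zero_le) ?_
    refine fun n => le_trans (measure_mono fun ω hω => ?_) (measure_union_le _ _)
    by_cases h1 : (⟨n, ω⟩ : Σ n, Ω n) ∈ S
    · exact Or.inr fun h2 => hω ⟨h1, h2⟩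
    · exact Or.inl h1

section Whp

variable {Ω : ℕ → Type} [∀ n, MeasurableSpace (Ω n)] {P : ∀ n, Measure (Ω n)}

theorem eventually_whp {q : (Σ n, Ω n) → Prop} :
    (∀ᶠ a in whp P, q a) ↔ Tendsto (fun n => P n {ω | ¬ q ⟨n, ω⟩}) atTop (𝓝 0) := Iff.rfl

theorem convInProb_iff_tendsto {W : ∀ n, Ω n → ℝ} {c : ℝ} :
    ConvInProb P W c ↔ Tendsto (fun a : Σ n, Ω n => W a.1 a.2) (whp P) (𝓝 c) := by
  rw [Metric.tendsto_nhds]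
  refine forall₂_congr fun ε hε => ?_
  rw [eventually_whp]
  simp [Real.dist_eq]

theorem convInProbZero_iff_tendsto {W : ∀ n, Ω n → ℝ≥0∞} :
    ConvInProbZero P W ↔ Tendsto (fun a : Σ n, Ω n => W a.1 a.2) (whp P) (𝓝 0) := by
  rw [ENNReal.nhds_zero_basis.tendsto_right_iff]
  refine forall₂_congr fun ε hε => ?_
  rw [eventually_whp]
  simp

theorem tendsto_fst_whp : Tendsto (Sigma.fst : (Σ n, Ω n) → ℕ) (whp P) atTop := by
  refine tendsto_atTop.2 fun N => eventually_whp.2 ?_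
  refine tendsto_const_nhds.congr' ?_
  filter_upwards [eventually_ge_atTop N] with n hn
  simp [hn]

theorem eventually_whp_of_ae {q : (Σ n, Ω n) → Prop}
    (h : ∀ n ≥ 1, ∀ᵐ ω ∂(P n), q ⟨n, ω⟩) : ∀ᶠ a in whp P, q a := by
  refine eventually_whp.2 (tendsto_const_nhds.congr' ?_)
  filter_upwards [eventually_ge_atTop 1] with n hn
  exact (ae_iff.1 (h n hn)).symm

end Whp

/-! ### Resampling one coordinate of every observation from its conditional law -/

/-- The law `L` is invariant under the following move: given `o`, draw `w` from `κ o` and replace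
`o` by `g o w`. -/
def IsRefresh {O : Type*} [MeasurableSpace O] (L : Measure O) (κ : Kernel O ℝ)
    (g : O → ℝ → O) : Prop :=
  Measurable (Function.uncurry g) ∧
    ∀ F : O → ℝ≥0∞, Measurable F → ∫⁻ o, F o ∂L = ∫⁻ o, ∫⁻ w, F (g o w) ∂(κ o) ∂L

section Refresh

variable {O : Type*} [MeasurableSpace O] {L : Measure O} [IsProbabilityMeasure L]
  {κ : Kernel O ℝ} [IsMarkovKernel κ] {g : O → ℝ → O}

theorem measurable_pi_comp {ι : Type*} [Fintype ι] {β : Type*} [MeasurableSpace β]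
    (η : Kernel O β) [IsMarkovKernel η] :
    Measurable fun d : ι → O => Measure.pi fun i => η (d i) := by
  refine Measurable.measure_of_isPiSystem_of_isProbabilityMeasure (generateFrom_pi).symm
    isPiSystem_pi ?_
  rintro _ ⟨s, hs, rfl⟩
  simp only [Measure.pi_pi]
  refine Finset.measurable_fun_prod _ fun i _ => ?_
  exact (η.measurable_coe (hs i (Set.mem_univ i))).comp (measurable_pi_apply i)

theorem lintegral_pi_prod {ι : Type*} [Fintype ι] {f : ι → O → ℝ≥0∞} (hf : ∀ i, Measurable (f i)) :
    ∫⁻ d, ∏ i, f i (d i) ∂(Measure.pi fun _ : ι => L) = ∏ i, ∫⁻ o, f i o ∂L := by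
  have hind := iIndepFun_pi (μ := fun _ : ι => L) (X := f) fun i => (hf i).aemeasurable
  have := lintegral_prod_eq_prod_lintegral_of_indepFun Finset.univ _ hind
    (fun i => (hf i).comp (measurable_pi_apply i))
  rw [this]
  refine Finset.prod_congr rfl fun i _ => ?_
  exact (measurePreserving_eval (fun _ : ι => L) i).lintegral_comp (hf i)

/-- Invariance passes to i.i.d. samples, every observation being moved independently. -/
theorem IsRefresh.lintegral_pi (h : IsRefresh L κ g) {n : ℕ} {F : (Fin n → O) → ℝ≥0∞}
    (hF : Measurable F) :
    ∫⁻ d, F d ∂(Measure.pi fun _ => L) =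
      ∫⁻ d, ∫⁻ w, F (fun i => g (d i) (w i)) ∂(Measure.pi fun i => κ (d i))
        ∂(Measure.pi fun _ => L) := by
  obtain ⟨hg, hL⟩ := h
  have hgo : ∀ o, Measurable (g o) := fun o => hg.comp measurable_prodMk_left
  let η : Kernel O O := Kernel.map (Kernel.id ×ₖ κ) (Function.uncurry g)
  have hη : ∀ o, η o = (κ o).map (g o) := by
    intro o
    ext s hs
    rw [Kernel.map_apply _ hg, Kernel.prod_apply, Kernel.id_apply, Measure.map_apply hg hs,
      Measure.map_apply (hgo o) hs, Measure.dirac_prod, Measure.map_apply measurable_prodMk_left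
        (hg hs)]
    rfl
  have : IsMarkovKernel η := Kernel.IsMarkovKernel.map _ hg
  have hmeas : Measurable fun d : Fin n → O => Measure.pi fun i => η (d i) := measurable_pi_comp η
  -- Boxes suffice, and there both sides factor over the observations.
  have hbind : (Measure.pi fun _ : Fin n => L).bind (fun d => Measure.pi fun i => η (d i)) =
      Measure.pi fun _ => L := by
    refine (Measure.pi_eq fun s hs => ?_).symm
    rw [Measure.bind_apply (MeasurableSet.univ_pi hs) hmeas.aemeasurable]
    simp only [Measure.pi_pi]
    rw [lintegral_pi_prod (f := fun i o => η o (s i)) fun i => η.measurable_coe (hs i)]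
    refine Finset.prod_congr rfl fun i _ => ?_
    have := hL ((s i).indicator 1) (measurable_one.indicator (hs i))
    rw [lintegral_indicator_one (hs i)] at this
    rw [this]
    refine lintegral_congr fun o => ?_
    rw [hη, Measure.map_apply (hgo o) (hs i), ← lintegral_indicator_one (hgo o (hs i))]
    rfl
  conv_lhs => rw [← hbind]
  rw [Measure.lintegral_bind hmeas.aemeasurable hF.aemeasurable]
  refine lintegral_congr fun d => ?_
  have hp : (Measure.pi fun i => η (d i)) =
      (Measure.pi fun i => κ (d i)).map (fun w i => g (d i) (w i)) := by
    have : ∀ i, SigmaFinite ((κ (d i)).map (g (d i))) := fun i => by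
      have := Measure.isProbabilityMeasure_map (μ := κ (d i)) (hgo (d i)).aemeasurable
      infer_instance
    rw [Measure.pi_map_pi fun i => (hgo (d i)).aemeasurable]
    simp_rw [hη]
  have hm : Measurable fun (w : Fin n → ℝ) i => g (d i) (w i) :=
    measurable_pi_lambda _ fun i => (hgo (d i)).comp (measurable_pi_apply i)
  rw [hp, lintegral_map hF hm]

theorem IsRefresh.measure_pi (h : IsRefresh L κ g) {n : ℕ} {s : Set (Fin n → O)}
    (hs : MeasurableSet s) :
    (Measure.pi fun _ => L) s =
      ∫⁻ d, (Measure.pi fun i => κ (d i)) {w | (fun i => g (d i) (w i)) ∈ s}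
        ∂(Measure.pi fun _ => L) := by
  rw [← lintegral_indicator_one hs, h.lintegral_pi (measurable_one.indicator hs)]
  refine lintegral_congr fun d => ?_
  have hgo : ∀ o, Measurable (g o) := fun o => h.1.comp measurable_prodMk_left
  have hm : Measurable fun (w : Fin n → ℝ) i => g (d i) (w i) :=
    measurable_pi_lambda _ fun i => (hgo (d i)).comp (measurable_pi_apply i)
  exact lintegral_indicator_one (hm hs)

end Refresh

section RefreshLimit

variable {O : ℕ → Type} [∀ n, MeasurableSpace (O n)] {L : ∀ n, Measure (O n)}
  [∀ n, IsProbabilityMeasure (L n)] {κ : ∀ n, Kernel (O n) ℝ} [∀ n, IsMarkovKernel (κ n)]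
  {g : ∀ n, O n → ℝ → O n}

/-- An event has probability tending to one as soon as its conditional probability given the part
of the sample that is not redrawn tends to one in probability. -/
theorem eventually_of_refresh (h : ∀ n ≥ 1, IsRefresh (L n) (κ n) (g n))
    {s : ∀ n, Set (Fin n → O n)} (hs : ∀ n, MeasurableSet (s n))
    (hlim : ∀ ε : ℝ≥0∞, 0 < ε → ∀ᶠ a : Σ n, Fin n → O n in whp fun n => Measure.pi fun _ : Fin n => L n,
      (Measure.pi fun i => κ a.1 (a.2 i)) {w | (fun i => g a.1 (a.2 i) (w i)) ∉ s a.1} ≤ ε) :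
    ∀ᶠ a : Σ n, Fin n → O n in whp fun n => Measure.pi fun _ : Fin n => L n, a.2 ∈ s a.1 := by
  rw [eventually_whp, ENNReal.tendsto_nhds_zero]
  intro ε hε
  have hε2 : 0 < ε / 2 := ENNReal.half_pos hε.ne'
  have hev := eventually_whp.1 (hlim (ε / 2) hε2)
  rw [ENNReal.tendsto_nhds_zero] at hev
  filter_upwards [hev (ε / 2) hε2, eventually_ge_atTop 1] with n hn hn1
  have heq := (h n hn1).measure_pi (n := n) (hs n).compl
  refine le_trans (le_of_eq heq) ?_
  set B : Set (Fin n → O n) := {d | ¬ (Measure.pi fun i => κ n (d i))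
    {w | (fun i => g n (d i) (w i)) ∉ s n} ≤ ε / 2}
  calc _ ≤ ∫⁻ d, (ε / 2 + B.indicator 1 d) ∂(Measure.pi fun _ => L n) := by
        refine lintegral_mono fun d => ?_
        by_cases hd : d ∈ B
        · rw [Set.indicator_of_mem hd]
          exact le_add_left prob_le_one
        · exact le_add_right (not_not.1 hd)
    _ = ε / 2 + ∫⁻ d, B.indicator 1 d ∂(Measure.pi fun _ => L n) := by
        rw [lintegral_add_left measurable_const]; simp
    _ ≤ ε / 2 + ε / 2 := by
        gcongr
        exact le_trans (lintegral_indicator_one_le B) hn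
    _ = ε := ENNReal.add_halves ε

/-- Conditional Markov inequality: a nonnegative statistic tends to zero in probability as soon as
its conditional expectation does. -/
theorem tendsto_zero_of_refresh (h : ∀ n ≥ 1, IsRefresh (L n) (κ n) (g n))
    {f : ∀ n, (Fin n → O n) → ℝ≥0∞} (hf : ∀ n, Measurable (f n))
    (hlim : Tendsto (fun a : Σ n, Fin n → O n =>
      ∫⁻ w, f a.1 (fun i => g a.1 (a.2 i) (w i)) ∂(Measure.pi fun i => κ a.1 (a.2 i)))
      (whp fun n => Measure.pi fun _ : Fin n => L n) (𝓝 0)) :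
    Tendsto (fun a : Σ n, Fin n → O n => f a.1 a.2)
      (whp fun n => Measure.pi fun _ : Fin n => L n) (𝓝 0) := by
  rw [ENNReal.tendsto_nhds_zero]
  intro t ht
  rcases eq_or_ne t ∞ with rfl | htt
  · simp
  refine eventually_of_refresh h (s := fun n => {d | f n d ≤ t})
    (fun n => measurableSet_le (hf n) measurable_const) fun ε hε => ?_
  rw [ENNReal.tendsto_nhds_zero] at hlim
  by_cases hεt : ε = ∞
  · simp [hεt]
  filter_upwards [hlim (t * ε) (ENNReal.mul_pos ht.ne' hε.ne'),
    tendsto_fst_whp.eventually (eventually_ge_atTop 1)] with a ha ha1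
  have hm : Measurable fun (w : Fin a.1 → ℝ) i => g a.1 (a.2 i) (w i) :=
    measurable_pi_lambda _ fun i =>
      ((h a.1 ha1).1.comp measurable_prodMk_left).comp (measurable_pi_apply i)
  calc _ ≤ (Measure.pi fun i => κ a.1 (a.2 i)) {w | t ≤ f a.1 (fun i => g a.1 (a.2 i) (w i))} :=
        measure_mono fun w hw => (not_le.1 hw).le
    _ ≤ (∫⁻ w, f a.1 (fun i => g a.1 (a.2 i) (w i)) ∂(Measure.pi fun i => κ a.1 (a.2 i))) / t :=
        meas_ge_le_lintegral_div ((hf _).comp hm).aemeasurable ht.ne' htt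
    _ ≤ t * ε / t := by gcongr
    _ = ε := by rw [mul_comm, ENNReal.mul_div_cancel_right ht.ne' htt]

end RefreshLimit

/-! ### Inequalities for sums of independent variables -/

section Independent

variable {ι : Type*} [Fintype ι] {Ω : Type*} [MeasurableSpace Ω] (μ : ι → Measure Ω)
  [∀ i, IsProbabilityMeasure (μ i)] {f : ι → Ω → ℝ}

theorem lintegral_pi_eval {h : Ω → ℝ≥0∞} (i : ι) (hh : Measurable h) :
    ∫⁻ ω, h (ω i) ∂(Measure.pi μ) = ∫⁻ o, h o ∂(μ i) :=
  (measurePreserving_eval μ i).lintegral_comp hh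

theorem lintegral_pi_sum {h : ι → Ω → ℝ≥0∞} (hh : ∀ i, Measurable (h i)) :
    ∫⁻ ω, ∑ i, h i (ω i) ∂(Measure.pi μ) = ∑ i, ∫⁻ o, h i o ∂(μ i) := by
  have hm : ∀ i ∈ Finset.univ, Measurable fun ω : ι → Ω => h i (ω i) := fun i _ =>
    (hh i).comp (measurable_pi_apply i)
  rw [lintegral_finsetSum _ hm]
  exact Finset.sum_congr rfl fun i _ => lintegral_pi_eval μ i (hh i)

/-- Chebyshev's inequality for independent variables, without integrability assumptions: a
variable that is not square integrable makes the right-hand side infinite. -/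
theorem measure_pi_chebyshev (hf : ∀ i, Measurable (f i)) {t : ℝ} (ht : 0 < t) :
    (Measure.pi μ) {ω | t ≤ |∑ i, f i (ω i) - ∑ i, ∫ o, f i o ∂(μ i)|} ≤
      (∑ i, eVar[f i; μ i]) / ENNReal.ofReal (t ^ 2) := by
  by_cases hfin : ∀ i, MemLp (f i) 2 (μ i)
  · have hmem : ∀ i, MemLp (fun ω : ι → Ω => f i (ω i)) 2 (Measure.pi μ) := fun i =>
      (hfin i).comp_measurePreserving (measurePreserving_eval μ i)
    have hsum : MemLp (fun ω : ι → Ω => ∑ i, f i (ω i)) 2 (Measure.pi μ) :=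
      memLp_finsetSum _ fun i _ => hmem i
    have h := meas_ge_le_variance_div_sq hsum ht
    have hv : Var[fun ω : ι → Ω => ∑ i, f i (ω i); Measure.pi μ] = ∑ i, Var[f i; μ i] := by
      rw [← variance_sum_pi hfin]
      congr 1
      ext ω
      simp
    have hE : ∫ ω, ∑ i, f i (ω i) ∂(Measure.pi μ) = ∑ i, ∫ o, f i o ∂(μ i) := by
      rw [integral_finsetSum _ fun i _ => (hmem i).integrable one_le_two]
      refine Finset.sum_congr rfl fun i _ => ?_
      exact integral_comp_eval (hfin i).aestronglyMeasurable
    rw [hE, hv, ENNReal.ofReal_div_of_pos (by positivity),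
      ENNReal.ofReal_sum_of_nonneg fun i _ => variance_nonneg _ _] at h
    simp_rw [fun i => ofReal_variance (hfin i)] at h
    exact h
  · push Not at hfin
    obtain ⟨i, hi⟩ := hfin
    have : ∑ i, eVar[f i; μ i] = ∞ := by
      refine ENNReal.sum_eq_top.2 ⟨i, Finset.mem_univ i, ?_⟩
      exact evariance_eq_top (hf i).aestronglyMeasurable hi
    rw [this, ENNReal.top_div_of_ne_top ENNReal.ofReal_ne_top]
    exact le_top

/-- Weak law of large numbers for nonnegative independent variables, with an explicit bound. The
variables are truncated at height `η`; a moment of order `q > 1` controls what is cut off. -/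
theorem measure_pi_weak_law (hf : ∀ i, Measurable (f i)) (hf0 : ∀ i o, 0 ≤ f i o)
    (hint : ∀ i, Integrable (f i) (μ i)) {q η t : ℝ} (hq : 1 < q) (hη : 0 < η) (ht : 0 < t) :
    (Measure.pi μ) {ω | t ≤ |∑ i, f i (ω i) - ∑ i, ∫ o, f i o ∂(μ i)|} ≤
      ENNReal.ofReal (4 * η / t ^ 2 * ∑ i, ∫ o, f i o ∂(μ i)) +
        ENNReal.ofReal (2 * η ^ (1 - q) / t) * ∑ i, ∫⁻ o, ENNReal.ofReal (f i o ^ q) ∂(μ i) := by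
  set g : ι → Ω → ℝ := fun i o => min (f i o) η with hg
  have hgm : ∀ i, Measurable (g i) := fun i => (hf i).min measurable_const
  have hg0 : ∀ i o, 0 ≤ g i o := fun i o => le_min (hf0 i o) hη.le
  have hgf : ∀ i o, g i o ≤ f i o := fun i o => min_le_left _ _
  have hgη : ∀ i o, g i o ≤ η := fun i o => min_le_right _ _
  have hgint : ∀ i, Integrable (g i) (μ i) := fun i =>
    (hint i).mono' (hgm i).aestronglyMeasurable
      (ae_of_all _ fun o => by rw [Real.norm_of_nonneg (hg0 i o)]; exact hgf i o)
  have hcut : ∀ i o, f i o - g i o ≤ η ^ (1 - q) * f i o ^ q := by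
    intro i o
    rcases le_or_gt (f i o) η with h | h
    · rw [hg]
      simp only [min_eq_left h, sub_self]
      have := hf0 i o
      positivity
    · have hpos : 0 < f i o := hη.trans h
      have h1 : f i o ^ q = f i o ^ (q - 1) * f i o := by
        rw [← Real.rpow_add_one hpos.ne']; ring_nf
      have h2 : η ^ (q - 1) ≤ f i o ^ (q - 1) :=
        Real.rpow_le_rpow hη.le h.le (by linarith)
      have h3 : η ^ (1 - q) * η ^ (q - 1) = 1 := by
        rw [← Real.rpow_add hη]; simp
      have h4 : 1 ≤ η ^ (1 - q) * f i o ^ (q - 1) := by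
        calc 1 = η ^ (1 - q) * η ^ (q - 1) := h3.symm
          _ ≤ _ := by gcongr
      rw [h1, ← mul_assoc]
      nlinarith [hg0 i o]
  set M := ∑ i, ∫⁻ o, ENNReal.ofReal (f i o ^ q) ∂(μ i) with hM
  have hD : ∑ i, ∫⁻ o, ENNReal.ofReal (f i o - g i o) ∂(μ i) ≤ ENNReal.ofReal (η ^ (1 - q)) * M := by
    rw [hM, Finset.mul_sum]
    refine Finset.sum_le_sum fun i _ => ?_
    rw [← lintegral_const_mul _ ((hf i).pow_const q).ennreal_ofReal]
    refine lintegral_mono fun o => ?_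
    rw [← ENNReal.ofReal_mul (by positivity)]
    exact ENNReal.ofReal_le_ofReal (hcut i o)
  have hDreal : ENNReal.ofReal (∑ i, ∫ o, (f i o - g i o) ∂(μ i)) ≤
      ENNReal.ofReal (η ^ (1 - q)) * M := by
    refine le_trans (le_of_eq ?_) hD
    rw [ENNReal.ofReal_sum_of_nonneg fun i _ => integral_nonneg fun o => sub_nonneg.2 (hgf i o)]
    refine Finset.sum_congr rfl fun i _ => ?_
    exact ofReal_integral_eq_lintegral_ofReal ((hint i).sub (hgint i))
      (ae_of_all _ fun o => sub_nonneg.2 (hgf i o))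
  have hc : ENNReal.ofReal (2 * η ^ (1 - q) / t) =
      ENNReal.ofReal (η ^ (1 - q)) / ENNReal.ofReal (t / 2) := by
    rw [← ENNReal.ofReal_div_of_pos (by positivity)]
    congr 1
    field_simp
  have ht2 : 0 < t / 2 := by positivity
  -- If the truncation removes at least `t / 2` from the expectation, the second term of the bound is
  -- at least one.
  by_cases hcase : t / 2 ≤ ∑ i, ∫ o, (f i o - g i o) ∂(μ i)
  · refine le_trans prob_le_one (le_add_left ?_)
    rw [hc, ENNReal.mul_comm_div, ← mul_div_assoc]
    rw [ENNReal.le_div_iff_mul_le (Or.inl (by simpa using ht)) (Or.inl ENNReal.ofReal_ne_top),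
      one_mul]
    exact (ENNReal.ofReal_le_ofReal hcase).trans hDreal
  · have hsub : {ω : ι → Ω | t ≤ |∑ i, f i (ω i) - ∑ i, ∫ o, f i o ∂(μ i)|} ⊆
        {ω | t / 2 ≤ |∑ i, g i (ω i) - ∑ i, ∫ o, g i o ∂(μ i)|} ∪
        {ω | ENNReal.ofReal (t / 2) ≤ ∑ i, ENNReal.ofReal (f i (ω i) - g i (ω i))} := by
      intro ω hω
      by_contra hcon
      simp only [Set.mem_union, Set.mem_ofPred_eq, not_or, not_le] at hcon hω
      obtain ⟨h1, h2⟩ := hcon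
      rw [← ENNReal.ofReal_sum_of_nonneg fun i _ => sub_nonneg.2 (hgf i (ω i)),
        ENNReal.ofReal_lt_ofReal_iff ht2] at h2
      have h0 : 0 ≤ ∑ i, (f i (ω i) - g i (ω i)) :=
        Finset.sum_nonneg fun i _ => sub_nonneg.2 (hgf i (ω i))
      have h0' : 0 ≤ ∑ i, ∫ o, (f i o - g i o) ∂(μ i) :=
        Finset.sum_nonneg fun i _ => integral_nonneg fun o => sub_nonneg.2 (hgf i o)
      simp_rw [fun i => integral_sub (hint i) (hgint i)] at hcase h0'
      rw [Finset.sum_sub_distrib] at h2 h0 hcase h0'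
      rw [abs_lt] at h1
      have : |∑ i, f i (ω i) - ∑ i, ∫ o, f i o ∂(μ i)| < t := by
        rw [abs_lt]; constructor <;> linarith
      linarith
    refine (measure_mono hsub).trans ((measure_union_le _ _).trans (add_le_add ?_ ?_))
    · refine (measure_pi_chebyshev μ hgm ht2).trans ?_
      have hvar : ∀ i, eVar[g i; μ i] ≤ ENNReal.ofReal (η * ∫ o, f i o ∂(μ i)) := by
        intro i
        have hmem : MemLp (g i) 2 (μ i) :=
          MemLp.of_bound (hgm i).aestronglyMeasurable η
            (ae_of_all _ fun o => by rw [Real.norm_of_nonneg (hg0 i o)]; exact hgη i o)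
        rw [← ofReal_variance hmem]
        refine ENNReal.ofReal_le_ofReal ((variance_le_expectation_sq hmem.aestronglyMeasurable).trans ?_)
        rw [← integral_const_mul]
        refine integral_mono hmem.integrable_sq ((hint i).const_mul η) fun o => ?_
        simp only [Pi.pow_apply]
        nlinarith [hg0 i o, hgf i o, hgη i o]
      have hrw : 4 * η / t ^ 2 * ∑ i, ∫ o, f i o ∂(μ i) =
          (∑ i, η * ∫ o, f i o ∂(μ i)) / (t / 2) ^ 2 := by
        rw [← Finset.mul_sum]
        field_simp
        ring
      rw [hrw, ENNReal.ofReal_div_of_pos (by positivity), ENNReal.ofReal_sum_of_nonneg fun i _ =>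
        mul_nonneg hη.le (integral_nonneg (hf0 i))]
      gcongr with i
      exact hvar i
    · have hmeas : ∀ i, Measurable fun o => ENNReal.ofReal (f i o - g i o) := fun i =>
        ((hf i).sub (hgm i)).ennreal_ofReal
      have hms : Measurable fun ω : ι → Ω => ∑ i, ENNReal.ofReal (f i (ω i) - g i (ω i)) :=
        Finset.measurable_fun_sum _ fun i _ => (hmeas i).comp (measurable_pi_apply i)
      refine (meas_ge_le_lintegral_div hms.aemeasurable (by simpa using ht)
        ENNReal.ofReal_ne_top).trans ?_
      rw [lintegral_pi_sum μ hmeas, hc, ENNReal.mul_comm_div, ← mul_div_assoc]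
      gcongr

end Independent

/-- Chebyshev's inequality for a linear combination of independent centred variables. Laws without
a mean are allowed: their variance is infinite. -/
theorem measure_pi_chebyshev_linear {ι : Type*} [Fintype ι] (ν : ι → Measure ℝ)
    [∀ i, IsProbabilityMeasure (ν i)] (c : ι → ℝ) {t : ℝ} (ht : 0 < t) :
    (Measure.pi ν) {w | t ≤ |∑ i, c i * (w i - ∫ x, x ∂(ν i))|} ≤
      (∑ i, ENNReal.ofReal (c i ^ 2) * eVar[id; ν i]) / ENNReal.ofReal (t ^ 2) := by
  have h := measure_pi_chebyshev ν (f := fun i x => c i * (x - ∫ x, x ∂(ν i)))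
    (fun i => by fun_prop) ht
  have hshift : ∀ i, Integrable (fun x : ℝ => x - ∫ x, x ∂(ν i)) (ν i) →
      Integrable (fun x : ℝ => x) (ν i) := fun i hi => by
    refine (hi.add (integrable_const (∫ x, x ∂(ν i)))).congr (ae_of_all _ fun x => ?_)
    simp
  have h0 : ∀ i, ∫ o, c i * (o - ∫ x, x ∂(ν i)) ∂(ν i) = 0 := by
    intro i
    rw [integral_const_mul]
    by_cases hi : Integrable (fun x : ℝ => x) (ν i)
    · rw [integral_sub hi (integrable_const _)]; simp
    -- The integrals of `x` and of `x` minus a constant both have the value zero by convention.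
    · rw [integral_undef fun hcon => hi (hshift i hcon), mul_zero]
  have hv : ∀ i, eVar[fun x => c i * (x - ∫ x, x ∂(ν i)); ν i] =
      ENNReal.ofReal (c i ^ 2) * eVar[id; ν i] := by
    intro i
    rw [evariance_mul]
    congr 1
    have h1 := h0 i
    unfold evariance
    by_cases hi : Integrable (fun x : ℝ => x) (ν i)
    · have : ∫ o, (o - ∫ x, x ∂(ν i)) ∂(ν i) = 0 := by
        rw [integral_sub hi (integrable_const _)]; simp
      rw [this]
      simp
    · rw [integral_undef fun hcon => hi (hshift i hcon), integral_undef (f := id) hi, integral_undef hi]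
      simp
  simp only [h0, hv, Finset.sum_const_zero, sub_zero] at h
  exact h

/-! ### Lyapunov's central limit theorem for triangular arrays -/

/-- Second-order Taylor bound for the characters of `ℝ`, in a form that a moment of order `2 + δ`
controls: the remainder is at most `|x|³ ≤ η x²` for `|x| ≤ η`, and at most `4 x²` beyond. -/
theorem norm_cexp_sub_taylor_le (x : ℝ) {η δ : ℝ} (hη : 0 < η) (hη1 : η ≤ 1) (hδ : 0 < δ) :
    ‖Complex.exp (x * Complex.I) - (1 + x * Complex.I - (x : ℂ) ^ 2 / 2)‖ ≤
      4 * (η * x ^ 2 + η ^ (-δ) * |x| ^ (2 + δ)) := by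
  have hp : 0 ≤ η ^ (-δ) * |x| ^ (2 + δ) := by positivity
  rcases le_or_gt |x| η with h | h
  · have hx : ‖(x : ℂ) * Complex.I‖ = |x| := by simp
    have hb := Complex.exp_bound (x := (x : ℂ) * Complex.I) (n := 3) (by rw [hx]; linarith)
      (by norm_num)
    have hs : ∑ m ∈ Finset.range 3, ((x : ℂ) * Complex.I) ^ m / (m.factorial : ℂ) =
        1 + x * Complex.I - (x : ℂ) ^ 2 / 2 := by
      simp [Finset.sum_range_succ, mul_pow, Nat.factorial]
      ring
    rw [hs, hx] at hb
    refine hb.trans ?_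
    have h3 : |x| ^ 3 ≤ η * x ^ 2 := by
      rw [pow_succ, sq_abs, mul_comm]
      gcongr
    have : ((Nat.succ 3 : ℝ) * (((Nat.factorial 3 : ℕ) : ℝ) * (3 : ℕ))⁻¹) = 2 / 9 := by
      norm_num [Nat.factorial]
    rw [this]
    nlinarith [pow_nonneg (abs_nonneg x) 3]
  · have hpos : 0 < |x| := hη.trans h
    have hbig : x ^ 2 ≤ η ^ (-δ) * |x| ^ (2 + δ) := by
      rw [add_comm, Real.rpow_add hpos, ← mul_assoc, Real.rpow_two, sq_abs]
      have h1 : η ^ δ ≤ |x| ^ δ := Real.rpow_le_rpow hη.le h.le hδ.le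
      have h2 : 1 ≤ η ^ (-δ) * |x| ^ δ := by
        calc 1 = η ^ (-δ) * η ^ δ := by rw [← Real.rpow_add hη]; simp
          _ ≤ _ := by gcongr
      nlinarith [sq_nonneg x]
    have hη2 : 0 ≤ η * x ^ 2 := by positivity
    rcases le_or_gt |x| 1 with h1 | h1
    · have hx : ‖(x : ℂ) * Complex.I‖ = |x| := by simp
      have hb := Complex.exp_bound (x := (x : ℂ) * Complex.I) (n := 3) (by rw [hx]; linarith)
        (by norm_num)
      have hs : ∑ m ∈ Finset.range 3, ((x : ℂ) * Complex.I) ^ m / (m.factorial : ℂ) =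
          1 + x * Complex.I - (x : ℂ) ^ 2 / 2 := by
        simp [Finset.sum_range_succ, mul_pow, Nat.factorial]
        ring
      rw [hs, hx] at hb
      refine hb.trans ?_
      have h3 : |x| ^ 3 ≤ x ^ 2 := by
        rw [pow_succ, sq_abs]
        nlinarith [sq_nonneg x]
      have : ((Nat.succ 3 : ℝ) * (((Nat.factorial 3 : ℕ) : ℝ) * (3 : ℕ))⁻¹) = 2 / 9 := by
        norm_num [Nat.factorial]
      rw [this]
      nlinarith [pow_nonneg (abs_nonneg x) 3]
    · have hn : ‖Complex.exp (x * Complex.I) - (1 + x * Complex.I - (x : ℂ) ^ 2 / 2)‖ ≤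
          1 + (1 + |x| + |x| ^ 2 / 2) := by
        refine (norm_sub_le _ _).trans ?_
        rw [Complex.norm_exp_ofReal_mul_I]
        gcongr
        refine (norm_sub_le _ _).trans ?_
        gcongr
        · refine (norm_add_le _ _).trans ?_
          simp
        · simp
      have : |x| ^ 2 = x ^ 2 := sq_abs x
      nlinarith

theorem norm_charFun_sub_taylor_le {ν : Measure ℝ} [IsProbabilityMeasure ν] (h2 : MemLp id 2 ν)
    (hmean : ∫ x, x ∂ν = 0) {η δ : ℝ} (hη : 0 < η) (hη1 : η ≤ 1) (hδ : 0 < δ)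
    (hM : Integrable (fun x => |x| ^ (2 + δ)) ν) (t : ℝ) :
    ‖charFun ν t - (1 - t ^ 2 * Var[id; ν] / 2 : ℝ)‖ ≤
      4 * (η * t ^ 2 * Var[id; ν] + η ^ (-δ) * |t| ^ (2 + δ) * ∫ x, |x| ^ (2 + δ) ∂ν) := by
  have hsq : Integrable (fun x : ℝ => x ^ 2) ν := h2.integrable_sq
  have hid : Integrable (fun x : ℝ => x) ν := h2.integrable one_le_two
  have hv : Var[id; ν] = ∫ x, x ^ 2 ∂ν := by
    rw [variance_of_integral_eq_zero aemeasurable_id hmean]; rfl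
  have hexp : Integrable (fun x : ℝ => Complex.exp ((t * x : ℝ) * Complex.I)) ν := by
    refine (integrable_const (1 : ℝ)).mono' (by fun_prop) (ae_of_all _ fun x => ?_)
    rw [Complex.norm_exp_ofReal_mul_I]
  have hT1 : Integrable (fun x : ℝ => ((t * x : ℝ) : ℂ) * Complex.I) ν :=
    ((hid.const_mul t).ofReal).mul_const _
  have hT2 : Integrable (fun x : ℝ => ((t * x : ℝ) : ℂ) ^ 2 / 2) ν := by
    refine (((hsq.const_mul (t ^ 2)).ofReal (𝕜 := ℂ)).div_const 2).congr (ae_of_all _ fun x => ?_)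
    change ((t ^ 2 * x ^ 2 : ℝ) : ℂ) / 2 = _
    push_cast; ring
  have hT3 : Integrable (fun x : ℝ => 1 + ((t * x : ℝ) : ℂ) * Complex.I) ν :=
    (integrable_const 1).add hT1
  have hT4 : Integrable
      (fun x : ℝ => 1 + ((t * x : ℝ) : ℂ) * Complex.I - ((t * x : ℝ) : ℂ) ^ 2 / 2) ν := hT3.sub hT2
  have hint : ∫ x : ℝ, (1 + ((t * x : ℝ) : ℂ) * Complex.I - ((t * x : ℝ) : ℂ) ^ 2 / 2) ∂ν =
      ((1 - t ^ 2 * Var[id; ν] / 2 : ℝ) : ℂ) := by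
    rw [integral_sub hT3 hT2, integral_add (integrable_const _) hT1,
      integral_mul_const, integral_complex_ofReal, integral_const_mul, hmean, hv]
    have : ∫ x : ℝ, ((t * x : ℝ) : ℂ) ^ 2 / 2 ∂ν = ((t ^ 2 * (∫ x, x ^ 2 ∂ν) / 2 : ℝ) : ℂ) := by
      rw [← integral_const_mul, ← integral_div, ← integral_complex_ofReal]
      refine integral_congr_ae (ae_of_all _ fun x => ?_)
      push_cast; ring
    rw [this]
    simp
  have hchar : charFun ν t = ∫ x : ℝ, Complex.exp ((t * x : ℝ) * Complex.I) ∂ν := by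
    rw [charFun_apply_real]
    refine integral_congr_ae (ae_of_all _ fun x => ?_)
    push_cast; rfl
  rw [hchar, ← hint, ← integral_sub hexp hT4, hv]
  refine (norm_integral_le_of_norm_le (g := fun x => 4 * (η * t ^ 2 * x ^ 2 +
    η ^ (-δ) * |t| ^ (2 + δ) * |x| ^ (2 + δ))) ?_ (ae_of_all _ fun x => ?_)).trans (le_of_eq ?_)
  · exact ((hsq.const_mul _).add (hM.const_mul _)).const_mul _
  · refine (norm_cexp_sub_taylor_le (t * x) hη hη1 hδ).trans (le_of_eq ?_)
    rw [abs_mul, Real.mul_rpow (abs_nonneg _) (abs_nonneg _)]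
    ring
  · rw [integral_const_mul, integral_add (hsq.const_mul _) (hM.const_mul _), integral_const_mul,
      integral_const_mul]

/-- Products of complex numbers in the unit disc differ by at most the sum of the differences of the
factors. -/
theorem norm_prod_sub_prod_le {ι : Type*} (s : Finset ι) {a b : ι → ℂ} (ha : ∀ i, ‖a i‖ ≤ 1)
    (hb : ∀ i, ‖b i‖ ≤ 1) : ‖∏ i ∈ s, a i - ∏ i ∈ s, b i‖ ≤ ∑ i ∈ s, ‖a i - b i‖ := by
  classical
  induction s using Finset.induction_on with
  | empty => simp
  | insert j s hj ih =>
    rw [Finset.prod_insert hj, Finset.prod_insert hj, Finset.sum_insert hj]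
    have hbs : ‖∏ i ∈ s, b i‖ ≤ 1 := by
      rw [norm_prod]
      exact Finset.prod_le_one (fun i _ => norm_nonneg _) fun i _ => hb i
    have : a j * ∏ i ∈ s, a i - b j * ∏ i ∈ s, b i =
        (a j - b j) * ∏ i ∈ s, b i + a j * (∏ i ∈ s, a i - ∏ i ∈ s, b i) := by ring
    rw [this]
    refine (norm_add_le _ _).trans ?_
    rw [norm_mul, norm_mul]
    gcongr
    · exact mul_le_of_le_one_right (norm_nonneg _) hbs
    · exact (mul_le_of_le_one_left (norm_nonneg _) (ha j)).trans ih

theorem abs_exp_neg_sub_le {u : ℝ} (hu : 0 ≤ u) : |Real.exp (-u) - (1 - u)| ≤ u ^ 2 := by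
  rcases le_or_gt u 1 with h | h
  · have := Real.abs_exp_sub_one_sub_id_le (x := -u) (by rwa [abs_neg, abs_of_nonneg hu])
    rw [neg_sq] at this
    convert this using 2
    ring
  · have h1 : Real.exp (-u) ≤ 1 := Real.exp_le_one_iff.2 (by linarith)
    have h2 := Real.exp_pos (-u)
    rw [abs_le]
    constructor <;> nlinarith

/-- A product of characteristic functions of centred laws compared with the Gaussian one. -/
theorem norm_charFun_pi_sum_sub_le {ι : Type*} [Fintype ι] {ν : ι → Measure ℝ}
    [∀ i, IsProbabilityMeasure (ν i)] (h2 : ∀ i, MemLp id 2 (ν i))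
    (hmean : ∀ i, ∫ x, x ∂(ν i) = 0) {η δ : ℝ} (hη : 0 < η) (hη1 : η ≤ 1) (hδ : 0 < δ)
    (hM : ∀ i, Integrable (fun x => |x| ^ (2 + δ)) (ν i)) (t : ℝ) :
    ‖charFun ((Measure.pi ν).map fun w => ∑ i, w i) t -
        (Real.exp (-(t ^ 2 * (∑ i, Var[id; ν i]) / 2)) : ℝ)‖ ≤
      4 * (η * t ^ 2 * (∑ i, Var[id; ν i]) +
        η ^ (-δ) * |t| ^ (2 + δ) * ∑ i, ∫ x, |x| ^ (2 + δ) ∂(ν i)) +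
      t ^ 4 * (∑ i, Var[id; ν i]) * (η ^ 2 + η ^ (-δ) * ∑ i, ∫ x, |x| ^ (2 + δ) ∂(ν i)) := by
  have hMn : ∀ i, 0 ≤ ∫ x, |x| ^ (2 + δ) ∂(ν i) := fun i => integral_nonneg fun x => by positivity
  have hvM : ∀ i, Var[id; ν i] ≤ η ^ 2 + η ^ (-δ) * ∑ i, ∫ x, |x| ^ (2 + δ) ∂(ν i) := by
    intro i
    have hv : Var[id; ν i] = ∫ x, x ^ 2 ∂(ν i) := by
      rw [variance_of_integral_eq_zero aemeasurable_id (hmean i)]; rfl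
    have h1 : ∫ x, x ^ 2 ∂(ν i) ≤ ∫ x, (η ^ 2 + η ^ (-δ) * |x| ^ (2 + δ)) ∂(ν i) := by
      refine integral_mono (h2 i).integrable_sq
        ((integrable_const _).add ((hM i).const_mul _)) fun x => ?_
      simp only
      rcases le_or_gt |x| η with h | h
      · have : x ^ 2 ≤ η ^ 2 := by
          rw [← sq_abs x]; gcongr
        have hp : 0 ≤ η ^ (-δ) * |x| ^ (2 + δ) := by positivity
        linarith
      · have hpos : 0 < |x| := hη.trans h
        rw [add_comm 2 δ, Real.rpow_add hpos, ← mul_assoc, Real.rpow_two, sq_abs]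
        have h1 : η ^ δ ≤ |x| ^ δ := Real.rpow_le_rpow hη.le h.le hδ.le
        have h2 : 1 ≤ η ^ (-δ) * |x| ^ δ := by
          calc 1 = η ^ (-δ) * η ^ δ := by rw [← Real.rpow_add hη]; simp
            _ ≤ _ := by gcongr
        nlinarith [sq_nonneg x, sq_nonneg η]
    rw [hv]
    refine h1.trans ?_
    rw [integral_add (integrable_const _) ((hM i).const_mul _), integral_const_mul]
    simp only [integral_const, probReal_univ, smul_eq_mul, one_mul]
    gcongr
    exact Finset.single_le_sum (fun j _ => hMn j) (Finset.mem_univ i)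
  have hprod : ((Real.exp (-(t ^ 2 * (∑ i, Var[id; ν i]) / 2)) : ℝ) : ℂ) =
      ∏ i, ((Real.exp (-(t ^ 2 * Var[id; ν i] / 2)) : ℝ) : ℂ) := by
    rw [← Complex.ofReal_prod, ← Real.exp_sum, Finset.sum_neg_distrib, Finset.mul_sum,
      Finset.sum_div]
  rw [charFun_map_sum_pi_eq_prod, hprod, Finset.prod_apply]
  refine (norm_prod_sub_prod_le _ (fun i => norm_charFun_le_one _) fun i => ?_).trans ?_
  · rw [Complex.norm_real, Real.norm_of_nonneg (Real.exp_pos _).le, Real.exp_le_one_iff]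
    have := variance_nonneg id (ν i)
    have : 0 ≤ t ^ 2 * Var[id; ν i] / 2 := by positivity
    linarith
  calc _ ≤ ∑ i, (4 * (η * t ^ 2 * Var[id; ν i] +
          η ^ (-δ) * |t| ^ (2 + δ) * ∫ x, |x| ^ (2 + δ) ∂(ν i)) +
        t ^ 4 * Var[id; ν i] * (η ^ 2 + η ^ (-δ) * ∑ i, ∫ x, |x| ^ (2 + δ) ∂(ν i))) := by
        refine Finset.sum_le_sum fun i _ => ?_
        have hv0 := variance_nonneg id (ν i)
        have hu : 0 ≤ t ^ 2 * Var[id; ν i] / 2 := by positivity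
        have ha := norm_charFun_sub_taylor_le (h2 i) (hmean i) hη hη1 hδ (hM i) t
        have hb := abs_exp_neg_sub_le hu
        have hbc : ‖((1 - t ^ 2 * Var[id; ν i] / 2 : ℝ) : ℂ) -
            ((Real.exp (-(t ^ 2 * Var[id; ν i] / 2)) : ℝ) : ℂ)‖ ≤
            (t ^ 2 * Var[id; ν i] / 2) ^ 2 := by
          rw [← Complex.ofReal_sub, Complex.norm_real, Real.norm_eq_abs, abs_sub_comm]
          exact hb
        refine (norm_sub_le_norm_sub_add_norm_sub _ _ _).trans (add_le_add ha (hbc.trans ?_))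
        have h4 : (t ^ 2 * Var[id; ν i] / 2) ^ 2 = t ^ 4 * Var[id; ν i] * (Var[id; ν i] / 4) := by
          ring
        rw [h4]
        gcongr
        exact le_trans (by linarith) (hvM i)
    _ = _ := by
        rw [Finset.sum_add_distrib, ← Finset.mul_sum, Finset.sum_add_distrib, ← Finset.mul_sum,
          ← Finset.mul_sum, ← Finset.sum_mul, ← Finset.mul_sum]

/-- Lyapunov's theorem along a sequence, at the level of characteristic functions. -/
theorem tendsto_charFun_pi_sum {β : Type*} {l : Filter β} {ι : β → Type*} [∀ b, Fintype (ι b)]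
    {ν : ∀ b, ι b → Measure ℝ} [∀ b i, IsProbabilityMeasure (ν b i)] {δ : ℝ} (hδ : 0 < δ)
    (h2 : ∀ᶠ b in l, ∀ i, MemLp id 2 (ν b i)) (hmean : ∀ᶠ b in l, ∀ i, ∫ x, x ∂(ν b i) = 0)
    (hV : Tendsto (fun b => ∑ i, Var[id; ν b i]) l (𝓝 1))
    (hM : Tendsto (fun b => ∑ i, absMoment (ν b i) 0 (2 + δ)) l (𝓝 0)) (t : ℝ) :
    Tendsto (fun b => charFun ((Measure.pi (ν b)).map fun w => ∑ i, w i) t) l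
      (𝓝 (charFun (gaussianReal 0 1) t)) := by
  have hfin : ∀ᶠ b in l, ∀ i, absMoment (ν b i) 0 (2 + δ) ≠ ∞ := by
    filter_upwards [hM.eventually_ne ENNReal.zero_ne_top] with b hb i hi
    exact hb (ENNReal.sum_eq_top.2 ⟨i, Finset.mem_univ i, hi⟩)
  have hint : ∀ᶠ b in l, ∀ i, Integrable (fun x => |x| ^ (2 + δ)) (ν b i) := by
    filter_upwards [hfin] with b hb i
    refine (lintegral_ofReal_ne_top_iff_integrable
      (measurable_id.abs.pow_const _).aestronglyMeasurable
      (ae_of_all _ fun x => by simp only [Pi.zero_apply]; positivity)).1 ?_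
    simpa [absMoment] using hb i
  have hMr : Tendsto (fun b => ∑ i, ∫ x, |x| ^ (2 + δ) ∂(ν b i)) l (𝓝 0) := by
    have h := (ENNReal.tendsto_toReal ENNReal.zero_ne_top).comp hM
    refine (h.congr' ?_)
    filter_upwards [hfin, hint] with b hb hi
    simp only [Function.comp]
    rw [ENNReal.toReal_sum fun i _ => hb i]
    refine Finset.sum_congr rfl fun i _ => ?_
    rw [integral_eq_lintegral_of_nonneg_ae (ae_of_all _ fun x => by
      simp only [Pi.zero_apply]; positivity) (hi i).aestronglyMeasurable]
    simp [absMoment]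
  have hgauss : charFun (gaussianReal 0 1) t = ((Real.exp (-(t ^ 2 * 1 / 2)) : ℝ) : ℂ) := by
    rw [charFun_gaussianReal]
    push_cast
    congr 1
    simp
  rw [hgauss]
  have hE : Tendsto (fun b => ((Real.exp (-(t ^ 2 * (∑ i, Var[id; ν b i]) / 2)) : ℝ) : ℂ)) l
      (𝓝 ((Real.exp (-(t ^ 2 * 1 / 2)) : ℝ) : ℂ)) := by
    refine (Complex.continuous_ofReal.tendsto _).comp ?_
    refine (Real.continuous_exp.tendsto _).comp ?_
    exact ((hV.const_mul _).div_const 2).neg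
  suffices h : Tendsto (fun b => charFun ((Measure.pi (ν b)).map fun w => ∑ i, w i) t -
      ((Real.exp (-(t ^ 2 * (∑ i, Var[id; ν b i]) / 2)) : ℝ) : ℂ)) l (𝓝 0) by
    have := h.add hE
    simpa using this
  rw [Metric.tendsto_nhds]
  intro ε hε
  -- The bound tends to `4 η t² + t⁴ η²` for fixed `η`, which is small with `η`.
  obtain ⟨η, hη, hη1, hηε⟩ : ∃ η : ℝ, 0 < η ∧ η ≤ 1 ∧ 4 * (η * t ^ 2) + t ^ 4 * η ^ 2 < ε := by
    have hc : Tendsto (fun η : ℝ => 4 * (η * t ^ 2) + t ^ 4 * η ^ 2) (𝓝[>] 0) (𝓝 0) := by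
      have : Continuous fun η : ℝ => 4 * (η * t ^ 2) + t ^ 4 * η ^ 2 := by fun_prop
      simpa using (this.tendsto 0).mono_left nhdsWithin_le_nhds
    have h1 : ∀ᶠ η : ℝ in 𝓝[>] 0, η ≤ 1 :=
      nhdsWithin_le_nhds (eventually_le_nhds one_pos)
    obtain ⟨η, h, h', h''⟩ := ((hc.eventually (gt_mem_nhds hε)).and
      (h1.and self_mem_nhdsWithin)).exists
    exact ⟨η, h'', h', h⟩
  have hbound : Tendsto (fun b => 4 * (η * t ^ 2 * (∑ i, Var[id; ν b i]) +
        η ^ (-δ) * |t| ^ (2 + δ) * ∑ i, ∫ x, |x| ^ (2 + δ) ∂(ν b i)) +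
      t ^ 4 * (∑ i, Var[id; ν b i]) * (η ^ 2 + η ^ (-δ) * ∑ i, ∫ x, |x| ^ (2 + δ) ∂(ν b i))) l
      (𝓝 (4 * (η * t ^ 2 * 1 + η ^ (-δ) * |t| ^ (2 + δ) * 0) +
        t ^ 4 * 1 * (η ^ 2 + η ^ (-δ) * 0))) :=
    (((hV.const_mul _).add (hMr.const_mul _)).const_mul _).add
      ((hV.const_mul _).mul ((hMr.const_mul _).const_add _))
  have hlt : 4 * (η * t ^ 2 * 1 + η ^ (-δ) * |t| ^ (2 + δ) * 0) +
        t ^ 4 * 1 * (η ^ 2 + η ^ (-δ) * 0) < ε := by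
    simpa using hηε
  filter_upwards [h2, hmean, hint, hbound.eventually (gt_mem_nhds hlt)] with b hb2 hbm hbi hbb
  rw [dist_zero_right]
  exact (norm_charFun_pi_sum_sub_le hb2 hbm hη hη1 hδ hbi t).trans_lt hbb

/-- **Lyapunov's central limit theorem** for triangular arrays indexed by an arbitrary filter.
Lévy's theorem is about sequences; it applies because the hypotheses only involve the limits of two
functions, that is, a countably generated filter. -/
theorem tendsto_cdf_pi_sum {β : Type*} {l : Filter β} {ι : β → Type*} [∀ b, Fintype (ι b)]
    {ν : ∀ b, ι b → Measure ℝ} [∀ b i, IsProbabilityMeasure (ν b i)] {δ : ℝ} (hδ : 0 < δ)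
    (h2 : ∀ᶠ b in l, ∀ i, MemLp id 2 (ν b i)) (hmean : ∀ᶠ b in l, ∀ i, ∫ x, x ∂(ν b i) = 0)
    (hV : Tendsto (fun b => ∑ i, Var[id; ν b i]) l (𝓝 1))
    (hM : Tendsto (fun b => ∑ i, absMoment (ν b i) 0 (2 + δ)) l (𝓝 0)) (t : ℝ) :
    Tendsto (fun b => (Measure.pi (ν b)) {w | ∑ i, w i ≤ t}) l
      (𝓝 (gaussianReal 0 1 (Set.Iic t))) := by
  let V : β → ℝ := fun b => ∑ i, Var[id; ν b i]
  let M : β → ℝ≥0∞ := fun b => ∑ i, absMoment (ν b i) 0 (2 + δ)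
  let S : Set β := {b | (∀ i, MemLp id 2 (ν b i)) ∧ ∀ i, ∫ x, x ∂(ν b i) = 0}
  let l' : Filter β := (comap V (𝓝 1) ⊓ comap M (𝓝 0)) ⊓ 𝓟 S
  have hl : l ≤ l' := le_inf (le_inf (tendsto_iff_comap.1 hV) (tendsto_iff_comap.1 hM))
    (le_principal_iff.2 (h2.and hmean))
  have hV' : Tendsto V l' (𝓝 1) := tendsto_comap.mono_left (inf_le_left.trans inf_le_left)
  have hM' : Tendsto M l' (𝓝 0) := tendsto_comap.mono_left (inf_le_left.trans inf_le_right)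
  have hS' : ∀ᶠ b in l', b ∈ S := mem_inf_of_right (mem_principal_self S)
  refine Tendsto.mono_left ?_ hl
  refine tendsto_of_seq_tendsto fun u hu => ?_
  have hsum : ∀ b, Measurable fun w : ι b → ℝ => ∑ i, w i := fun b =>
    Finset.measurable_fun_sum _ fun i _ => measurable_pi_apply i
  let μ : ℕ → ProbabilityMeasure ℝ := fun k =>
    ⟨(Measure.pi (ν (u k))).map fun w => ∑ i, w i,
      Measure.isProbabilityMeasure_map (hsum _).aemeasurable⟩
  let γ : ProbabilityMeasure ℝ := ⟨gaussianReal 0 1, inferInstance⟩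
  have hconv : Tendsto μ atTop (𝓝 γ) := by
    refine ProbabilityMeasure.tendsto_of_tendsto_charFun fun s => ?_
    exact tendsto_charFun_pi_sum (ν := fun k => ν (u k)) hδ
      ((hu.eventually hS').mono fun k hk => hk.1) ((hu.eventually hS').mono fun k hk => hk.2)
      (hV'.comp hu) (hM'.comp hu) s
  have hnull : (γ : Measure ℝ) (frontier (Set.Iic t)) = 0 := by
    have := nullSingletonClass_gaussianReal (μ := 0) (v := 1) one_ne_zero
    rw [frontier_Iic]
    exact measure_singleton (μ := gaussianReal 0 1) t
  have := ProbabilityMeasure.tendsto_measure_of_null_frontier_of_tendsto' hconv hnull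
  refine this.congr fun k => ?_
  exact Measure.map_apply (hsum _) measurableSet_Iic

/-! ### The conditional laws under the null hypothesis -/

section Model

variable {n k : ℕ}

@[fun_prop]
theorem measurable_obsX : Measurable (obsX (k := k)) := measurable_fst

@[fun_prop]
theorem measurable_obsY : Measurable (obsY (k := k)) := measurable_snd.fst

attribute [fun_prop] measurable_obsZ

@[fun_prop]
theorem measurable_dataXZ : Measurable (dataXZ (n := n) (k := k)) := by
  unfold dataXZ; fun_prop

@[fun_prop]
theorem measurable_dataYZ : Measurable (dataYZ (n := n) (k := k)) := by
  unfold dataYZ; fun_prop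

theorem measurable_integral_kernel {β : Type*} [MeasurableSpace β] (κ : Kernel β ℝ)
    [IsMarkovKernel κ] : Measurable fun b => ∫ x, x ∂(κ b) :=
  (StronglyMeasurable.integral_kernel (κ := κ) (f := fun x : ℝ => x)
    stronglyMeasurable_id).measurable

theorem measurable_absMoment_kernel {β : Type*} [MeasurableSpace β] (κ : Kernel β ℝ)
    [IsMarkovKernel κ] {c : β → ℝ} (hc : Measurable c) (r : ℝ) :
    Measurable fun b => absMoment (κ b) (c b) r := by
  unfold absMoment
  refine Measurable.lintegral_kernel_prod_right
    (f := fun b w => ENNReal.ofReal (|w - c b| ^ r)) ?_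
  have : Measurable fun p : β × ℝ => p.2 - c p.1 := by fun_prop
  exact ((measurable_norm.comp this).pow_const r).ennreal_ofReal

theorem evariance_id_eq_absMoment (ν : Measure ℝ) :
    eVar[id; ν] = absMoment ν (∫ x, x ∂ν) 2 := by
  rw [evariance_eq_lintegral_ofReal]
  simp [absMoment]

theorem measurable_evariance_kernel {β : Type*} [MeasurableSpace β] (κ : Kernel β ℝ)
    [IsMarkovKernel κ] : Measurable fun b => eVar[id; κ b] := by
  simp_rw [evariance_id_eq_absMoment]
  exact measurable_absMoment_kernel κ (measurable_integral_kernel κ) 2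

/-- Jensen's inequality for absolute moments. -/
theorem absMoment_rpow_le (ν : Measure ℝ) [IsProbabilityMeasure ν] (c : ℝ) {r q : ℝ} (hq : 1 ≤ q)
    : absMoment ν c r ^ q ≤ absMoment ν c (r * q) := by
  have hm : AEStronglyMeasurable (fun w : ℝ => |w - c| ^ r) ν :=
    ((measurable_id.sub_const c).abs.pow_const r).aestronglyMeasurable
  have h := eLpNorm'_le_eLpNorm'_of_exponent_le one_pos hq ν hm
  simp only [eLpNorm'_eq_lintegral_enorm, ENNReal.rpow_one, one_div, inv_one] at h
  have hq0 : 0 < q := by linarith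
  have he : ∀ w : ℝ, ‖|w - c| ^ r‖ₑ = ENNReal.ofReal (|w - c| ^ r) := fun w => by
    rw [Real.enorm_eq_ofReal (by positivity)]
  have he' : ∀ w : ℝ, ‖|w - c| ^ r‖ₑ ^ q = ENNReal.ofReal (|w - c| ^ (r * q)) := fun w => by
    rw [he, ENNReal.ofReal_rpow_of_nonneg (by positivity) hq0.le, ← Real.rpow_mul (abs_nonneg _)]
  simp_rw [he', he] at h
  calc absMoment ν c r ^ q ≤ ((absMoment ν c (r * q)) ^ q⁻¹) ^ q := by
        gcongr; exact h
    _ = _ := by rw [← ENNReal.rpow_mul, inv_mul_cancel₀ hq0.ne', ENNReal.rpow_one]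

variable (L : Measure (Obs k)) [IsProbabilityMeasure L]

instance (z : Cov k) : IsProbabilityMeasure (condLawX L z) := by
  unfold condLawX; infer_instance

instance (z : Cov k) : IsProbabilityMeasure (condLawY L z) := by
  unfold condLawY; infer_instance

/-- The conditional law of `X` given the covariate of an observation. -/
noncomputable def kerX : Kernel (Obs k) ℝ := (condDistrib obsX obsZ L).comap obsZ measurable_obsZ

/-- The conditional law of `Y` given the covariate of an observation. -/
noncomputable def kerY : Kernel (Obs k) ℝ := (condDistrib obsY obsZ L).comap obsZ measurable_obsZ

instance : IsMarkovKernel (kerX L) := by unfold kerX; infer_instance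

instance : IsMarkovKernel (kerY L) := by unfold kerY; infer_instance

theorem kerY_apply (o : Obs k) : kerY L o = condLawY L (obsZ o) := rfl

/-- Replace the coordinate `X` of an observation. -/
def setX (o : Obs k) (x : ℝ) : Obs k := (x, obsY o, obsZ o)

/-- Replace the coordinate `Y` of an observation. -/
def setY (o : Obs k) (y : ℝ) : Obs k := (obsX o, y, obsZ o)

@[fun_prop]
theorem measurable_meanX : Measurable (meanX L) :=
  measurable_integral_kernel (condDistrib obsX obsZ L)

@[fun_prop]
theorem measurable_meanY : Measurable (meanY L) :=
  measurable_integral_kernel (condDistrib obsY obsZ L)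

/-- The error `X - μₓ(Z)`. -/
noncomputable def epsX (o : Obs k) : ℝ := obsX o - meanX L (obsZ o)

/-- The error `Y - μ_y(Z)`. -/
noncomputable def epsY (o : Obs k) : ℝ := obsY o - meanY L (obsZ o)

@[fun_prop]
theorem measurable_epsX : Measurable (epsX L) := by unfold epsX; fun_prop

@[fun_prop]
theorem measurable_epsY : Measurable (epsY L) := by unfold epsY; fun_prop

variable {L}

/-- Under the null hypothesis, `L` draws `Z`, and then `X` and `Y` independently from their
conditional laws given `Z`. -/
theorem IsNull.lintegral_eq (h : IsNull L) {F : Obs k → ℝ≥0∞} (hF : Measurable F) :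
    ∫⁻ o, F o ∂L =
      ∫⁻ o, ∫⁻ x, ∫⁻ y, F (x, y, obsZ o) ∂(condLawY L (obsZ o)) ∂(condLawX L (obsZ o)) ∂L := by
  have h' := (condIndepFun_iff_map_prod_eq_prod_condDistrib_prod_condDistrib measurable_obsX
    measurable_obsY measurable_obsZ).1 h
  let G : Cov k × ℝ × ℝ → ℝ≥0∞ := fun p => F (p.2.1, p.2.2, p.1)
  have hG : Measurable G := hF.comp (by fun_prop)
  have hmap : Measurable fun o : Obs k => (obsZ o, obsX o, obsY o) := by fun_prop
  have h1 : ∫⁻ o, F o ∂L = ∫⁻ p, G p ∂(L.map fun o => (obsZ o, obsX o, obsY o)) := by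
    rw [lintegral_map hG hmap]; rfl
  rw [h1, h', Measure.lintegral_bind (Kernel.aemeasurable _) hG.aemeasurable,
    lintegral_map hG.lintegral_kernel measurable_obsZ]
  refine lintegral_congr fun o => ?_
  rw [Kernel.prod_apply, Kernel.id_apply, Measure.dirac_prod,
    lintegral_map hG measurable_prodMk_left, Kernel.prod_apply,
    lintegral_prod (fun p => G (obsZ o, p)) (hG.comp measurable_prodMk_left).aemeasurable]
  rfl

theorem IsNull.isRefresh_Y (h : IsNull L) : IsRefresh L (kerY L) setY := by
  have hg : Measurable (Function.uncurry (setY (k := k))) := by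
    unfold setY; fun_prop
  refine ⟨hg, fun F hF => ?_⟩
  have hF' : Measurable fun o => ∫⁻ w, F (setY o w) ∂(kerY L o) :=
    Measurable.lintegral_kernel_prod_right (hF.comp hg)
  rw [h.lintegral_eq hF, h.lintegral_eq hF']
  refine lintegral_congr fun o => ?_
  refine lintegral_congr fun x => ?_
  change _ = ∫⁻ _, (∫⁻ w, F (x, w, obsZ o) ∂(condLawY L (obsZ o))) ∂(condLawY L (obsZ o))
  simp

theorem IsNull.isRefresh_X (h : IsNull L) : IsRefresh L (kerX L) setX := by
  have hg : Measurable (Function.uncurry (setX (k := k))) := by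
    unfold setX; fun_prop
  refine ⟨hg, fun F hF => ?_⟩
  have hF' : Measurable fun o => ∫⁻ w, F (setX o w) ∂(kerX L o) :=
    Measurable.lintegral_kernel_prod_right (hF.comp hg)
  rw [h.lintegral_eq hF, h.lintegral_eq hF']
  refine lintegral_congr fun o => ?_
  change _ = ∫⁻ _, ∫⁻ y, (∫⁻ w, F (w, y, obsZ o) ∂(condLawX L (obsZ o))) ∂(condLawY L (obsZ o))
    ∂(condLawX L (obsZ o))
  have hm : Measurable (Function.uncurry fun x y : ℝ => F (x, y, obsZ o)) :=
    hF.comp (by fun_prop)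
  rw [lintegral_const, measure_univ, mul_one, lintegral_lintegral_swap hm.aemeasurable]

/-- Moments of the product of the two errors factor conditionally on the covariate. -/
theorem IsNull.lintegral_abs_mul_rpow (h : IsNull L) (r : ℝ) :
    ∫⁻ o, ENNReal.ofReal (|epsX L o * epsY L o| ^ r) ∂L =
      ∫⁻ o, absMoment (condLawX L (obsZ o)) (meanX L (obsZ o)) r *
        absMoment (condLawY L (obsZ o)) (meanY L (obsZ o)) r ∂L := by
  have hF : Measurable fun o => ENNReal.ofReal (|epsX L o * epsY L o| ^ r) := by
    have : Measurable fun o => epsX L o * epsY L o := by fun_prop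
    exact (this.abs.pow_const r).ennreal_ofReal
  rw [h.lintegral_eq hF]
  refine lintegral_congr fun o => ?_
  unfold absMoment
  have hm : ∀ c : ℝ, Measurable fun w : ℝ => ENNReal.ofReal (|w - c| ^ r) := fun c =>
    ((measurable_id.sub_const c).abs.pow_const r).ennreal_ofReal
  rw [← lintegral_mul_const _ (hm _)]
  refine lintegral_congr fun x => ?_
  rw [← lintegral_const_mul _ (hm _)]
  refine lintegral_congr fun y => ?_
  rw [← ENNReal.ofReal_mul (by positivity), ← Real.mul_rpow (abs_nonneg _) (abs_nonneg _), ← abs_mul]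
  rfl

theorem ae_integrable_condLawY (hY : Integrable obsY L) :
    ∀ᵐ o ∂L, Integrable (fun y : ℝ => y) (condLawY L (obsZ o)) := by
  have : Integrable (fun p : Cov k × ℝ => p.2) (L.map fun o => (obsZ o, obsY o)) :=
    (integrable_map_measure (by fun_prop) (by fun_prop)).2 hY
  exact this.condDistrib_ae (by fun_prop) (by fun_prop)

/-- The positive and the negative part of a centred variable have the same expectation. -/
theorem lintegral_ofReal_centred_eq {ν : Measure ℝ} [IsProbabilityMeasure ν]
    (hν : Integrable (fun x : ℝ => x) ν) (c : ℝ) :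
    ∫⁻ x, ENNReal.ofReal (c * (x - ∫ x, x ∂ν)) ∂ν =
      ∫⁻ x, ENNReal.ofReal (-(c * (x - ∫ x, x ∂ν))) ∂ν := by
  have hint : Integrable (fun x => c * (x - ∫ x, x ∂ν)) ν :=
    (hν.sub (integrable_const _)).const_mul c
  have h0 : ∫ x, c * (x - ∫ x, x ∂ν) ∂ν = 0 := by
    rw [integral_const_mul, integral_sub hν (integrable_const _)]; simp
  rw [integral_eq_lintegral_pos_part_sub_lintegral_neg_part hint, sub_eq_zero] at h0
  exact (ENNReal.toReal_eq_toReal_iff' hint.lintegral_lt_top.ne hint.neg.lintegral_lt_top.ne).1 h0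

/-- The product of the two errors is centred, because the error of `Y` is centred given `X` and `Z`.
Where the product is not integrable, the integral is zero by convention. The positive and the
negative parts are compared, since `IsRefresh` is about functions with values in `[0, ∞]`. -/
theorem IsNull.integral_mul_eq_zero (h : IsNull L) (hY : Integrable obsY L) :
    ∫ o, epsX L o * epsY L o ∂L = 0 := by
  by_cases hint : Integrable (fun o => epsX L o * epsY L o) L
  · rw [integral_eq_lintegral_pos_part_sub_lintegral_neg_part hint, sub_eq_zero]
    congr 1
    have hm : Measurable fun o => epsX L o * epsY L o := by fun_prop
    have hm' : Measurable fun o => -(epsX L o * epsY L o) := hm.neg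
    rw [h.isRefresh_Y.2 _ hm.ennreal_ofReal, h.isRefresh_Y.2 _ hm'.ennreal_ofReal]
    refine lintegral_congr_ae ?_
    filter_upwards [ae_integrable_condLawY hY] with o ho
    exact lintegral_ofReal_centred_eq ho (epsX L o)
  · exact integral_undef hint

end Model

/-! ### Limit theorems in probability for samples -/

/-- A perturbation that vanishes in mean square does not change the limit of a mean square. -/
theorem tendsto_mean_sq_add {β : Type*} {l : Filter β} {n : β → ℕ} {u v : ∀ b, Fin (n b) → ℝ}
    {s : β → ℝ} {K : ℝ} (hs : ∀ᶠ b in l, s b ≤ K)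
    (hu : Tendsto (fun b => (1 / (n b : ℝ)) * ∑ i, u b i ^ 2 - s b) l (𝓝 0))
    (hv : Tendsto (fun b => (1 / (n b : ℝ)) * ∑ i, v b i ^ 2) l (𝓝 0)) :
    Tendsto (fun b => (1 / (n b : ℝ)) * ∑ i, (u b i + v b i) ^ 2 - s b) l (𝓝 0) := by
  have hlim : Tendsto (fun b => (1 / (n b : ℝ)) * ∑ i, v b i ^ 2 +
      2 * (√(K + 1) * √((1 / (n b : ℝ)) * ∑ i, v b i ^ 2))) l (𝓝 0) := by
    have h1 := (Real.continuous_sqrt.tendsto 0).comp hv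
    have h2 := hv.add ((h1.const_mul √(K + 1)).const_mul 2)
    simpa using h2
  have hdiff : Tendsto (fun b => (1 / (n b : ℝ)) * ∑ i, (u b i + v b i) ^ 2 -
      (1 / (n b : ℝ)) * ∑ i, u b i ^ 2) l (𝓝 0) := by
    refine squeeze_zero_norm' ?_ hlim
    filter_upwards [hs, hu.eventually (gt_mem_nhds one_pos)] with b hb hub
    have hn : (0 : ℝ) ≤ 1 / (n b : ℝ) := by positivity
    have hexp : (1 / (n b : ℝ)) * ∑ i, (u b i + v b i) ^ 2 - (1 / (n b : ℝ)) * ∑ i, u b i ^ 2 =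
        (1 / (n b : ℝ)) * ∑ i, v b i ^ 2 + 2 * ((1 / (n b : ℝ)) * ∑ i, u b i * v b i) := by
      rw [← mul_sub, ← Finset.sum_sub_distrib, ← mul_assoc, mul_comm (2 : ℝ), mul_assoc, ← mul_add,
        Finset.mul_sum (f := fun i => u b i * v b i), ← Finset.sum_add_distrib]
      congr 1
      exact Finset.sum_congr rfl fun i _ => by ring
    have hcs : |(1 / (n b : ℝ)) * ∑ i, u b i * v b i| ≤
        √(K + 1) * √((1 / (n b : ℝ)) * ∑ i, v b i ^ 2) := by
      have hcs0 := Finset.sum_mul_sq_le_sq_mul_sq Finset.univ (u b) (v b)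
      rw [← Real.sqrt_mul (by
        have : 0 ≤ (1 / (n b : ℝ)) * ∑ i, u b i ^ 2 := by positivity
        linarith)]
      refine Real.abs_le_sqrt ?_
      calc ((1 / (n b : ℝ)) * ∑ i, u b i * v b i) ^ 2
          = (1 / (n b : ℝ)) ^ 2 * (∑ i, u b i * v b i) ^ 2 := by ring
        _ ≤ (1 / (n b : ℝ)) ^ 2 * ((∑ i, u b i ^ 2) * ∑ i, v b i ^ 2) := by gcongr
        _ = ((1 / (n b : ℝ)) * ∑ i, u b i ^ 2) * ((1 / (n b : ℝ)) * ∑ i, v b i ^ 2) := by ring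
        _ ≤ _ := by
          gcongr
          linarith
    rw [hexp, Real.norm_eq_abs]
    refine (abs_add_le _ _).trans ?_
    rw [abs_mul 2, abs_two, abs_of_nonneg
      (by positivity : (0 : ℝ) ≤ (1 / (n b : ℝ)) * ∑ i, v b i ^ 2)]
    gcongr
  have := hdiff.add hu
  simpa using this

section RefreshSums

variable {O : ℕ → Type} [∀ n, MeasurableSpace (O n)] {L : ∀ n, Measure (O n)}
  [∀ n, IsProbabilityMeasure (L n)] {κ : ∀ n, Kernel (O n) ℝ} [∀ n, IsMarkovKernel (κ n)]
  {g : ∀ n, O n → ℝ → O n}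

/-- A weighted sum tends to zero in probability if it does after the redrawn factors have been
replaced by their conditional means; the weights must not depend on what is redrawn. -/
theorem tendsto_sum_mul_of_refresh (h : ∀ n ≥ 1, IsRefresh (L n) (κ n) (g n)) (s : ℕ → ℝ≥0∞)
    {C : ∀ n, (Fin n → O n) → Fin n → ℝ≥0∞} (hC : ∀ n i, Measurable fun d => C n d i)
    (hinv : ∀ n (d : Fin n → O n) (w : Fin n → ℝ), C n (fun i => g n (d i) (w i)) = C n d)
    {E : ∀ n, O n → ℝ≥0∞} (hE : ∀ n, Measurable (E n))
    (hlim : Tendsto (fun a : Σ n, Fin n → O n =>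
        s a.1 * ∑ i, C a.1 a.2 i * ∫⁻ w, E a.1 (g a.1 (a.2 i) w) ∂(κ a.1 (a.2 i)))
      (whp fun n => Measure.pi fun _ : Fin n => L n) (𝓝 0)) :
    Tendsto (fun a : Σ n, Fin n → O n => s a.1 * ∑ i, C a.1 a.2 i * E a.1 (a.2 i))
      (whp fun n => Measure.pi fun _ : Fin n => L n) (𝓝 0) := by
  refine tendsto_zero_of_refresh h (f := fun n d => s n * ∑ i, C n d i * E n (d i))
    (fun n => (Finset.measurable_fun_sum _ fun i _ =>
      (hC n i).mul ((hE n).comp (measurable_pi_apply i))).const_mul _) ?_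
  refine hlim.congr' ?_
  filter_upwards [tendsto_fst_whp.eventually (eventually_ge_atTop 1)] with a ha
  have hg := (h a.1 ha).1
  have hm : ∀ i, Measurable fun w => C a.1 a.2 i * E a.1 (g a.1 (a.2 i) w) := fun i =>
    ((hE _).comp (hg.comp measurable_prodMk_left)).const_mul _
  have hm' : ∀ i, Measurable fun w => E a.1 (g a.1 (a.2 i) w) := fun i =>
    (hE _).comp (hg.comp measurable_prodMk_left)
  simp only [hinv]
  have hms : Measurable fun w : Fin a.1 → ℝ =>
      ∑ i, C a.1 a.2 i * E a.1 (g a.1 (a.2 i) (w i)) :=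
    Finset.measurable_fun_sum _ fun i _ => (hm i).comp (measurable_pi_apply i)
  rw [lintegral_const_mul _ hms, lintegral_pi_sum _ hm]
  congr 1
  exact Finset.sum_congr rfl fun i _ => (lintegral_const_mul _ (hm' i)).symm

/-- A normalised sum of conditionally centred variables tends to zero in probability if its
conditional variance does. By `hinv` the weights do not depend on what is redrawn, and by `hcent`
the redrawn value of `e` is the new draw minus its conditional mean. -/
theorem tendsto_linear_of_refresh (h : ∀ n ≥ 1, IsRefresh (L n) (κ n) (g n))
    {c : ∀ n, (Fin n → O n) → Fin n → ℝ} (hc : ∀ n i, Measurable fun d => c n d i)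
    (hinv : ∀ n (d : Fin n → O n) (w : Fin n → ℝ), c n (fun i => g n (d i) (w i)) = c n d)
    {e : ∀ n, O n → ℝ} (he : ∀ n, Measurable (e n))
    (hcent : ∀ n o w, e n (g n o w) = w - ∫ x, x ∂(κ n o))
    (hlim : Tendsto (fun a : Σ n, Fin n → O n =>
        (a.1 : ℝ≥0∞)⁻¹ * ∑ i, ENNReal.ofReal (c a.1 a.2 i ^ 2) * eVar[id; κ a.1 (a.2 i)])
      (whp fun n => Measure.pi fun _ : Fin n => L n) (𝓝 0)) :
    Tendsto (fun a : Σ n, Fin n → O n => (1 / √(a.1 : ℝ)) * ∑ i, c a.1 a.2 i * e a.1 (a.2 i))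
      (whp fun n => Measure.pi fun _ : Fin n => L n) (𝓝 0) := by
  rw [Metric.tendsto_nhds]
  intro t ht
  have hm : ∀ n, Measurable fun d : Fin n → O n => (1 / √(n : ℝ)) * ∑ i, c n d i * e n (d i) :=
    fun n => (Finset.measurable_fun_sum _ fun i _ =>
      (hc n i).mul ((he n).comp (measurable_pi_apply i))).const_mul _
  refine eventually_of_refresh h
    (s := fun n => {d | dist ((1 / √(n : ℝ)) * ∑ i, c n d i * e n (d i)) 0 < t})
    (fun n => measurableSet_lt ((hm n).dist measurable_const) measurable_const) fun ε hε => ?_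
  rcases eq_or_ne ε ∞ with rfl | hεt
  · simp
  rw [ENNReal.tendsto_nhds_zero] at hlim
  have ht2 : ENNReal.ofReal (t ^ 2) ≠ 0 := by simpa using ht.ne'
  filter_upwards [hlim (ε * ENNReal.ofReal (t ^ 2)) (ENNReal.mul_pos hε.ne' ht2),
    tendsto_fst_whp.eventually (eventually_ge_atTop 1)] with a ha hn
  have hn0 : (0 : ℝ) < a.1 := by exact_mod_cast hn
  have hch := measure_pi_chebyshev_linear (fun i => κ a.1 (a.2 i))
    (fun i => (1 / √(a.1 : ℝ)) * c a.1 a.2 i) ht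
  refine le_trans (le_trans (measure_mono fun w hw => ?_) hch) ?_
  · simp only [Set.mem_ofPred_eq, dist_zero_right, not_lt, hinv, hcent, Real.norm_eq_abs] at hw ⊢
    rw [Finset.mul_sum] at hw
    simp_rw [mul_assoc]
    exact hw
  · have hrw : ∑ i, ENNReal.ofReal (((1 / √(a.1 : ℝ)) * c a.1 a.2 i) ^ 2) *
        eVar[id; κ a.1 (a.2 i)] =
        (a.1 : ℝ≥0∞)⁻¹ * ∑ i, ENNReal.ofReal (c a.1 a.2 i ^ 2) * eVar[id; κ a.1 (a.2 i)] := by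
      rw [Finset.mul_sum]
      refine Finset.sum_congr rfl fun i _ => ?_
      rw [mul_pow, div_pow, Real.sq_sqrt hn0.le, one_pow, ENNReal.ofReal_mul (by positivity),
        one_div, ENNReal.ofReal_inv_of_pos hn0, ENNReal.ofReal_natCast, mul_assoc]
    rw [hrw]
    exact ENNReal.div_le_of_le_mul ha

theorem exists_pos_ofReal_mul_le (t B : ℝ) {ε : ℝ≥0∞} (hε : 0 < ε) :
    ∃ η : ℝ, 0 < η ∧ ENNReal.ofReal (4 * η / t ^ 2 * B) ≤ ε := by
  have hlim : Tendsto (fun η : ℝ => ENNReal.ofReal (4 * η / t ^ 2 * B)) (𝓝[>] 0) (𝓝 0) := by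
    have : Continuous fun η : ℝ => ENNReal.ofReal (4 * η / t ^ 2 * B) :=
      ENNReal.continuous_ofReal.comp (by fun_prop)
    simpa using (this.tendsto 0).mono_left nhdsWithin_le_nhds
  rw [ENNReal.tendsto_nhds_zero] at hlim
  obtain ⟨η, h1, h2⟩ := ((hlim ε hε).and self_mem_nhdsWithin).exists
  exact ⟨η, h2, h1⟩

theorem natCast_mul_rpow_inv {n : ℕ} (hn : 1 ≤ n) (q : ℝ) :
    (n : ℝ) * (1 / (n : ℝ)) ^ q = (n : ℝ) ^ (1 - q) := by
  have hn0 : (0 : ℝ) < n := by exact_mod_cast hn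
  rw [one_div, Real.inv_rpow hn0.le, Real.rpow_sub hn0, Real.rpow_one]
  rfl

/-- Conditional weak law of large numbers for weighted squares, under a conditional moment
condition of order `2 q > 2`. -/
theorem tendsto_weighted_sq_of_refresh (h : ∀ n ≥ 1, IsRefresh (L n) (κ n) (g n))
    {c : ∀ n, (Fin n → O n) → Fin n → ℝ} (hc : ∀ n i, Measurable fun d => c n d i)
    (hc0 : ∀ n d i, 0 ≤ c n d i)
    (hinv : ∀ n (d : Fin n → O n) (w : Fin n → ℝ), c n (fun i => g n (d i) (w i)) = c n d)
    {e : ∀ n, O n → ℝ} (he : ∀ n, Measurable (e n))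
    (hcent : ∀ n o w, e n (g n o w) = w - ∫ x, x ∂(κ n o))
    (hκ : ∀ n o w, κ n (g n o w) = κ n o)
    {q K : ℝ} (hq : 1 < q)
    (hfin : ∀ᶠ a : Σ n, Fin n → O n in whp fun n => Measure.pi fun _ : Fin n => L n,
      ∀ i, eVar[id; κ a.1 (a.2 i)] < ∞)
    (hK : ∀ᶠ a : Σ n, Fin n → O n in whp fun n => Measure.pi fun _ : Fin n => L n,
      (1 / (a.1 : ℝ)) * ∑ i, c a.1 a.2 i * Var[id; κ a.1 (a.2 i)] ≤ K)
    (hlim : Tendsto (fun a : Σ n, Fin n → O n =>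
        (∑ i, ENNReal.ofReal (c a.1 a.2 i ^ q) *
          absMoment (κ a.1 (a.2 i)) (∫ x, x ∂(κ a.1 (a.2 i))) (2 * q)) /
          ENNReal.ofReal ((a.1 : ℝ) ^ q))
      (whp fun n => Measure.pi fun _ : Fin n => L n) (𝓝 0)) :
    Tendsto (fun a : Σ n, Fin n → O n => (1 / (a.1 : ℝ)) * ∑ i, c a.1 a.2 i * e a.1 (a.2 i) ^ 2 -
        (1 / (a.1 : ℝ)) * ∑ i, c a.1 a.2 i * Var[id; κ a.1 (a.2 i)])
      (whp fun n => Measure.pi fun _ : Fin n => L n) (𝓝 0) := by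
  rw [Metric.tendsto_nhds]
  intro t ht
  have hv : ∀ n (i : Fin n), Measurable fun d : Fin n → O n => Var[id; κ n (d i)] := fun n i =>
    ((measurable_evariance_kernel (κ n)).comp (measurable_pi_apply i)).ennreal_toReal
  have hm : ∀ n, Measurable fun d : Fin n → O n => (1 / (n : ℝ)) * ∑ i, c n d i * e n (d i) ^ 2 -
      (1 / (n : ℝ)) * ∑ i, c n d i * Var[id; κ n (d i)] := fun n =>
    ((Finset.measurable_fun_sum _ fun i _ =>
      (hc n i).mul (((he n).comp (measurable_pi_apply i)).pow_const 2)).const_mul _).sub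
    ((Finset.measurable_fun_sum _ fun i _ => (hc n i).mul (hv n i)).const_mul _)
  refine eventually_of_refresh h
    (s := fun n => {d | dist ((1 / (n : ℝ)) * ∑ i, c n d i * e n (d i) ^ 2 -
      (1 / (n : ℝ)) * ∑ i, c n d i * Var[id; κ n (d i)]) 0 < t})
    (fun n => measurableSet_lt ((hm n).dist measurable_const) measurable_const) fun ε hε => ?_
  -- The truncation level is chosen so that the variance term is at most `ε / 2`.
  obtain ⟨η, hη, hηε⟩ := exists_pos_ofReal_mul_le t K (ENNReal.half_pos hε.ne')
  have hlim' := ENNReal.Tendsto.const_mul (a := ENNReal.ofReal (2 * η ^ (1 - q) / t)) hlim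
    (Or.inr ENNReal.ofReal_ne_top)
  rw [mul_zero, ENNReal.tendsto_nhds_zero] at hlim'
  filter_upwards [hlim' (ε / 2) (ENNReal.half_pos hε.ne'), hfin, hK,
    tendsto_fst_whp.eventually (eventually_ge_atTop 1)] with a ha hfa hKa hn
  have hn0 : (0 : ℝ) < a.1 := by exact_mod_cast hn
  set ν : Fin a.1 → Measure ℝ := fun i => κ a.1 (a.2 i) with hνdef
  have hmem : ∀ i, MemLp id 2 (ν i) := fun i =>
    (evariance_lt_top_iff_memLp aestronglyMeasurable_id).1 (hfa i)
  have hsqint : ∀ i, Integrable (fun w => (w - ∫ x, x ∂(ν i)) ^ 2) (ν i) := fun i =>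
    ((hmem i).sub (memLp_const (∫ x, x ∂(ν i)))).integrable_sq
  set f : Fin a.1 → ℝ → ℝ := fun i w => (1 / (a.1 : ℝ)) * (c a.1 a.2 i * (w - ∫ x, x ∂(ν i)) ^ 2)
    with hf
  have hfint : ∀ i, ∫ w, f i w ∂(ν i) = (1 / (a.1 : ℝ)) * (c a.1 a.2 i * Var[id; ν i]) := by
    intro i
    rw [hf]
    simp only
    rw [integral_const_mul, integral_const_mul, variance_eq_integral aemeasurable_id]
    rfl
  have hlln := measure_pi_weak_law ν (f := f) (fun i => by fun_prop)
    (fun i w => by have := hc0 a.1 a.2 i; positivity)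
    (fun i => ((hsqint i).const_mul _).const_mul _) hq hη ht
  simp only [hfint] at hlln
  rw [← Finset.mul_sum] at hlln
  refine le_trans (le_trans (measure_mono fun w hw => ?_) hlln) ?_
  · simp only [Set.mem_ofPred_eq, dist_zero_right, not_lt, hinv, hcent, hκ, Real.norm_eq_abs]
      at hw ⊢
    rw [hf]
    simp only
    rw [← Finset.mul_sum]
    exact hw
  · rw [← ENNReal.add_halves ε]
    refine add_le_add (le_trans (ENNReal.ofReal_le_ofReal ?_) hηε) (le_trans (le_of_eq ?_) ha)
    · gcongr
    · congr 1
      rw [ENNReal.div_eq_inv_mul, Finset.mul_sum]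
      refine Finset.sum_congr rfl fun i _ => ?_
      unfold absMoment
      have hmm : Measurable fun w : ℝ => ENNReal.ofReal (|w - ∫ x, x ∂(ν i)| ^ (2 * q)) :=
        ((measurable_id.sub_const _).abs.pow_const _).ennreal_ofReal
      rw [← lintegral_const_mul _ hmm, ← lintegral_const_mul _ (hmm.const_mul _)]
      refine lintegral_congr fun w => ?_
      have hci := hc0 a.1 a.2 i
      rw [hf]
      simp only
      rw [Real.mul_rpow (by positivity) (by positivity), Real.mul_rpow hci (by positivity),
        ENNReal.ofReal_mul (by positivity), ENNReal.ofReal_mul (by positivity), one_div,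
        Real.inv_rpow hn0.le, ENNReal.ofReal_inv_of_pos (by positivity), ← sq_abs,
        ← Real.rpow_natCast, ← Real.rpow_mul (abs_nonneg _)]
      norm_num

end RefreshSums

section IID

variable {O : ℕ → Type} [∀ n, MeasurableSpace (O n)] {L : ∀ n, Measure (O n)}
  [∀ n, IsProbabilityMeasure (L n)]

/-- Weak law of large numbers for a triangular array of i.i.d. nonnegative variables with bounded
moments of order `q > 1`. -/
theorem tendsto_mean_of_iid {f : ∀ n, O n → ℝ} (hf : ∀ n, Measurable (f n))
    (hf0 : ∀ n o, 0 ≤ f n o) {q : ℝ} (hq : 1 < q) {C : ℝ}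
    (hC : ∀ n ≥ 1, ∫⁻ o, ENNReal.ofReal (f n o ^ q) ∂(L n) ≤ ENNReal.ofReal C) :
    Tendsto (fun a : Σ n, Fin n → O n => (1 / (a.1 : ℝ)) * ∑ i, f a.1 (a.2 i) - ∫ o, f a.1 o ∂(L a.1))
      (whp fun n => Measure.pi fun _ : Fin n => L n) (𝓝 0) := by
  have hle : ∀ x : ℝ, 0 ≤ x → x ≤ 1 + x ^ q := by
    intro x hx
    rcases le_or_gt x 1 with h | h
    · have := Real.rpow_nonneg hx q
      linarith
    · have := Real.self_le_rpow_of_one_le h.le hq.le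
      linarith
  have hlint : ∀ n ≥ 1, ∫⁻ o, ENNReal.ofReal (f n o) ∂(L n) ≤ 1 + ENNReal.ofReal C := by
    intro n hn
    calc ∫⁻ o, ENNReal.ofReal (f n o) ∂(L n)
        ≤ ∫⁻ o, (1 + ENNReal.ofReal (f n o ^ q)) ∂(L n) := by
          refine lintegral_mono fun o => ?_
          rw [← ENNReal.ofReal_one, ← ENNReal.ofReal_add zero_le_one
            (Real.rpow_nonneg (hf0 n o) q)]
          exact ENNReal.ofReal_le_ofReal (hle _ (hf0 n o))
      _ ≤ _ := by
          rw [lintegral_add_left measurable_const]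
          simpa using hC n hn
  have hint : ∀ n ≥ 1, Integrable (f n) (L n) := fun n hn =>
    (lintegral_ofReal_ne_top_iff_integrable (hf n).aestronglyMeasurable
      (ae_of_all _ (hf0 n))).1 (ne_top_of_le_ne_top (by simp) (hlint n hn))
  have hmean : ∀ n ≥ 1, ∫ o, f n o ∂(L n) ≤ 1 + |C| := by
    intro n hn
    rw [integral_eq_lintegral_of_nonneg_ae (ae_of_all _ (hf0 n)) (hf n).aestronglyMeasurable]
    refine ENNReal.toReal_le_of_le_ofReal (by positivity) ((hlint n hn).trans ?_)
    rw [ENNReal.ofReal_add zero_le_one (abs_nonneg _), ENNReal.ofReal_one]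
    gcongr
    exact le_abs_self C
  rw [Metric.tendsto_nhds]
  intro t ht
  rw [eventually_whp, ENNReal.tendsto_nhds_zero]
  intro ε hε
  obtain ⟨η, hη, hηε⟩ := exists_pos_ofReal_mul_le t (1 + |C|) (ENNReal.half_pos hε.ne')
  have hrate : Tendsto (fun n : ℕ => ENNReal.ofReal (2 * η ^ (1 - q) / t) *
      (ENNReal.ofReal ((n : ℝ) ^ (1 - q)) * ENNReal.ofReal C)) atTop (𝓝 0) := by
    have h1 : Tendsto (fun n : ℕ => (n : ℝ) ^ (1 - q)) atTop (𝓝 0) := by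
      have := (tendsto_rpow_neg_atTop (y := q - 1) (by linarith)).comp
        (tendsto_natCast_atTop_atTop (R := ℝ))
      simpa [Function.comp_def] using this
    have h2 := ENNReal.tendsto_ofReal h1
    rw [ENNReal.ofReal_zero] at h2
    have h3 := ENNReal.Tendsto.mul_const h2 (Or.inr (ENNReal.ofReal_ne_top (r := C)))
    have h4 := ENNReal.Tendsto.const_mul (a := ENNReal.ofReal (2 * η ^ (1 - q) / t)) h3
      (Or.inr ENNReal.ofReal_ne_top)
    simpa using h4
  rw [ENNReal.tendsto_nhds_zero] at hrate
  filter_upwards [hrate (ε / 2) (ENNReal.half_pos hε.ne'), eventually_ge_atTop 1] with n hr hn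
  have hn0 : (0 : ℝ) < n := by exact_mod_cast hn
  have hlln := measure_pi_weak_law (fun _ : Fin n => L n) (f := fun _ o => (1 / (n : ℝ)) * f n o)
    (fun i => (hf n).const_mul _) (fun i o => by have := hf0 n o; positivity)
    (fun i => (hint n hn).const_mul _) hq hη ht
  have hsum : ∑ _i : Fin n, ∫ o, (1 / (n : ℝ)) * f n o ∂(L n) = ∫ o, f n o ∂(L n) := by
    rw [integral_const_mul]
    simp
    field_simp
  rw [hsum] at hlln
  refine le_trans (le_trans (measure_mono fun d hd => ?_) hlln) ?_
  · simp only [Set.mem_ofPred_eq, dist_zero_right, not_lt, Real.norm_eq_abs] at hd ⊢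
    rw [← Finset.mul_sum]
    exact hd
  · rw [← ENNReal.add_halves ε]
    refine add_le_add (le_trans (ENNReal.ofReal_le_ofReal ?_) hηε) (le_trans ?_ hr)
    · gcongr
      exact hmean n hn
    · gcongr
      have hfq : Measurable fun o => ENNReal.ofReal (f n o ^ q) := ((hf n).pow_const q).ennreal_ofReal
      have : ∫⁻ o, ENNReal.ofReal (((1 / (n : ℝ)) * f n o) ^ q) ∂(L n) =
          ENNReal.ofReal ((1 / (n : ℝ)) ^ q) * ∫⁻ o, ENNReal.ofReal (f n o ^ q) ∂(L n) := by
        rw [← lintegral_const_mul _ hfq]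
        refine lintegral_congr fun o => ?_
        rw [Real.mul_rpow (by positivity) (hf0 n o), ENNReal.ofReal_mul (by positivity)]
      rw [this, Finset.sum_const, Finset.card_univ, Fintype.card_fin, nsmul_eq_mul, ← mul_assoc,
        ← natCast_mul_rpow_inv hn, ENNReal.ofReal_mul hn0.le, ENNReal.ofReal_natCast]
      gcongr
      exact hC n hn

/-- Weak law of large numbers for a triangular array of i.i.d. centred variables with bounded
variance. -/
theorem tendsto_mean_zero_of_iid {f : ∀ n, O n → ℝ} (hf : ∀ n, Measurable (f n))
    (hf0 : ∀ n ≥ 1, ∫ o, f n o ∂(L n) = 0) {C : ℝ}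
    (hC : ∀ n ≥ 1, ∫⁻ o, ENNReal.ofReal (f n o ^ 2) ∂(L n) ≤ ENNReal.ofReal C) :
    Tendsto (fun a : Σ n, Fin n → O n => (1 / (a.1 : ℝ)) * ∑ i, f a.1 (a.2 i))
      (whp fun n => Measure.pi fun _ : Fin n => L n) (𝓝 0) := by
  rw [Metric.tendsto_nhds]
  intro t ht
  rw [eventually_whp]
  have hrate : Tendsto (fun n : ℕ => ENNReal.ofReal C / ENNReal.ofReal (t ^ 2) * (n : ℝ≥0∞)⁻¹)
      atTop (𝓝 0) := by
    have := ENNReal.Tendsto.const_mul (a := ENNReal.ofReal C / ENNReal.ofReal (t ^ 2))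
      ENNReal.tendsto_inv_nat_nhds_zero
      (Or.inr (ENNReal.div_ne_top ENNReal.ofReal_ne_top (by simpa using ht.ne')))
    simpa using this
  refine tendsto_of_tendsto_of_tendsto_of_le_of_le' tendsto_const_nhds hrate
    (Eventually.of_forall fun _ => zero_le) ?_
  filter_upwards [eventually_ge_atTop 1] with n hn
  have hn0 : (0 : ℝ) < n := by exact_mod_cast hn
  have hch := measure_pi_chebyshev (fun _ : Fin n => L n) (f := fun _ o => (1 / (n : ℝ)) * f n o)
    (fun i => (hf n).const_mul _) ht
  refine le_trans (le_trans (measure_mono fun d hd => ?_) hch) ?_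
  · simp only [Set.mem_ofPred_eq, dist_zero_right, not_lt, Real.norm_eq_abs, integral_const_mul,
      hf0 n hn] at hd ⊢
    rw [← Finset.mul_sum]
    simpa using hd
  · have hvar : eVar[fun o => (1 / (n : ℝ)) * f n o; L n] ≤
        ENNReal.ofReal ((1 / (n : ℝ)) ^ 2) * ENNReal.ofReal C := by
      rw [evariance_mul, evariance_eq_lintegral_ofReal, hf0 n hn]
      gcongr
      simpa using hC n hn
    calc (∑ _i : Fin n, eVar[fun o => (1 / (n : ℝ)) * f n o; L n]) / ENNReal.ofReal (t ^ 2)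
        ≤ (∑ _i : Fin n, ENNReal.ofReal ((1 / (n : ℝ)) ^ 2) * ENNReal.ofReal C) /
          ENNReal.ofReal (t ^ 2) := by gcongr
      _ = _ := by
        rw [Finset.sum_const, Finset.card_univ, Fintype.card_fin, nsmul_eq_mul, ← mul_assoc,
          ← ENNReal.ofReal_natCast, ← ENNReal.ofReal_mul hn0.le]
        have : (n : ℝ) * (1 / (n : ℝ)) ^ 2 = (n : ℝ)⁻¹ := by field_simp
        rw [this, ENNReal.ofReal_inv_of_pos hn0, div_eq_mul_inv, div_eq_mul_inv]
        ring

end IID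

/-! ### Quantiles -/

section Quantile

variable {ν : Measure ℝ} [IsProbabilityMeasure ν] {q a b : ℝ}

theorem bddBelow_of_measureReal_Iic_lt (ha : ν.real (Set.Iic a) < q) :
    a ∈ lowerBounds {t : ℝ | q ≤ ν.real (Set.Iic t)} := by
  intro t ht
  by_contra hcon
  have : ν.real (Set.Iic t) ≤ ν.real (Set.Iic a) :=
    measureReal_mono (Set.Iic_subset_Iic.2 (not_le.1 hcon).le)
  exact absurd (ha.trans_le (ht.trans this)) (lt_irrefl _)

theorem quantile_mem_Icc (ha : ν.real (Set.Iic a) < q) (hb : q ≤ ν.real (Set.Iic b)) :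
    quantile ν q ∈ Set.Icc a b :=
  ⟨le_csInf ⟨b, hb⟩ (bddBelow_of_measureReal_Iic_lt ha),
    csInf_le ⟨a, bddBelow_of_measureReal_Iic_lt ha⟩ hb⟩

theorem exists_measureReal_Iic_lt (hq : 0 < q) : ∃ a, ν.real (Set.Iic a) < q := by
  have h := (tendsto_cdf_atBot ν).eventually (gt_mem_nhds hq)
  obtain ⟨a, ha⟩ := h.exists
  exact ⟨a, by rwa [cdf_eq_real] at ha⟩

theorem exists_le_measureReal_Iic (hq : q < 1) : ∃ b, q ≤ ν.real (Set.Iic b) := by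
  have h := (tendsto_cdf_atTop ν).eventually (lt_mem_nhds hq)
  obtain ⟨b, hb⟩ := h.exists
  exact ⟨b, by rw [cdf_eq_real] at hb; exact hb.le⟩

theorem measureReal_Iic_lt_of_lt_quantile (hq : 0 < q) (ha : a < quantile ν q) :
    ν.real (Set.Iic a) < q := by
  by_contra hcon
  obtain ⟨c, hc⟩ := exists_measureReal_Iic_lt (ν := ν) hq
  exact absurd (ha.trans_le (csInf_le ⟨c, bddBelow_of_measureReal_Iic_lt hc⟩ (not_lt.1 hcon)))
    (lt_irrefl _)

theorem lt_measureReal_Iic_of_quantile_lt (hq : q < 1)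
    (hb : quantile (gaussianReal 0 1) q < b) : q < (gaussianReal 0 1).real (Set.Iic b) := by
  obtain ⟨t, ht, htb⟩ := exists_lt_of_csInf_lt (exists_le_measureReal_Iic hq) hb
  have hpos : 0 < (gaussianReal 0 1).real (Set.Ioc t b) := by
    rw [measureReal_def, ENNReal.toReal_pos_iff]
    refine ⟨pos_iff_ne_zero.2 fun h0 => ?_, measure_lt_top _ _⟩
    have := gaussianReal_absolutelyContinuous' 0 one_ne_zero h0
    simp at this
    linarith
  have hsplit : (gaussianReal 0 1).real (Set.Iic b) =
      (gaussianReal 0 1).real (Set.Iic t) + (gaussianReal 0 1).real (Set.Ioc t b) := by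
    rw [← Set.Iic_union_Ioc_eq_Iic htb.le, measureReal_union ?_ measurableSet_Ioc]
    exact Set.disjoint_left.2 fun x hx hx' => absurd hx (not_le.2 hx'.1)
  have : q ≤ (gaussianReal 0 1).real (Set.Iic t) := ht
  linarith

theorem gaussianReal_Ioc_le (a b : ℝ) :
    gaussianReal 0 1 (Set.Ioc a b) ≤ ENNReal.ofReal (b - a) := by
  rw [gaussianReal_apply 0 one_ne_zero]
  calc ∫⁻ x in Set.Ioc a b, gaussianPDF 0 1 x ≤ ∫⁻ _ in Set.Ioc a b, 1 := by
        refine lintegral_mono fun x => ?_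
        rw [gaussianPDF, ← ENNReal.ofReal_one]
        refine ENNReal.ofReal_le_ofReal ?_
        rw [gaussianPDFReal]
        have h1 : (1 : ℝ) ≤ √(2 * Real.pi * ((1 : NNReal) : ℝ)) := by
          rw [Real.one_le_sqrt]
          have := Real.pi_gt_three
          simp
          linarith
        have h2 : Real.exp (-(x - 0) ^ 2 / (2 * ((1 : NNReal) : ℝ))) ≤ 1 := by
          refine Real.exp_le_one_iff.2 ?_
          simp only [NNReal.coe_one]
          nlinarith [sq_nonneg (x - 0)]
        exact mul_le_one₀ (inv_le_one_of_one_le₀ h1) (Real.exp_pos _).le h2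
    _ = _ := by simp

end Quantile

/-! ### Biases, errors, and the variance of their products -/

section Estimators

variable {n k : ℕ}

@[fun_prop]
theorem measurable_fitX (Q : LawHat n k) [∀ i, IsMarkovKernel (Q i)] (i : Fin n) :
    Measurable fun d : Sample n k => fitX Q d i :=
  (measurable_integral_kernel (Q i)).comp (f := fun d : Sample n k => (dataXZ d, obsZ (d i)))
    (by fun_prop)

@[fun_prop]
theorem measurable_fitY {m : RegHat n k} (hm : Measurable (Function.uncurry m)) (i : Fin n) :
    Measurable fun d : Sample n k => fitY m d i :=
  hm.comp (f := fun d : Sample n k => (dataYZ d, obsZ (d i))) (by fun_prop)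

theorem measurable_evariance_learnedLaw (Q : LawHat n k) [∀ i, IsMarkovKernel (Q i)] (i : Fin n) :
    Measurable fun d : Sample n k => eVar[id; learnedLaw Q d i] :=
  (measurable_evariance_kernel (Q i)).comp (f := fun d : Sample n k => (dataXZ d, obsZ (d i)))
    (by fun_prop)

theorem measurable_absMoment_learnedLaw (Q : LawHat n k) [∀ i, IsMarkovKernel (Q i)] (r : ℝ)
    (i : Fin n) : Measurable fun d : Sample n k => absMoment (learnedLaw Q d i) (fitX Q d i) r :=
  (measurable_absMoment_kernel (Q i) (measurable_integral_kernel (Q i)) r).comp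
    (f := fun d : Sample n k => (dataXZ d, obsZ (d i))) (by fun_prop)

instance (Q : LawHat n k) [∀ i, IsMarkovKernel (Q i)] (d : Sample n k) (i : Fin n) :
    IsProbabilityMeasure (learnedLaw Q d i) := by
  unfold learnedLaw; infer_instance

instance (Q : LawHat n k) [∀ i, IsMarkovKernel (Q i)] (d : Sample n k) :
    IsProbabilityMeasure (resampleLaw Q d) := by
  unfold resampleLaw; infer_instance

instance (L : Measure (Obs k)) [IsProbabilityMeasure L] : IsProbabilityMeasure (sampleLaw n L) := by
  unfold sampleLaw; infer_instance

/-- The error `μ̂ₓ(Zᵢ) - μₓ(Zᵢ)` of the fitted value. -/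
noncomputable def biasX (L : Measure (Obs k)) [IsProbabilityMeasure L] (Q : LawHat n k)
    (d : Sample n k) (i : Fin n) : ℝ := fitX Q d i - meanX L (obsZ (d i))

/-- The error `μ̂_y(Zᵢ) - μ_y(Zᵢ)` of the fitted value. -/
noncomputable def biasY (L : Measure (Obs k)) [IsProbabilityMeasure L] (m : RegHat n k)
    (d : Sample n k) (i : Fin n) : ℝ := fitY m d i - meanY L (obsZ (d i))

/-- The variance `E[(X - μₓ(Z))² (Y - μ_y(Z))²]` of the product of the two errors. -/
noncomputable def errVar (L : Measure (Obs k)) [IsProbabilityMeasure L] : ℝ :=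
  ∫ o, (epsX L o * epsY L o) ^ 2 ∂L

@[fun_prop]
theorem measurable_biasX (L : Measure (Obs k)) [IsProbabilityMeasure L] (Q : LawHat n k)
    [∀ i, IsMarkovKernel (Q i)] (i : Fin n) : Measurable fun d => biasX L Q d i := by
  unfold biasX; fun_prop

theorem measurable_biasY (L : Measure (Obs k)) [IsProbabilityMeasure L] {m : RegHat n k}
    (hm : Measurable (Function.uncurry m)) (i : Fin n) : Measurable fun d => biasY L m d i := by
  unfold biasY
  have := measurable_fitY hm i
  fun_prop

theorem residProd_eq (L : Measure (Obs k)) [IsProbabilityMeasure L] (Q : LawHat n k)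
    (m : RegHat n k) (d : Sample n k) (i : Fin n) :
    residProd Q m d i = (epsX L (d i) - biasX L Q d i) * (epsY L (d i) - biasY L m d i) := by
  unfold residProd epsX epsY biasX biasY; ring

/-- The resampling variance, for learned laws of finite variance. -/
theorem dcrtVar_eq (Q : LawHat n k) [∀ i, IsMarkovKernel (Q i)] (m : RegHat n k) (d : Sample n k)
    (hfin : ∀ i, eVar[id; learnedLaw Q d i] < ∞) :
    dcrtVar Q m d =
      (1 / (n : ℝ)) * ∑ i, Var[id; learnedLaw Q d i] * (obsY (d i) - fitY m d i) ^ 2 := by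
  have hmem : ∀ i, MemLp id 2 (learnedLaw Q d i) := fun i =>
    (evariance_lt_top_iff_memLp aestronglyMeasurable_id).1 (hfin i)
  have hmem' : ∀ i, MemLp (fun x => (x - fitX Q d i) * (obsY (d i) - fitY m d i)) 2
      (learnedLaw Q d i) := fun i => by
    have := ((hmem i).sub (memLp_const (fitX Q d i))).const_mul (obsY (d i) - fitY m d i)
    refine this.ae_eq (ae_of_all _ fun x => ?_)
    simp [mul_comm]
  have h := variance_sum_pi (μ := fun i => learnedLaw Q d i) hmem'
  unfold dcrtVar resampleLaw
  have hst : statAt Q m d = fun x => (1 / √(n : ℝ)) *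
      (∑ i, fun x : Fin n → ℝ => (x i - fitX Q d i) * (obsY (d i) - fitY m d i)) x := by
    ext x
    simp [statAt]
  rw [hst, variance_const_mul, h, div_pow, one_pow, Real.sq_sqrt (Nat.cast_nonneg n)]
  congr 1
  refine Finset.sum_congr rfl fun i _ => ?_
  rw [variance_mul_const]
  congr 1
  exact variance_sub_const (X := id) aestronglyMeasurable_id (fitX Q d i)

end Estimators

theorem tendsto_inner_of_tendsto_sqrt {β : Type*} {l : Filter β} {f : β → ℝ≥0∞}
    (h : Tendsto (fun b => f b ^ (1 / 2 : ℝ)) l (𝓝 0)) : Tendsto f l (𝓝 0) := by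
  have h2 := ((ENNReal.continuous_rpow_const (y := (2 : ℝ))).tendsto 0).comp h
  rw [ENNReal.zero_rpow_of_pos two_pos] at h2
  refine h2.congr fun b => ?_
  simp only [Function.comp]
  rw [← ENNReal.rpow_mul]
  norm_num

theorem tendsto_mean_sq_of_ennreal {β : Type*} {l : Filter β} {n : β → ℕ}
    {u v : ∀ b, Fin (n b) → ℝ} (hn : ∀ᶠ b in l, 1 ≤ n b)
    (h : Tendsto (fun b => (n b : ℝ≥0∞)⁻¹ *
      ∑ i, ENNReal.ofReal (u b i ^ 2) * ENNReal.ofReal (v b i ^ 2)) l (𝓝 0)) :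
    Tendsto (fun b => (1 / (n b : ℝ)) * ∑ i, (u b i * v b i) ^ 2) l (𝓝 0) := by
  have h2 := (ENNReal.tendsto_toReal ENNReal.zero_ne_top).comp h
  refine h2.congr' ?_
  filter_upwards [hn] with b hb
  simp only [Function.comp, ENNReal.toReal_mul, ENNReal.toReal_inv, ENNReal.toReal_natCast, one_div]
  rw [ENNReal.toReal_sum fun i _ => ENNReal.mul_ne_top ENNReal.ofReal_ne_top ENNReal.ofReal_ne_top]
  congr 1
  refine Finset.sum_congr rfl fun i _ => ?_
  rw [ENNReal.toReal_mul, ENNReal.toReal_ofReal (sq_nonneg _), ENNReal.toReal_ofReal (sq_nonneg _),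
    mul_pow]

/-- Uniform bounds on the product of the two errors: the variance is at least `c`, and `C` bounds both
the variance and the moment of order `2 + δ`. -/
structure ErrBounds {p : ℕ → ℕ} (L : ∀ n, Measure (Obs (p n))) [∀ n, IsProbabilityMeasure (L n)]
    (c C δ : ℝ) : Prop where
  c_pos : 0 < c
  δ_pos : 0 < δ
  le_errVar : ∀ n ≥ 1, c ≤ errVar (L n)
  errVar_le : ∀ n ≥ 1, errVar (L n) ≤ C
  integrable : ∀ n ≥ 1, Integrable (fun o => (epsX (L n) o * epsY (L n) o) ^ 2) (L n)
  moment_le : ∀ n ≥ 1, ∫⁻ o, ENNReal.ofReal (|epsX (L n) o * epsY (L n) o| ^ (2 + δ)) ∂(L n) ≤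
    ENNReal.ofReal C

section Limits

variable {p : ℕ → ℕ} {L : ∀ n, Measure (Obs (p n))} [∀ n, IsProbabilityMeasure (L n)]
  {Q : ∀ n, LawHat n (p n)} [∀ n i, IsMarkovKernel (Q n i)] {m : ∀ n, RegHat n (p n)}
  {c C δ : ℝ}

theorem SP2.exists_errBounds (h : SP2 L) : ∃ c C δ, ErrBounds L c C δ := by
  obtain ⟨c₁, c₂, δ, hc₁, hc₂, hδ, hlow, hup⟩ := h
  have hmom : ∀ n ≥ 1, ∫⁻ o, ENNReal.ofReal (|epsX (L n) o * epsY (L n) o| ^ (2 + δ)) ∂(L n) ≤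
      ENNReal.ofReal c₂ := fun n hn => (le_iSup₂ (f := fun n (_ : n ≥ 1) => ∫⁻ o, ENNReal.ofReal
      (|(obsX o - meanX (L n) (obsZ o)) * (obsY o - meanY (L n) (obsZ o))| ^ (2 + δ)) ∂(L n))
      n hn).trans hup.le
  have hsq : ∀ n ≥ 1, ∫⁻ o, ENNReal.ofReal ((epsX (L n) o * epsY (L n) o) ^ 2) ∂(L n) ≤
      ENNReal.ofReal (1 + c₂) := by
    intro n hn
    calc ∫⁻ o, ENNReal.ofReal ((epsX (L n) o * epsY (L n) o) ^ 2) ∂(L n)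
        ≤ ∫⁻ o, (1 + ENNReal.ofReal (|epsX (L n) o * epsY (L n) o| ^ (2 + δ))) ∂(L n) := by
          refine lintegral_mono fun o => ?_
          rw [← ENNReal.ofReal_one, ← ENNReal.ofReal_add zero_le_one (by positivity), ← sq_abs]
          refine ENNReal.ofReal_le_ofReal ?_
          rcases le_or_gt |epsX (L n) o * epsY (L n) o| 1 with h1 | h1
          · have h2 : |epsX (L n) o * epsY (L n) o| ^ 2 ≤ 1 := pow_le_one₀ (abs_nonneg _) h1
            have h3 : 0 ≤ |epsX (L n) o * epsY (L n) o| ^ (2 + δ) := by positivity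
            linarith
          · have h2 : |epsX (L n) o * epsY (L n) o| ^ (2 : ℝ) ≤
                |epsX (L n) o * epsY (L n) o| ^ (2 + δ) :=
              Real.rpow_le_rpow_of_exponent_le h1.le (by linarith)
            rw [Real.rpow_two] at h2
            linarith
      _ ≤ _ := by
          rw [lintegral_add_left measurable_const, ENNReal.ofReal_add zero_le_one hc₂.le]
          simpa using hmom n hn
  have hm : ∀ n, Measurable fun o => (epsX (L n) o * epsY (L n) o) ^ 2 := fun n => by fun_prop
  have hint : ∀ n ≥ 1, Integrable (fun o => (epsX (L n) o * epsY (L n) o) ^ 2) (L n) := fun n hn =>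
    (lintegral_ofReal_ne_top_iff_integrable (hm n).aestronglyMeasurable
      (ae_of_all _ fun o => sq_nonneg _)).1 (ne_top_of_le_ne_top ENNReal.ofReal_ne_top (hsq n hn))
  refine ⟨c₁, 1 + c₂, δ, hc₁, hδ, fun n hn => ?_, fun n hn => ?_, hint, fun n hn =>
    (hmom n hn).trans (ENNReal.ofReal_le_ofReal (by linarith))⟩
  · have h1 := hlow.le.trans (iInf₂_le n hn)
    have h2 : ENNReal.ofReal c₁ ≤ ENNReal.ofReal (errVar (L n)) := by
      unfold errVar
      rw [ofReal_integral_eq_lintegral_ofReal (hint n hn) (ae_of_all _ fun o => sq_nonneg _)]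
      simpa only [mul_pow, epsX, epsY] using h1
    exact (ENNReal.ofReal_le_ofReal_iff (integral_nonneg fun o => sq_nonneg _)).1 h2
  · unfold errVar
    rw [integral_eq_lintegral_of_nonneg_ae (ae_of_all _ fun o => sq_nonneg _)
      (hm n).aestronglyMeasurable]
    exact ENNReal.toReal_le_of_le_ofReal (by linarith) (hsq n hn)

/-- The law of large numbers for the squared products of errors. -/
theorem ErrBounds.tendsto_mean_sq (hB : ErrBounds L c C δ) :
    Tendsto (fun a : Σ n, Sample n (p n) =>
      (1 / (a.1 : ℝ)) * ∑ i, (epsX (L a.1) (a.2 i) * epsY (L a.1) (a.2 i)) ^ 2 - errVar (L a.1))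
      (whp fun n => sampleLaw n (L n)) (𝓝 0) := by
  have hδ := hB.δ_pos
  refine tendsto_mean_of_iid (f := fun n o => (epsX (L n) o * epsY (L n) o) ^ 2)
    (fun n => by fun_prop) (fun n o => sq_nonneg _) (q := 1 + δ / 2) (by linarith) (C := C)
    fun n hn => ?_
  refine le_trans (le_of_eq (lintegral_congr fun o => ?_)) (hB.moment_le n hn)
  rw [← sq_abs, ← Real.rpow_natCast, ← Real.rpow_mul (abs_nonneg _)]
  congr 2
  push_cast; ring

/-- The law of large numbers for the products of the conditional variances, whose mean is also
`errVar`: a product of independent errors has the product of the variances as its variance. -/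
theorem ErrBounds.tendsto_mean_variance (hB : ErrBounds L c C δ) (hnull : ∀ n ≥ 1, IsNull (L n)) :
    Tendsto (fun a : Σ n, Sample n (p n) => (1 / (a.1 : ℝ)) * ∑ i,
        Var[id; condLawX (L a.1) (obsZ (a.2 i))] * Var[id; condLawY (L a.1) (obsZ (a.2 i))] -
      errVar (L a.1)) (whp fun n => sampleLaw n (L n)) (𝓝 0) := by
  have hδ := hB.δ_pos
  have hme : ∀ n, Measurable fun o : Obs (p n) =>
      eVar[id; condLawX (L n) (obsZ o)] * eVar[id; condLawY (L n) (obsZ o)] := fun n =>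
    (measurable_evariance_kernel (kerX (L n))).mul (measurable_evariance_kernel (kerY (L n)))
  have hm : ∀ n, Measurable fun o : Obs (p n) =>
      Var[id; condLawX (L n) (obsZ o)] * Var[id; condLawY (L n) (obsZ o)] := fun n =>
    (measurable_evariance_kernel (kerX (L n))).ennreal_toReal.mul
      (measurable_evariance_kernel (kerY (L n))).ennreal_toReal
  have hle : ∀ n ≥ 1, ∫⁻ o, (eVar[id; condLawX (L n) (obsZ o)] *
      eVar[id; condLawY (L n) (obsZ o)]) ^ (1 + δ / 2) ∂(L n) ≤ ENNReal.ofReal C := by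
    intro n hn
    refine le_trans ?_ (hB.moment_le n hn)
    rw [(hnull n hn).lintegral_abs_mul_rpow]
    refine lintegral_mono fun o => ?_
    simp only
    rw [ENNReal.mul_rpow_of_nonneg _ _ (by linarith), evariance_id_eq_absMoment,
      evariance_id_eq_absMoment]
    have he : 2 + δ = 2 * (1 + δ / 2) := by ring
    rw [he]
    gcongr
    · exact absMoment_rpow_le _ _ (by linarith)
    · exact absMoment_rpow_le _ _ (by linarith)
  have hofReal : ∀ n, ∀ o : Obs (p n), ENNReal.ofReal
      (Var[id; condLawX (L n) (obsZ o)] * Var[id; condLawY (L n) (obsZ o)]) ≤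
      eVar[id; condLawX (L n) (obsZ o)] * eVar[id; condLawY (L n) (obsZ o)] := fun n o => by
    rw [variance, variance, ← ENNReal.toReal_mul]
    exact ENNReal.ofReal_toReal_le
  have h := tendsto_mean_of_iid (L := L) (f := fun n o =>
      Var[id; condLawX (L n) (obsZ o)] * Var[id; condLawY (L n) (obsZ o)])
    hm (fun n o => mul_nonneg (variance_nonneg _ _) (variance_nonneg _ _))
    (q := 1 + δ / 2) (by linarith) (C := C) fun n hn => by
      refine le_trans (lintegral_mono fun o => ?_) (hle n hn)
      rw [← ENNReal.ofReal_rpow_of_nonneg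
        (mul_nonneg (variance_nonneg _ _) (variance_nonneg _ _)) (by linarith)]
      gcongr
      exact hofReal n o
  refine h.congr' ?_
  filter_upwards [tendsto_fst_whp.eventually (eventually_ge_atTop 1)] with a ha
  congr 1
  unfold errVar
  have hlint : ∫⁻ o, ENNReal.ofReal ((epsX (L a.1) o * epsY (L a.1) o) ^ 2) ∂(L a.1) =
      ∫⁻ o, eVar[id; condLawX (L a.1) (obsZ o)] * eVar[id; condLawY (L a.1) (obsZ o)] ∂(L a.1) := by
    have := (hnull a.1 ha).lintegral_abs_mul_rpow 2
    simp only [Real.rpow_two, sq_abs] at this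
    rw [this]
    refine lintegral_congr fun o => ?_
    rw [evariance_id_eq_absMoment, evariance_id_eq_absMoment]
    rfl
  have hmsq : Measurable fun o => (epsX (L a.1) o * epsY (L a.1) o) ^ 2 := by fun_prop
  rw [integral_eq_lintegral_of_nonneg_ae (ae_of_all _ fun o => sq_nonneg _)
    hmsq.aestronglyMeasurable, hlint,
    ← integral_toReal (hme a.1).aemeasurable ?_]
  · refine integral_congr_ae (ae_of_all _ fun o => ?_)
    simp only [ENNReal.toReal_mul]
    rfl
  · have hfin := ae_lt_top ((hme a.1).pow_const (1 + δ / 2))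
      (ne_top_of_le_ne_top ENNReal.ofReal_ne_top (hle a.1 ha))
    filter_upwards [hfin] with o ho
    exact (ENNReal.rpow_lt_top_iff_of_pos (by linarith)).1 ho

end Limits

/-! ### The contribution of the estimation errors -/

section Bias

variable {p : ℕ → ℕ} {L : ∀ n, Measure (Obs (p n))} [∀ n, IsProbabilityMeasure (L n)]
  {Q : ∀ n, LawHat n (p n)} {m : ∀ n, RegHat n (p n)} {c C δ : ℝ}

theorem NDG2.eventually_whp (hN : NDG2 L Q m) :
    ∀ᶠ a : Σ n, Sample n (p n) in whp fun n => sampleLaw n (L n), ∀ i,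
      0 < eVar[id; learnedLaw (Q a.1) a.2 i] ∧ eVar[id; learnedLaw (Q a.1) a.2 i] < ∞ :=
  eventually_whp_of_ae fun n hn => (hN n hn).mono fun _ hd i => ⟨(hd i).1, (hd i).2.1⟩

theorem eventually_one_le_fst {P : ∀ n, Measure (Sample n (p n))} :
    ∀ᶠ a in whp P, 1 ≤ a.1 :=
  tendsto_fst_whp.eventually (eventually_ge_atTop 1)

/-- The double robustness term: the product of the two biases is controlled by Cauchy-Schwarz. -/
theorem tendsto_sum_abs_bias_mul (h : ConvInProb (fun n => sampleLaw n (L n))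
      (fun n d => √(n : ℝ) * (errX (L n) (Q n) d * errY (L n) (m n) d)) 0) :
    Tendsto (fun a : Σ n, Sample n (p n) => (1 / √(a.1 : ℝ)) *
      ∑ i, |biasX (L a.1) (Q a.1) a.2 i * biasY (L a.1) (m a.1) a.2 i|)
      (whp fun n => sampleLaw n (L n)) (𝓝 0) := by
  refine squeeze_zero' (Eventually.of_forall fun a => by positivity) ?_
    (convInProb_iff_tendsto.1 h)
  filter_upwards [eventually_one_le_fst] with a ha
  have hn0 : (0 : ℝ) < a.1 := by exact_mod_cast ha
  have hcs := Finset.sum_mul_sq_le_sq_mul_sq Finset.univ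
    (fun i => |biasX (L a.1) (Q a.1) a.2 i|) (fun i => |biasY (L a.1) (m a.1) a.2 i|)
  simp only [sq_abs] at hcs
  have h1 := Real.le_sqrt_of_sq_le hcs
  simp only [abs_mul]
  unfold errX errY
  rw [← Real.sqrt_mul (by positivity), ← Real.sqrt_mul (by positivity)]
  calc (1 / √(a.1 : ℝ)) * ∑ i, |biasX (L a.1) (Q a.1) a.2 i| * |biasY (L a.1) (m a.1) a.2 i|
      ≤ (1 / √(a.1 : ℝ)) * √((∑ i, biasX (L a.1) (Q a.1) a.2 i ^ 2) *
        ∑ i, biasY (L a.1) (m a.1) a.2 i ^ 2) := by gcongr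
    _ = √((1 / (a.1 : ℝ)) * ((∑ i, biasX (L a.1) (Q a.1) a.2 i ^ 2) *
        ∑ i, biasY (L a.1) (m a.1) a.2 i ^ 2)) := by
        rw [Real.sqrt_mul (by positivity : (0 : ℝ) ≤ 1 / a.1), Real.sqrt_div zero_le_one,
          Real.sqrt_one]
    _ = _ := by
        congr 1
        unfold biasX biasY
        field_simp

theorem tendsto_linear_bias_mul (h : ConvInProb (fun n => sampleLaw n (L n))
      (fun n d => √(n : ℝ) * (errX (L n) (Q n) d * errY (L n) (m n) d)) 0) :
    Tendsto (fun a : Σ n, Sample n (p n) => (1 / √(a.1 : ℝ)) *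
      ∑ i, biasX (L a.1) (Q a.1) a.2 i * biasY (L a.1) (m a.1) a.2 i)
      (whp fun n => sampleLaw n (L n)) (𝓝 0) := by
  refine squeeze_zero_norm (fun a => ?_) (tendsto_sum_abs_bias_mul h)
  rw [Real.norm_eq_abs, abs_mul, abs_of_nonneg (by positivity : 0 ≤ 1 / √(a.1 : ℝ))]
  gcongr
  exact Finset.abs_sum_le_sum_abs _ _

theorem tendsto_mean_sq_bias_mul (h : ConvInProb (fun n => sampleLaw n (L n))
      (fun n d => √(n : ℝ) * (errX (L n) (Q n) d * errY (L n) (m n) d)) 0) :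
    Tendsto (fun a : Σ n, Sample n (p n) => (1 / (a.1 : ℝ)) *
      ∑ i, (biasX (L a.1) (Q a.1) a.2 i * biasY (L a.1) (m a.1) a.2 i) ^ 2)
      (whp fun n => sampleLaw n (L n)) (𝓝 0) := by
  have h1 := (tendsto_sum_abs_bias_mul h).pow 2
  rw [zero_pow two_ne_zero] at h1
  refine squeeze_zero (fun a => by positivity) (fun a => ?_) h1
  rw [mul_pow, div_pow, one_pow, Real.sq_sqrt (Nat.cast_nonneg _)]
  gcongr
  have := Finset.sum_sq_le_sq_sum_of_nonneg (s := Finset.univ)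
    (f := fun i => |biasX (L a.1) (Q a.1) a.2 i * biasY (L a.1) (m a.1) a.2 i|)
    fun i _ => abs_nonneg _
  simpa only [sq_abs] using this

theorem tendsto_mean_variance_mul_biasY_sq (hN : NDG2 L Q m)
    (h : ConvInProbZero (fun n => sampleLaw n (L n)) (fun n d => errYHat' (L n) (Q n) (m n) d)) :
    Tendsto (fun a : Σ n, Sample n (p n) => (1 / (a.1 : ℝ)) *
      ∑ i, (biasY (L a.1) (m a.1) a.2 i * √Var[id; learnedLaw (Q a.1) a.2 i]) ^ 2)
      (whp fun n => sampleLaw n (L n)) (𝓝 0) := by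
  have h0 := tendsto_inner_of_tendsto_sqrt (convInProbZero_iff_tendsto.1 h)
  refine tendsto_mean_sq_of_ennreal eventually_one_le_fst (h0.congr' ?_)
  filter_upwards [hN.eventually_whp] with a ha
  congr 1
  refine Finset.sum_congr rfl fun i _ => ?_
  rw [Real.sq_sqrt (variance_nonneg _ _), variance, ENNReal.ofReal_toReal (ha i).2.ne]
  rfl

variable [∀ n i, IsMarkovKernel (Q n i)]

theorem lintegral_epsX_sq_setX {k : ℕ} (L : Measure (Obs k)) [IsProbabilityMeasure L] (o : Obs k) :
    ∫⁻ w, ENNReal.ofReal (epsX L (setX o w) ^ 2) ∂(kerX L o) = eVar[id; condLawX L (obsZ o)] := by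
  rw [evariance_eq_lintegral_ofReal]; rfl

theorem lintegral_epsY_sq_setY {k : ℕ} (L : Measure (Obs k)) [IsProbabilityMeasure L] (o : Obs k) :
    ∫⁻ w, ENNReal.ofReal (epsY L (setY o w) ^ 2) ∂(kerY L o) = eVar[id; condLawY L (obsZ o)] := by
  rw [evariance_eq_lintegral_ofReal]; rfl

/-- The bias of `μ̂ₓ` only depends on the `(X, Z)`-data, so it can be averaged against `Y`. -/
theorem tendsto_mean_sq_biasX (hnull : ∀ n ≥ 1, IsNull (L n))
    (h : ConvInProbZero (fun n => sampleLaw n (L n)) (fun n d => errX' (L n) (Q n) d)) :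
    Tendsto (fun a : Σ n, Sample n (p n) => (1 / (a.1 : ℝ)) *
      ∑ i, (biasX (L a.1) (Q a.1) a.2 i * epsY (L a.1) (a.2 i)) ^ 2)
      (whp fun n => sampleLaw n (L n)) (𝓝 0) := by
  have h0 := tendsto_inner_of_tendsto_sqrt (convInProbZero_iff_tendsto.1 h)
  refine tendsto_mean_sq_of_ennreal eventually_one_le_fst ?_
  refine tendsto_sum_mul_of_refresh (L := L) (fun n hn => (hnull n hn).isRefresh_Y)
    (fun n => (n : ℝ≥0∞)⁻¹) (C := fun n d i => ENNReal.ofReal (biasX (L n) (Q n) d i ^ 2))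
    (fun n i => by fun_prop) (fun n d w => rfl)
    (E := fun n o => ENNReal.ofReal (epsY (L n) o ^ 2)) (fun n => by fun_prop) ?_
  simp only [lintegral_epsY_sq_setY]
  exact h0

theorem tendsto_linear_biasX (hnull : ∀ n ≥ 1, IsNull (L n))
    (h : ConvInProbZero (fun n => sampleLaw n (L n)) (fun n d => errX' (L n) (Q n) d)) :
    Tendsto (fun a : Σ n, Sample n (p n) => (1 / √(a.1 : ℝ)) *
      ∑ i, biasX (L a.1) (Q a.1) a.2 i * epsY (L a.1) (a.2 i))
      (whp fun n => sampleLaw n (L n)) (𝓝 0) := by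
  have h0 := tendsto_inner_of_tendsto_sqrt (convInProbZero_iff_tendsto.1 h)
  exact tendsto_linear_of_refresh (L := L) (κ := fun n => kerY (L n)) (g := fun n => setY)
    (fun n hn => (hnull n hn).isRefresh_Y)
    (c := fun n d i => biasX (L n) (Q n) d i) (fun n i => by fun_prop) (fun n d w => rfl)
    (e := fun n o => epsY (L n) o) (fun n => by fun_prop) (fun n o w => rfl) h0

theorem tendsto_mean_sq_biasY (hm : ∀ n, Measurable (Function.uncurry (m n)))
    (hnull : ∀ n ≥ 1, IsNull (L n))
    (h : ConvInProbZero (fun n => sampleLaw n (L n)) (fun n d => errY' (L n) (m n) d)) :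
    Tendsto (fun a : Σ n, Sample n (p n) => (1 / (a.1 : ℝ)) *
      ∑ i, (biasY (L a.1) (m a.1) a.2 i * epsX (L a.1) (a.2 i)) ^ 2)
      (whp fun n => sampleLaw n (L n)) (𝓝 0) := by
  have h0 := tendsto_inner_of_tendsto_sqrt (convInProbZero_iff_tendsto.1 h)
  refine tendsto_mean_sq_of_ennreal eventually_one_le_fst ?_
  refine tendsto_sum_mul_of_refresh (L := L) (fun n hn => (hnull n hn).isRefresh_X)
    (fun n => (n : ℝ≥0∞)⁻¹) (C := fun n d i => ENNReal.ofReal (biasY (L n) (m n) d i ^ 2))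
    (fun n i => ((measurable_biasY (L n) (hm n) i).pow_const 2).ennreal_ofReal) (fun n d w => rfl)
    (E := fun n o => ENNReal.ofReal (epsX (L n) o ^ 2)) (fun n => by fun_prop) ?_
  simp only [lintegral_epsX_sq_setX]
  exact h0

theorem tendsto_linear_biasY (hm : ∀ n, Measurable (Function.uncurry (m n)))
    (hnull : ∀ n ≥ 1, IsNull (L n))
    (h : ConvInProbZero (fun n => sampleLaw n (L n)) (fun n d => errY' (L n) (m n) d)) :
    Tendsto (fun a : Σ n, Sample n (p n) => (1 / √(a.1 : ℝ)) *
      ∑ i, biasY (L a.1) (m a.1) a.2 i * epsX (L a.1) (a.2 i))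
      (whp fun n => sampleLaw n (L n)) (𝓝 0) := by
  have h0 := tendsto_inner_of_tendsto_sqrt (convInProbZero_iff_tendsto.1 h)
  exact tendsto_linear_of_refresh (L := L) (κ := fun n => kerX (L n)) (g := fun n => setX)
    (fun n hn => (hnull n hn).isRefresh_X)
    (c := fun n d i => biasY (L n) (m n) d i) (fun n i => measurable_biasY (L n) (hm n) i)
    (fun n d w => rfl) (e := fun n o => epsX (L n) o) (fun n => by fun_prop) (fun n o w => rfl) h0

/-- The part of the product of residuals that involves an estimation error. -/
noncomputable def residRem {n k : ℕ} (L : Measure (Obs k)) [IsProbabilityMeasure L]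
    (Q : LawHat n k) (m : RegHat n k) (d : Sample n k) (i : Fin n) : ℝ :=
  biasX L Q d i * biasY L m d i - biasX L Q d i * epsY L (d i) - biasY L m d i * epsX L (d i)

theorem residProd_eq_add {n k : ℕ} (L : Measure (Obs k)) [IsProbabilityMeasure L]
    (Q : LawHat n k) (m : RegHat n k) (d : Sample n k) (i : Fin n) :
    residProd Q m d i = epsX L (d i) * epsY L (d i) + residRem L Q m d i := by
  rw [residProd_eq L, residRem]; ring

theorem SP1'.tendsto_linear_residRem (h : SP1' L Q m)
    (hm : ∀ n, Measurable (Function.uncurry (m n))) (hnull : ∀ n ≥ 1, IsNull (L n)) :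
    Tendsto (fun a : Σ n, Sample n (p n) => (1 / √(a.1 : ℝ)) *
      ∑ i, residRem (L a.1) (Q a.1) (m a.1) a.2 i) (whp fun n => sampleLaw n (L n)) (𝓝 0) := by
  have := ((tendsto_linear_bias_mul h.1).sub (tendsto_linear_biasX hnull h.2.1)).sub
    (tendsto_linear_biasY hm hnull h.2.2.1)
  simp only [sub_zero] at this
  refine this.congr fun a => ?_
  simp only [residRem, Finset.sum_sub_distrib]
  ring

theorem SP1'.tendsto_mean_sq_residRem (h : SP1' L Q m)
    (hm : ∀ n, Measurable (Function.uncurry (m n))) (hnull : ∀ n ≥ 1, IsNull (L n)) :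
    Tendsto (fun a : Σ n, Sample n (p n) => (1 / (a.1 : ℝ)) *
      ∑ i, residRem (L a.1) (Q a.1) (m a.1) a.2 i ^ 2)
      (whp fun n => sampleLaw n (L n)) (𝓝 0) := by
  have := (((tendsto_mean_sq_bias_mul h.1).add (tendsto_mean_sq_biasX hnull h.2.1)).add
    (tendsto_mean_sq_biasY hm hnull h.2.2.1)).const_mul 3
  simp only [add_zero, mul_zero] at this
  refine squeeze_zero (fun a => by positivity) (fun a => ?_) this
  rw [← mul_add, ← mul_add, ← Finset.sum_add_distrib, ← Finset.sum_add_distrib, mul_left_comm,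
    Finset.mul_sum (a := (3 : ℝ))]
  gcongr with i
  unfold residRem
  set u := biasX (L a.1) (Q a.1) a.2 i * biasY (L a.1) (m a.1) a.2 i
  set v := biasX (L a.1) (Q a.1) a.2 i * epsY (L a.1) (a.2 i)
  set w := biasY (L a.1) (m a.1) a.2 i * epsX (L a.1) (a.2 i)
  nlinarith [sq_nonneg (u + v), sq_nonneg (u + w), sq_nonneg (v - w)]

/-! ### Consistency of the two variance estimates -/

/-- The GCM variance estimate is consistent: the residual products differ from the products of errors
by a term that is negligible both in mean square and in mean. -/
theorem ErrBounds.tendsto_gcmVar (hB : ErrBounds L c C δ) (h : SP1' L Q m)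
    (hm : ∀ n, Measurable (Function.uncurry (m n))) (hY : ∀ n ≥ 1, Integrable obsY (L n))
    (hnull : ∀ n ≥ 1, IsNull (L n)) :
    Tendsto (fun a : Σ n, Sample n (p n) => gcmVar (Q a.1) (m a.1) a.2 - errVar (L a.1))
      (whp fun n => sampleLaw n (L n)) (𝓝 0) := by
  have hle : ∀ᶠ a : Σ n, Sample n (p n) in whp fun n => sampleLaw n (L n),
      errVar (L a.1) ≤ C := by
    filter_upwards [eventually_one_le_fst] with a ha using hB.errVar_le a.1 ha
  have h1 := tendsto_mean_sq_add hle hB.tendsto_mean_sq (h.tendsto_mean_sq_residRem hm hnull)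
  have hmean0 : Tendsto (fun a : Σ n, Sample n (p n) =>
      (1 / (a.1 : ℝ)) * ∑ i, epsX (L a.1) (a.2 i) * epsY (L a.1) (a.2 i))
      (whp fun n => sampleLaw n (L n)) (𝓝 0) := by
    refine tendsto_mean_zero_of_iid (f := fun n o => epsX (L n) o * epsY (L n) o)
      (fun n => by fun_prop) (fun n hn => (hnull n hn).integral_mul_eq_zero (hY n hn))
      (C := C) fun n hn => ?_
    rw [← ofReal_integral_eq_lintegral_ofReal (hB.integrable n hn)
      (ae_of_all _ fun o => sq_nonneg _)]
    exact ENNReal.ofReal_le_ofReal (hB.errVar_le n hn)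
  have hmean1 : Tendsto (fun a : Σ n, Sample n (p n) =>
      (1 / (a.1 : ℝ)) * ∑ i, residRem (L a.1) (Q a.1) (m a.1) a.2 i)
      (whp fun n => sampleLaw n (L n)) (𝓝 0) := by
    refine squeeze_zero_norm' ?_ (tendsto_zero_iff_norm_tendsto_zero.1 (h.tendsto_linear_residRem hm hnull))
    filter_upwards [eventually_one_le_fst] with a ha
    have hn1 : (1 : ℝ) ≤ a.1 := by exact_mod_cast ha
    rw [norm_mul, norm_mul]
    gcongr
    rw [Real.norm_of_nonneg (by positivity), Real.norm_of_nonneg (by positivity)]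
    have h1 : 1 ≤ √(a.1 : ℝ) := Real.one_le_sqrt.2 hn1
    have h2 : √(a.1 : ℝ) ≤ a.1 := by
      nlinarith [Real.sq_sqrt (by linarith : (0 : ℝ) ≤ a.1)]
    gcongr
  have h2 := h1.sub ((hmean0.add hmean1).pow 2)
  simp only [add_zero, ne_eq, OfNat.ofNat_ne_zero, not_false_eq_true, zero_pow, sub_zero] at h2
  refine h2.congr fun a => ?_
  unfold gcmVar
  simp only [residProd_eq_add (L a.1), Finset.sum_add_distrib, mul_add]
  ring

/-- The conditional moments of `Y` are finite with probability tending to one: as the learned laws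
are not degenerate, an infinite moment would make the Lyapunov sum infinite. -/
theorem eventually_evariance_condLawY_lt_top (hN : NDG2 L Q m) {δ : ℝ} (hδ : 0 < δ)
    (hLyap : Tendsto (fun a : Σ n, Sample n (p n) =>
      (∑ i, absMoment (condLawY (L a.1) (obsZ (a.2 i))) (meanY (L a.1) (obsZ (a.2 i))) (2 + δ) *
        absMoment (learnedLaw (Q a.1) a.2 i) (fitX (Q a.1) a.2 i) (2 + δ)) /
          ENNReal.ofReal ((a.1 : ℝ) ^ (1 + δ / 2))) (whp fun n => sampleLaw n (L n)) (𝓝 0)) :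
    ∀ᶠ a : Σ n, Sample n (p n) in whp fun n => sampleLaw n (L n),
      ∀ i, eVar[id; condLawY (L a.1) (obsZ (a.2 i))] < ∞ := by
  filter_upwards [hLyap.eventually_ne ENNReal.zero_ne_top, hN.eventually_whp] with a ha hNa i
  have hq : 1 + δ / 2 ≠ 0 := by positivity
  have he : 2 + δ = 2 * (1 + δ / 2) := by ring
  by_contra hcon
  rw [not_lt, top_le_iff] at hcon
  refine ha ?_
  have hY : absMoment (condLawY (L a.1) (obsZ (a.2 i))) (meanY (L a.1) (obsZ (a.2 i))) (2 + δ) =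
      ∞ := by
    have := absMoment_rpow_le (condLawY (L a.1) (obsZ (a.2 i))) (meanY (L a.1) (obsZ (a.2 i)))
      (r := 2) (q := 1 + δ / 2) (by linarith)
    rw [← he] at this
    rw [evariance_id_eq_absMoment] at hcon
    change absMoment _ (meanY (L a.1) (obsZ (a.2 i))) 2 = ∞ at hcon
    rw [hcon, ENNReal.top_rpow_of_pos (by positivity), top_le_iff] at this
    exact this
  have hX : absMoment (learnedLaw (Q a.1) a.2 i) (fitX (Q a.1) a.2 i) (2 + δ) ≠ 0 := by
    have h1 := absMoment_rpow_le (learnedLaw (Q a.1) a.2 i) (fitX (Q a.1) a.2 i)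
      (r := 2) (q := 1 + δ / 2) (by linarith)
    rw [← he] at h1
    have h2 := (hNa i).1
    rw [evariance_id_eq_absMoment] at h2
    exact (lt_of_lt_of_le (ENNReal.rpow_pos_of_nonneg h2 (by positivity)) h1).ne'
  rw [ENNReal.sum_eq_top.2 ⟨i, Finset.mem_univ i, by rw [hY, ENNReal.top_mul hX]⟩,
    ENNReal.top_div_of_ne_top ENNReal.ofReal_ne_top]

/-- The resampling variance with the true errors of `Y` in the place of the residuals is
consistent. -/
theorem ErrBounds.tendsto_mean_variance_mul_epsY_sq (hB : ErrBounds L c C δ) (hN : NDG2 L Q m)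
    (hnull : ∀ n ≥ 1, IsNull (L n)) (hvar : VarConsistent L Q) (hLyap : Lyap2 L Q) :
    Tendsto (fun a : Σ n, Sample n (p n) => (1 / (a.1 : ℝ)) *
      ∑ i, Var[id; learnedLaw (Q a.1) a.2 i] * epsY (L a.1) (a.2 i) ^ 2 - errVar (L a.1))
      (whp fun n => sampleLaw n (L n)) (𝓝 0) := by
  obtain ⟨δ', hδ', hLy⟩ := hLyap
  have hLyT := convInProbZero_iff_tendsto.1 hLy
  have hmean : Tendsto (fun a : Σ n, Sample n (p n) => (1 / (a.1 : ℝ)) *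
      ∑ i, Var[id; learnedLaw (Q a.1) a.2 i] * Var[id; condLawY (L a.1) (obsZ (a.2 i))] -
        errVar (L a.1)) (whp fun n => sampleLaw n (L n)) (𝓝 0) := by
    have := (convInProb_iff_tendsto.1 hvar).add (hB.tendsto_mean_variance hnull)
    rw [add_zero] at this
    refine this.congr fun a => ?_
    simp only [sub_mul, Finset.sum_sub_distrib]
    ring
  have hK : ∀ᶠ a : Σ n, Sample n (p n) in whp fun n => sampleLaw n (L n), (1 / (a.1 : ℝ)) *
      ∑ i, Var[id; learnedLaw (Q a.1) a.2 i] * Var[id; condLawY (L a.1) (obsZ (a.2 i))] ≤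
        C + 1 := by
    filter_upwards [hmean.eventually (gt_mem_nhds one_pos), eventually_one_le_fst] with a ha hn
    have := hB.errVar_le a.1 hn
    linarith
  have hlln := tendsto_weighted_sq_of_refresh (L := L) (κ := fun n => kerY (L n))
    (g := fun n => setY) (fun n hn => (hnull n hn).isRefresh_Y)
    (c := fun n d i => Var[id; learnedLaw (Q n) d i])
    (fun n i => (measurable_evariance_learnedLaw (Q n) i).ennreal_toReal)
    (fun n d i => variance_nonneg _ _) (fun n d w => rfl)
    (e := fun n o => epsY (L n) o) (fun n => by fun_prop) (fun n o w => rfl) (fun n o w => rfl)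
    (q := 1 + δ' / 2) (K := C + 1) (by linarith)
    (eventually_evariance_condLawY_lt_top hN hδ' hLyT) hK ?_
  · have := Tendsto.add hlln hmean
    rw [add_zero] at this
    refine this.congr fun a => ?_
    simp only [kerY_apply]
    ring
  · refine tendsto_of_tendsto_of_tendsto_of_le_of_le' tendsto_const_nhds hLyT
      (Eventually.of_forall fun _ => zero_le) (Eventually.of_forall fun a => ?_)
    refine ENNReal.div_le_div_right (Finset.sum_le_sum fun i _ => ?_) _
    rw [mul_comm]
    have he : 2 + δ' = 2 * (1 + δ' / 2) := by ring
    rw [he]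
    refine mul_le_mul' le_rfl ?_
    rw [← ENNReal.ofReal_rpow_of_nonneg (variance_nonneg _ _) (by positivity)]
    refine le_trans ?_ (absMoment_rpow_le _ _ (by linarith))
    gcongr
    refine ENNReal.ofReal_toReal_le.trans (le_of_eq ?_)
    exact evariance_id_eq_absMoment _

/-- The resampling variance is consistent. -/
theorem ErrBounds.tendsto_dcrtVar (hB : ErrBounds L c C δ) (h : SP1' L Q m) (hN : NDG2 L Q m)
    (hnull : ∀ n ≥ 1, IsNull (L n)) (hvar : VarConsistent L Q) (hLyap : Lyap2 L Q) :
    Tendsto (fun a : Σ n, Sample n (p n) => dcrtVar (Q a.1) (m a.1) a.2 - errVar (L a.1))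
      (whp fun n => sampleLaw n (L n)) (𝓝 0) := by
  have hle : ∀ᶠ a : Σ n, Sample n (p n) in whp fun n => sampleLaw n (L n),
      errVar (L a.1) ≤ C := by
    filter_upwards [eventually_one_le_fst] with a ha using hB.errVar_le a.1 ha
  have h1 := hB.tendsto_mean_variance_mul_epsY_sq hN hnull hvar hLyap
  have h2 := tendsto_mean_variance_mul_biasY_sq hN h.2.2.2
  have hsum := tendsto_mean_sq_add
    (u := fun a : Σ n, Sample n (p n) => fun i =>
      √Var[id; learnedLaw (Q a.1) a.2 i] * epsY (L a.1) (a.2 i))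
    (v := fun a : Σ n, Sample n (p n) => fun i =>
      -(biasY (L a.1) (m a.1) a.2 i * √Var[id; learnedLaw (Q a.1) a.2 i])) hle
    (h1.congr fun a => by
      congr 2
      refine Finset.sum_congr rfl fun i _ => ?_
      rw [mul_pow, Real.sq_sqrt (variance_nonneg _ _)])
    (h2.congr fun a => by simp only [neg_sq])
  refine hsum.congr' ?_
  filter_upwards [hN.eventually_whp] with a ha
  rw [dcrtVar_eq _ _ _ fun i => (ha i).2]
  congr 2
  refine Finset.sum_congr rfl fun i _ => ?_
  have : obsY (a.2 i) - fitY (m a.1) a.2 i =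
      epsY (L a.1) (a.2 i) - biasY (L a.1) (m a.1) a.2 i := by
    unfold epsY biasY; ring
  rw [this, ← Real.sq_sqrt (variance_nonneg id (learnedLaw (Q a.1) a.2 i)), ← mul_pow,
    Real.sq_sqrt (variance_nonneg _ _)]
  ring

end Bias

/-! ### The two critical values and the two tests -/

section Tests

variable {p : ℕ → ℕ} {L : ∀ n, Measure (Obs (p n))} [∀ n, IsProbabilityMeasure (L n)]
  {Q : ∀ n, LawHat n (p n)} [∀ n i, IsMarkovKernel (Q n i)] {m : ∀ n, RegHat n (p n)}
  {c C δ : ℝ}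

theorem ErrBounds.errVar_pos (hB : ErrBounds L c C δ) {n : ℕ} (hn : 1 ≤ n) : 0 < errVar (L n) :=
  hB.c_pos.trans_le (hB.le_errVar n hn)

theorem absMoment_map_mul {Ω : Type*} [MeasurableSpace Ω] {ν : Measure Ω} {f : Ω → ℝ}
    (hf : Measurable f) (w r : ℝ) :
    absMoment (ν.map fun o => w * f o) 0 r =
      ENNReal.ofReal (|w| ^ r) * ∫⁻ o, ENNReal.ofReal (|f o| ^ r) ∂ν := by
  unfold absMoment
  have h1 : Measurable fun w : ℝ => ENNReal.ofReal (|w - 0| ^ r) :=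
    ((measurable_id.sub_const _).abs.pow_const r).ennreal_ofReal
  rw [lintegral_map h1 (hf.const_mul w), ← lintegral_const_mul _ (hf.abs.pow_const r).ennreal_ofReal]
  refine lintegral_congr fun o => ?_
  rw [← ENNReal.ofReal_mul (by positivity), ← Real.mul_rpow (abs_nonneg _) (abs_nonneg _), ← abs_mul,
    sub_zero]

/-- The Lyapunov condition, with the errors of `Y` in the place of their conditional moments. -/
theorem tendsto_lyapunov_epsY (hnull : ∀ n ≥ 1, IsNull (L n)) {δ : ℝ}
    (hLyap : Tendsto (fun a : Σ n, Sample n (p n) =>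
      (∑ i, absMoment (condLawY (L a.1) (obsZ (a.2 i))) (meanY (L a.1) (obsZ (a.2 i))) (2 + δ) *
        absMoment (learnedLaw (Q a.1) a.2 i) (fitX (Q a.1) a.2 i) (2 + δ)) /
          ENNReal.ofReal ((a.1 : ℝ) ^ (1 + δ / 2))) (whp fun n => sampleLaw n (L n)) (𝓝 0)) :
    Tendsto (fun a : Σ n, Sample n (p n) => (ENNReal.ofReal ((a.1 : ℝ) ^ (1 + δ / 2)))⁻¹ *
      ∑ i, absMoment (learnedLaw (Q a.1) a.2 i) (fitX (Q a.1) a.2 i) (2 + δ) *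
        ENNReal.ofReal (|epsY (L a.1) (a.2 i)| ^ (2 + δ)))
      (whp fun n => sampleLaw n (L n)) (𝓝 0) := by
  refine tendsto_sum_mul_of_refresh (L := L) (fun n hn => (hnull n hn).isRefresh_Y)
    (fun n => (ENNReal.ofReal ((n : ℝ) ^ (1 + δ / 2)))⁻¹)
    (C := fun n d i => absMoment (learnedLaw (Q n) d i) (fitX (Q n) d i) (2 + δ))
    (fun n i => measurable_absMoment_learnedLaw (Q n) (2 + δ) i) (fun n d w => rfl)
    (E := fun n o => ENNReal.ofReal (|epsY (L n) o| ^ (2 + δ)))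
    (fun n => ((measurable_epsY (L n)).abs.pow_const _).ennreal_ofReal) (hLyap.congr fun a => ?_)
  rw [ENNReal.div_eq_inv_mul]
  congr 1
  refine Finset.sum_congr rfl fun i _ => ?_
  rw [mul_comm]
  rfl

theorem scaled_rpow {n : ℕ} (hn : 1 ≤ n) {s : ℝ} (hs : 0 < s) (x δ : ℝ) :
    |x * (√(n : ℝ) * √s)⁻¹| ^ (2 + δ) =
      (s ^ (1 + δ / 2))⁻¹ * (((n : ℝ) ^ (1 + δ / 2))⁻¹ * |x| ^ (2 + δ)) := by
  have hn0 : (0 : ℝ) < n := by exact_mod_cast hn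
  have hroot : ∀ y : ℝ, 0 < y → √y ^ (2 + δ) = y ^ (1 + δ / 2) := by
    intro y hy
    rw [Real.sqrt_eq_rpow, ← Real.rpow_mul hy.le]
    congr 1
    ring
  rw [abs_mul, abs_of_nonneg (by positivity : 0 ≤ (√(n : ℝ) * √s)⁻¹),
    Real.mul_rpow (abs_nonneg _) (by positivity), Real.inv_rpow (by positivity),
    Real.mul_rpow (by positivity) (by positivity), hroot _ hn0, hroot _ hs, mul_inv]
  ring

/-- Lyapunov's theorem for normalised sums of centred variables `f b i` whose average variance is
close to `s b`. -/
theorem tendsto_cdf_normalised_sum {β : Type*} {l : Filter β} {n : β → ℕ} {Ω : β → Type*}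
    [∀ b, MeasurableSpace (Ω b)] {μ : ∀ b, Fin (n b) → Measure (Ω b)}
    [∀ b i, IsProbabilityMeasure (μ b i)] {f : ∀ b, Fin (n b) → Ω b → ℝ}
    (hf : ∀ b i, Measurable (f b i)) {s : β → ℝ} {c δ : ℝ} (hc : 0 < c) (hδ : 0 < δ)
    (hn : ∀ᶠ b in l, 1 ≤ n b) (hs : ∀ᶠ b in l, c ≤ s b)
    (h2 : ∀ᶠ b in l, ∀ i, MemLp (f b i) 2 (μ b i))
    (hmean : ∀ᶠ b in l, ∀ i, ∫ o, f b i o ∂(μ b i) = 0)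
    (hV : Tendsto (fun b => (1 / (n b : ℝ)) * ∑ i, Var[f b i; μ b i] - s b) l (𝓝 0))
    (hM : Tendsto (fun b => (ENNReal.ofReal ((n b : ℝ) ^ (1 + δ / 2)))⁻¹ *
      ∑ i, ∫⁻ o, ENNReal.ofReal (|f b i o| ^ (2 + δ)) ∂(μ b i)) l (𝓝 0)) (t : ℝ) :
    Tendsto (fun b => (Measure.pi (μ b)) {ω | (1 / √(n b : ℝ)) * ∑ i, f b i (ω i) ≤ √(s b) * t}) l
      (𝓝 (gaussianReal 0 1 (Set.Iic t))) := by
  set w : β → ℝ := fun b => 1 * (√(n b : ℝ) * √(s b))⁻¹ with hw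
  have hwf : ∀ b i, Measurable fun o => w b * f b i o := fun b i => (hf b i).const_mul _
  have hν : ∀ b i, IsProbabilityMeasure ((μ b i).map fun o => w b * f b i o) := fun b i =>
    Measure.isProbabilityMeasure_map (hwf b i).aemeasurable
  have hclt := tendsto_cdf_pi_sum (l := l) (ν := fun b i => (μ b i).map fun o => w b * f b i o) hδ
    ?_ ?_ ?_ ?_ t
  · refine hclt.congr' ?_
    filter_upwards [hs] with b hsb
    have hpos : 0 < √(s b) := Real.sqrt_pos.2 (hc.trans_le hsb)
    have hms : MeasurableSet {w : Fin (n b) → ℝ | ∑ i, w i ≤ t} :=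
      measurableSet_le (Finset.measurable_fun_sum _ fun i _ => measurable_pi_apply i)
        measurable_const
    have hfm : Measurable fun (ω : Fin (n b) → Ω b) i => w b * f b i (ω i) :=
      measurable_pi_lambda _ fun i => (hwf b i).comp (measurable_pi_apply i)
    rw [← Measure.pi_map_pi fun i => (hwf b i).aemeasurable, Measure.map_apply hfm hms]
    congr 1
    ext ω
    simp only [Set.mem_preimage, Set.mem_ofPred_eq]
    have hsum : ∑ i, w b * f b i (ω i) = ((1 / √(n b : ℝ)) * ∑ i, f b i (ω i)) / √(s b) := by
      rw [← Finset.mul_sum, hw]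
      simp only
      rw [mul_inv, one_mul, one_div]
      ring
    rw [hsum, div_le_iff₀ hpos, mul_comm t]
  · filter_upwards [h2] with b hb i
    rw [memLp_map_measure_iff aestronglyMeasurable_id (hwf b i).aemeasurable]
    exact (hb i).const_mul (w b)
  · filter_upwards [hmean] with b hb i
    rw [integral_map (hwf b i).aemeasurable (by fun_prop), integral_const_mul, hb i, mul_zero]
  · have h1 : Tendsto (fun b => ((1 / (n b : ℝ)) * ∑ i, Var[f b i; μ b i] - s b) / s b) l
        (𝓝 0) := by
      have h2 := hV.norm.div_const c
      rw [norm_zero, zero_div] at h2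
      refine squeeze_zero_norm' ?_ h2
      filter_upwards [hs] with b hb
      rw [norm_div, Real.norm_of_nonneg (hc.trans_le hb).le]
      gcongr
    have h2 := h1.add_const 1
    rw [zero_add] at h2
    refine h2.congr' ?_
    filter_upwards [hn, hs] with b hnb hsb
    have hpos := hc.trans_le hsb
    have hn0 : (0 : ℝ) < n b := by exact_mod_cast hnb
    have hterm : ∀ i, Var[id; (μ b i).map fun o => w b * f b i o] = w b ^ 2 * Var[f b i; μ b i] :=
      fun i => by rw [variance_id_map (hwf b i).aemeasurable, variance_const_mul]
    simp only [hterm]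
    rw [sub_div, div_self hpos.ne', sub_add_cancel, ← Finset.mul_sum, hw]
    simp only
    rw [one_mul, inv_pow, mul_pow, Real.sq_sqrt hn0.le, Real.sq_sqrt hpos.le]
    field_simp
  · have h1 := ENNReal.Tendsto.const_mul (a := ENNReal.ofReal ((c ^ (1 + δ / 2))⁻¹)) hM
      (Or.inr ENNReal.ofReal_ne_top)
    rw [mul_zero] at h1
    refine tendsto_of_tendsto_of_tendsto_of_le_of_le' tendsto_const_nhds h1
      (Eventually.of_forall fun _ => zero_le) ?_
    filter_upwards [hn, hs] with b hnb hsb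
    have hpos := hc.trans_le hsb
    have hn0 : (0 : ℝ) < n b := by exact_mod_cast hnb
    rw [Finset.mul_sum, Finset.mul_sum]
    refine Finset.sum_le_sum fun i _ => ?_
    rw [absMoment_map_mul (hf b i), hw]
    simp only
    rw [scaled_rpow hnb hpos, abs_one, Real.one_rpow, mul_one, ENNReal.ofReal_mul (by positivity),
      ENNReal.ofReal_inv_of_pos (Real.rpow_pos_of_pos hn0 _), mul_assoc]
    gcongr

/-- Conditional central limit theorem: given the sample, the resampled statistic with the true
errors of `Y` in the place of the residuals is asymptotically normal. -/
theorem ErrBounds.tendsto_resampleLaw_cdf (hB : ErrBounds L c C δ) (hN : NDG2 L Q m)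
    (hnull : ∀ n ≥ 1, IsNull (L n)) (hvar : VarConsistent L Q) (hLyap : Lyap2 L Q) (t : ℝ) :
    Tendsto (fun a : Σ n, Sample n (p n) => resampleLaw (Q a.1) a.2
        {x | (1 / √(a.1 : ℝ)) * ∑ i, (x i - fitX (Q a.1) a.2 i) * epsY (L a.1) (a.2 i) ≤
          √(errVar (L a.1)) * t})
      (whp fun n => sampleLaw n (L n)) (𝓝 (gaussianReal 0 1 (Set.Iic t))) := by
  have hvarT := hB.tendsto_mean_variance_mul_epsY_sq hN hnull hvar hLyap
  obtain ⟨δ', hδ', hLy⟩ := hLyap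
  have hLy' := convInProbZero_iff_tendsto.1 hLy
  have hLyT := tendsto_lyapunov_epsY (Q := Q) hnull hLy'
  have hmem : ∀ᶠ a : Σ n, Sample n (p n) in whp fun n => sampleLaw n (L n), ∀ i,
      MemLp id 2 (learnedLaw (Q a.1) a.2 i) := by
    filter_upwards [hN.eventually_whp] with a ha i
    exact (evariance_lt_top_iff_memLp aestronglyMeasurable_id).1 (ha i).2
  have hint : ∀ᶠ a : Σ n, Sample n (p n) in whp fun n => sampleLaw n (L n), ∀ i,
      ∫ x, (x - fitX (Q a.1) a.2 i) * epsY (L a.1) (a.2 i) ∂(learnedLaw (Q a.1) a.2 i) = 0 := by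
    filter_upwards [hmem] with a ha i
    have hint : Integrable (fun x : ℝ => x) (learnedLaw (Q a.1) a.2 i) := (ha i).integrable one_le_two
    rw [integral_mul_const, integral_sub hint (integrable_const _), integral_const,
      probReal_univ, one_smul]
    exact mul_eq_zero_of_left (sub_self _) _
  have hL2 : ∀ᶠ a : Σ n, Sample n (p n) in whp fun n => sampleLaw n (L n), ∀ i,
      MemLp (fun x => (x - fitX (Q a.1) a.2 i) * epsY (L a.1) (a.2 i)) 2
        (learnedLaw (Q a.1) a.2 i) := by
    filter_upwards [hmem] with a ha i
    exact ((ha i).sub (memLp_const (fitX (Q a.1) a.2 i))).mul_const _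
  have hV : ∀ (a : Σ n, Sample n (p n)) i,
      Var[fun x => (x - fitX (Q a.1) a.2 i) * epsY (L a.1) (a.2 i); learnedLaw (Q a.1) a.2 i] =
        Var[id; learnedLaw (Q a.1) a.2 i] * epsY (L a.1) (a.2 i) ^ 2 := by
    intro a i
    rw [variance_mul_const]
    congr 1
    exact variance_sub_const (X := id) aestronglyMeasurable_id (fitX (Q a.1) a.2 i)
  have hM : ∀ (a : Σ n, Sample n (p n)) i,
      ∫⁻ x, ENNReal.ofReal (|(x - fitX (Q a.1) a.2 i) * epsY (L a.1) (a.2 i)| ^ (2 + δ'))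
        ∂(learnedLaw (Q a.1) a.2 i) =
      absMoment (learnedLaw (Q a.1) a.2 i) (fitX (Q a.1) a.2 i) (2 + δ') *
        ENNReal.ofReal (|epsY (L a.1) (a.2 i)| ^ (2 + δ')) := by
    intro a i
    unfold absMoment
    have hmm : Measurable fun w : ℝ => ENNReal.ofReal (|w - fitX (Q a.1) a.2 i| ^ (2 + δ')) :=
      ((measurable_id.sub_const _).abs.pow_const _).ennreal_ofReal
    rw [← lintegral_mul_const _ hmm]
    refine lintegral_congr fun x => ?_
    rw [← ENNReal.ofReal_mul (by positivity), ← Real.mul_rpow (abs_nonneg _) (abs_nonneg _),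
      ← abs_mul]
  have hs : ∀ᶠ a : Σ n, Sample n (p n) in whp fun n => sampleLaw n (L n), c ≤ errVar (L a.1) := by
    filter_upwards [eventually_one_le_fst] with a ha using hB.le_errVar a.1 ha
  have hV' : Tendsto (fun a : Σ n, Sample n (p n) => (1 / (a.1 : ℝ)) *
      ∑ i, Var[fun x => (x - fitX (Q a.1) a.2 i) * epsY (L a.1) (a.2 i);
        learnedLaw (Q a.1) a.2 i] - errVar (L a.1)) (whp fun n => sampleLaw n (L n)) (𝓝 0) := by
    simp only [hV]
    exact hvarT
  have hM' : Tendsto (fun a : Σ n, Sample n (p n) => (ENNReal.ofReal ((a.1 : ℝ) ^ (1 + δ' / 2)))⁻¹ *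
      ∑ i, ∫⁻ x, ENNReal.ofReal (|(x - fitX (Q a.1) a.2 i) * epsY (L a.1) (a.2 i)| ^ (2 + δ'))
        ∂(learnedLaw (Q a.1) a.2 i)) (whp fun n => sampleLaw n (L n)) (𝓝 0) := by
    simp only [hM]
    exact hLyT
  have hf : ∀ (a : Σ n, Sample n (p n)) i,
      Measurable fun x : ℝ => (x - fitX (Q a.1) a.2 i) * epsY (L a.1) (a.2 i) :=
    fun a i => by fun_prop
  exact tendsto_cdf_normalised_sum (n := fun a : Σ n, Sample n (p n) => a.1) (Ω := fun _ => ℝ)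
    (μ := fun a i => learnedLaw (Q a.1) a.2 i) hf hB.c_pos hδ' eventually_one_le_fst hs hL2 hint
    hV' hM' t

/-- The part of the resampled statistic due to the bias of `μ̂_y` is negligible. -/
theorem ErrBounds.tendsto_resampleLaw_bias (hB : ErrBounds L c C δ)
    (h : ConvInProbZero (fun n => sampleLaw n (L n)) (fun n d => errYHat' (L n) (Q n) (m n) d))
    {t : ℝ} (ht : 0 < t) :
    Tendsto (fun a : Σ n, Sample n (p n) => resampleLaw (Q a.1) a.2
        {x | √(errVar (L a.1)) * t ≤
          |(1 / √(a.1 : ℝ)) * ∑ i, (x i - fitX (Q a.1) a.2 i) * biasY (L a.1) (m a.1) a.2 i|})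
      (whp fun n => sampleLaw n (L n)) (𝓝 0) := by
  have h0 := tendsto_inner_of_tendsto_sqrt (convInProbZero_iff_tendsto.1 h)
  have hct : 0 < √c * t := mul_pos (Real.sqrt_pos.2 hB.c_pos) ht
  have h1 := ENNReal.Tendsto.div_const h0 (b := ENNReal.ofReal ((√c * t) ^ 2))
    (Or.inr (by simpa using hct.ne'))
  rw [ENNReal.zero_div] at h1
  refine tendsto_of_tendsto_of_tendsto_of_le_of_le' tendsto_const_nhds h1
    (Eventually.of_forall fun _ => zero_le) ?_
  filter_upwards [eventually_one_le_fst] with a ha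
  have hn0 : (0 : ℝ) < a.1 := by exact_mod_cast ha
  have hch := measure_pi_chebyshev_linear (fun i => learnedLaw (Q a.1) a.2 i)
    (fun i => (1 / √(a.1 : ℝ)) * biasY (L a.1) (m a.1) a.2 i) hct
  refine le_trans (le_trans (measure_mono fun x hx => ?_) hch) (le_of_eq ?_)
  · simp only [Set.mem_ofPred_eq] at hx ⊢
    have hle : √c * t ≤ √(errVar (L a.1)) * t := by
      gcongr
      exact hB.le_errVar a.1 ha
    refine (hle.trans hx).trans (le_of_eq ?_)
    rw [Finset.mul_sum]
    congr 1
    refine Finset.sum_congr rfl fun i _ => ?_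
    unfold fitX
    ring
  · congr 1
    rw [Finset.mul_sum]
    refine Finset.sum_congr rfl fun i _ => ?_
    rw [mul_pow, div_pow, Real.sq_sqrt hn0.le, one_pow, ENNReal.ofReal_mul (by positivity),
      one_div, ENNReal.ofReal_inv_of_pos hn0, ENNReal.ofReal_natCast, mul_assoc]
    rfl

/-- The resampling quantile is asymptotically the normal quantile, in the scale of the standard
deviation of the statistic. -/
theorem ErrBounds.eventually_quantile_mem (hB : ErrBounds L c C δ) (hSP1 : SP1' L Q m)
    (hN : NDG2 L Q m) (hnull : ∀ n ≥ 1, IsNull (L n)) (hvar : VarConsistent L Q)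
    (hLyap : Lyap2 L Q) {q : ℝ} (hq0 : 0 < q) (hq1 : q < 1) {h : ℝ} (hh : 0 < h) :
    ∀ᶠ a : Σ n, Sample n (p n) in whp fun n => sampleLaw n (L n),
      quantile ((resampleLaw (Q a.1) a.2).map (statAt (Q a.1) (m a.1) a.2)) q ∈
        Set.Icc (√(errVar (L a.1)) * (quantile (gaussianReal 0 1) q - h))
          (√(errVar (L a.1)) * (quantile (gaussianReal 0 1) q + h)) := by
  set z := quantile (gaussianReal 0 1) q with hz
  have hcdf : ∀ t, Tendsto (fun a : Σ n, Sample n (p n) => (resampleLaw (Q a.1) a.2).real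
        {x | (1 / √(a.1 : ℝ)) * ∑ i, (x i - fitX (Q a.1) a.2 i) * epsY (L a.1) (a.2 i) ≤
          √(errVar (L a.1)) * t})
      (whp fun n => sampleLaw n (L n)) (𝓝 ((gaussianReal 0 1).real (Set.Iic t))) := fun t =>
    (ENNReal.tendsto_toReal (measure_ne_top _ _)).comp
      (hB.tendsto_resampleLaw_cdf hN hnull hvar hLyap t)
  have hbias : Tendsto (fun a : Σ n, Sample n (p n) => (resampleLaw (Q a.1) a.2).real
        {x | √(errVar (L a.1)) * (h / 2) ≤
          |(1 / √(a.1 : ℝ)) * ∑ i, (x i - fitX (Q a.1) a.2 i) * biasY (L a.1) (m a.1) a.2 i|})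
      (whp fun n => sampleLaw n (L n)) (𝓝 0) :=
    (ENNReal.tendsto_toReal ENNReal.zero_ne_top).comp
      (hB.tendsto_resampleLaw_bias hSP1.2.2.2 (half_pos hh))
  have hlow : (gaussianReal 0 1).real (Set.Iic (z - h / 2)) < q :=
    measureReal_Iic_lt_of_lt_quantile hq0 (by linarith)
  have hup : q < (gaussianReal 0 1).real (Set.Iic (z + h / 2)) :=
    lt_measureReal_Iic_of_quantile_lt hq1 (by linarith)
  have hlow' := ((hcdf (z - h / 2)).add hbias).eventually
    (gt_mem_nhds (by rw [add_zero]; exact hlow))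
  have hup' := ((hcdf (z + h / 2)).sub hbias).eventually
    (lt_mem_nhds (by rw [sub_zero]; exact hup))
  filter_upwards [hlow', hup'] with a hla hua
  have hst : Measurable (statAt (Q a.1) (m a.1) a.2) := by
    unfold statAt
    fun_prop
  have hsplit : ∀ x, statAt (Q a.1) (m a.1) a.2 x =
      (1 / √(a.1 : ℝ)) * ∑ i, (x i - fitX (Q a.1) a.2 i) * epsY (L a.1) (a.2 i) -
      (1 / √(a.1 : ℝ)) * ∑ i, (x i - fitX (Q a.1) a.2 i) * biasY (L a.1) (m a.1) a.2 i := by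
    intro x
    rw [← mul_sub, ← Finset.sum_sub_distrib]
    unfold statAt
    congr 1
    refine Finset.sum_congr rfl fun i _ => ?_
    unfold epsY biasY
    ring
  have : IsProbabilityMeasure ((resampleLaw (Q a.1) a.2).map (statAt (Q a.1) (m a.1) a.2)) :=
    Measure.isProbabilityMeasure_map hst.aemeasurable
  refine quantile_mem_Icc ?_ ?_
  · rw [map_measureReal_apply hst measurableSet_Iic]
    refine lt_of_le_of_lt ((measureReal_mono fun x hx => ?_).trans (measureReal_union_le _ _)) hla
    simp only [Set.mem_preimage, Set.mem_Iic, Set.mem_union, Set.mem_ofPred_eq] at hx ⊢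
    rw [hsplit] at hx
    by_contra hcon
    push Not at hcon
    have := (abs_lt.1 hcon.2).2
    nlinarith [hcon.1]
  · rw [map_measureReal_apply hst measurableSet_Iic]
    refine hua.le.trans ?_
    rw [sub_le_iff_le_add]
    refine (measureReal_mono fun x hx => ?_).trans (measureReal_union_le _ _)
    simp only [Set.mem_preimage, Set.mem_Iic, Set.mem_union, Set.mem_ofPred_eq] at hx ⊢
    rw [hsplit]
    by_contra hcon
    push Not at hcon
    have := (abs_lt.1 hcon.2).1
    nlinarith [hcon.1]

/-- Central limit theorem for the products of errors. -/
theorem ErrBounds.tendsto_cdf_sum (hB : ErrBounds L c C δ) (hY : ∀ n ≥ 1, Integrable obsY (L n))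
    (hnull : ∀ n ≥ 1, IsNull (L n)) (t : ℝ) :
    Tendsto (fun n => sampleLaw n (L n) {d | (1 / √(n : ℝ)) *
        ∑ i, epsX (L n) (d i) * epsY (L n) (d i) ≤ √(errVar (L n)) * t}) atTop
      (𝓝 (gaussianReal 0 1 (Set.Iic t))) := by
  have hδ := hB.δ_pos
  have hf : ∀ n, Measurable fun o => epsX (L n) o * epsY (L n) o := fun n => by fun_prop
  refine tendsto_cdf_normalised_sum (n := fun n : ℕ => n) (Ω := fun n => Obs (p n))
    (μ := fun n _ => L n) (f := fun n _ o => epsX (L n) o * epsY (L n) o) (fun n _ => hf n)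
    (s := fun n => errVar (L n)) hB.c_pos hδ (eventually_ge_atTop 1) ?_ ?_ ?_ ?_ ?_ t
  · filter_upwards [eventually_ge_atTop 1] with n hn using hB.le_errVar n hn
  · filter_upwards [eventually_ge_atTop 1] with n hn _
    exact (memLp_two_iff_integrable_sq (hf n).aestronglyMeasurable).2 (hB.integrable n hn)
  · filter_upwards [eventually_ge_atTop 1] with n hn _
    exact (hnull n hn).integral_mul_eq_zero (hY n hn)
  · refine tendsto_const_nhds.congr' ?_
    filter_upwards [eventually_ge_atTop 1] with n hn
    have hn0 : (0 : ℝ) < n := by exact_mod_cast hn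
    rw [variance_of_integral_eq_zero (hf n).aemeasurable
      ((hnull n hn).integral_mul_eq_zero (hY n hn)), Finset.sum_const, Finset.card_univ,
      Fintype.card_fin, nsmul_eq_mul, ← mul_assoc, one_div, inv_mul_cancel₀ hn0.ne', one_mul]
    exact (sub_self _).symm
  · have hrate : Tendsto (fun n : ℕ => ENNReal.ofReal ((n : ℝ) ^ (-(δ / 2))) * ENNReal.ofReal C)
        atTop (𝓝 0) := by
      have h1 := ENNReal.tendsto_ofReal ((tendsto_rpow_neg_atTop (y := δ / 2) (by linarith)).comp
        (tendsto_natCast_atTop_atTop (R := ℝ)))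
      rw [ENNReal.ofReal_zero] at h1
      have h2 := ENNReal.Tendsto.mul_const h1 (Or.inr (ENNReal.ofReal_ne_top (r := C)))
      simpa using h2
    refine tendsto_of_tendsto_of_tendsto_of_le_of_le' tendsto_const_nhds hrate
      (Eventually.of_forall fun _ => zero_le) ?_
    filter_upwards [eventually_ge_atTop 1] with n hn
    have hn0 : (0 : ℝ) < n := by exact_mod_cast hn
    rw [Finset.sum_const, Finset.card_univ, Fintype.card_fin, nsmul_eq_mul, ← mul_assoc]
    refine mul_le_mul' (le_of_eq ?_) (hB.moment_le n hn)
    rw [← ENNReal.ofReal_inv_of_pos (by positivity), ← ENNReal.ofReal_natCast,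
      ← ENNReal.ofReal_mul (by positivity), ← Real.rpow_neg hn0.le]
    congr 1
    rw [← Real.rpow_add_one hn0.ne']
    congr 1
    ring

/-- The statistic is the normalised sum of the products of errors, up to a negligible term. -/
theorem SP1'.tendsto_dcrtStat_sub (h : SP1' L Q m)
    (hm : ∀ n, Measurable (Function.uncurry (m n))) (hnull : ∀ n ≥ 1, IsNull (L n)) :
    Tendsto (fun a : Σ n, Sample n (p n) => dcrtStat (Q a.1) (m a.1) a.2 -
      (1 / √(a.1 : ℝ)) * ∑ i, epsX (L a.1) (a.2 i) * epsY (L a.1) (a.2 i))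
      (whp fun n => sampleLaw n (L n)) (𝓝 0) := by
  refine (h.tendsto_linear_residRem hm hnull).congr fun a => ?_
  have : dcrtStat (Q a.1) (m a.1) a.2 =
      (1 / √(a.1 : ℝ)) * ∑ i, residProd (Q a.1) (m a.1) a.2 i := rfl
  rw [this, ← mul_sub, ← Finset.sum_sub_distrib]
  congr 1
  refine Finset.sum_congr rfl fun i _ => ?_
  rw [residProd_eq_add (L a.1)]
  ring

theorem gcmTest_eq {n k : ℕ} (α : ℝ) (Q : LawHat n k) (m : RegHat n k) (d : Sample n k)
    (hpos : 0 < gcmVar Q m d) : gcmTest α Q m d =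
      if √(gcmVar Q m d) * quantile (gaussianReal 0 1) (1 - α) < dcrtStat Q m d then 1 else 0 := by
  have hst : gcmStat Q m d = dcrtStat Q m d / √(gcmVar Q m d) := by
    have : dcrtStat Q m d = (1 / √(n : ℝ)) * ∑ i, residProd Q m d i := rfl
    rw [gcmStat, this, one_div_mul_eq_div]
  have hs : 0 < √(gcmVar Q m d) := Real.sqrt_pos.2 hpos
  unfold gcmTest
  simp only [hst, lt_div_iff₀ hs, mul_comm]

theorem abs_sqrt_sub_sqrt_mul_le {x y : ℝ} (hx : 0 ≤ x) (hy : 0 ≤ y) :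
    |√x - √y| * √y ≤ |x - y| := by
  have h : x - y = (√x - √y) * (√x + √y) := by
    nlinarith [Real.sq_sqrt hx, Real.sq_sqrt hy]
  rw [h, abs_mul, abs_of_nonneg (by positivity : 0 ≤ √x + √y)]
  gcongr
  linarith [Real.sqrt_nonneg x]

/-- The critical value of the GCM test, in the scale of the statistic, is asymptotically the normal
quantile times the standard deviation of the statistic. -/
theorem ErrBounds.eventually_gcm_critical (hB : ErrBounds L c C δ) (h : SP1' L Q m)
    (hm : ∀ n, Measurable (Function.uncurry (m n))) (hY : ∀ n ≥ 1, Integrable obsY (L n))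
    (hnull : ∀ n ≥ 1, IsNull (L n)) (z : ℝ) {t : ℝ} (ht : 0 < t) :
    ∀ᶠ a : Σ n, Sample n (p n) in whp fun n => sampleLaw n (L n),
      0 < gcmVar (Q a.1) (m a.1) a.2 ∧ √(gcmVar (Q a.1) (m a.1) a.2) * z ∈
        Set.Icc (√(errVar (L a.1)) * (z - t)) (√(errVar (L a.1)) * (z + t)) := by
  have hlim := hB.tendsto_gcmVar h hm hY hnull
  have hc := hB.c_pos
  have hη : 0 < min c (c * t / (|z| + 1)) := by positivity
  filter_upwards [(Metric.tendsto_nhds.1 hlim) _ hη, eventually_one_le_fst] with a ha hn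
  rw [dist_zero_right, Real.norm_eq_abs, lt_min_iff] at ha
  have hle := hB.le_errVar a.1 hn
  have hpos := hB.errVar_pos hn
  set s := errVar (L a.1)
  set G := gcmVar (Q a.1) (m a.1) a.2
  have hG : 0 < G := by
    have := (abs_lt.1 ha.1).1
    linarith
  have hs : 0 < √s := Real.sqrt_pos.2 hpos
  have h1 := abs_sqrt_sub_sqrt_mul_le hG.le hpos.le
  have h2 : |√G - √s| * |z| * √s ≤ √s * t * √s := by
    calc |√G - √s| * |z| * √s = (|√G - √s| * √s) * |z| := by ring
      _ ≤ (c * t / (|z| + 1)) * |z| := by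
          gcongr
          exact h1.trans ha.2.le
      _ ≤ c * t := by
          rw [div_mul_eq_mul_div, div_le_iff₀ (by positivity)]
          nlinarith [abs_nonneg z, mul_pos hc ht]
      _ ≤ s * t := by gcongr
      _ = √s * t * √s := by
          rw [mul_right_comm, Real.mul_self_sqrt hpos.le]
  have h3 : |(√G - √s) * z| ≤ √s * t := by
    rw [abs_mul]
    exact le_of_mul_le_mul_right h2 hs
  rw [abs_le] at h3
  refine ⟨hG, ?_, ?_⟩ <;> nlinarith [h3.1, h3.2]

/-- The statistic puts little mass near any threshold of its own order. -/
theorem ErrBounds.tendsto_measure_between (hB : ErrBounds L c C δ)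
    (hY : ∀ n ≥ 1, Integrable obsY (L n)) (hnull : ∀ n ≥ 1, IsNull (L n)) {t u : ℝ} (htu : t ≤ u) :
    Tendsto (fun n => sampleLaw n (L n) {d |
        √(errVar (L n)) * t < (1 / √(n : ℝ)) * ∑ i, epsX (L n) (d i) * epsY (L n) (d i) ∧
        (1 / √(n : ℝ)) * ∑ i, epsX (L n) (d i) * epsY (L n) (d i) ≤ √(errVar (L n)) * u}) atTop
      (𝓝 (gaussianReal 0 1 (Set.Ioc t u))) := by
  have h := ENNReal.Tendsto.sub (hB.tendsto_cdf_sum hY hnull u) (hB.tendsto_cdf_sum hY hnull t)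
    (Or.inl (measure_ne_top _ _))
  have hlim : gaussianReal 0 1 (Set.Ioc t u) =
      gaussianReal 0 1 (Set.Iic u) - gaussianReal 0 1 (Set.Iic t) := by
    rw [← measure_sdiff (Set.Iic_subset_Iic.2 htu) measurableSet_Iic.nullMeasurableSet
      (measure_ne_top _ _), Set.Iic_sdiff_Iic]
  rw [hlim]
  refine h.congr fun n => ?_
  have hmeas : Measurable fun d : Sample n (p n) =>
      (1 / √(n : ℝ)) * ∑ i, epsX (L n) (d i) * epsY (L n) (d i) := by fun_prop
  rw [← measure_sdiff (fun d hd => ?_) (measurableSet_le hmeas measurable_const).nullMeasurableSet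
      (measure_ne_top _ _)]
  · congr 1
    ext d
    simp only [Set.mem_sdiff, Set.mem_ofPred_eq, not_le]
    tauto
  · simp only [Set.mem_ofPred_eq] at hd ⊢
    exact hd.trans (by gcongr)

end Tests

/-! ### Comparison of the two tests -/

section Comparison

variable {p : ℕ → ℕ} {L : ∀ n, Measure (Obs (p n))} [∀ n, IsProbabilityMeasure (L n)]
  {Q : ∀ n, LawHat n (p n)} [∀ n i, IsMarkovKernel (Q n i)] {m : ∀ n, RegHat n (p n)}
  {c C δ : ℝ}

theorem ErrBounds.tendsto_variance_ratio (hB : ErrBounds L c C δ)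
    (hm : ∀ n, Measurable (Function.uncurry (m n))) (hY : ∀ n ≥ 1, Integrable obsY (L n))
    (hnull : ∀ n ≥ 1, IsNull (L n)) (hSP1 : SP1' L Q m) (hN : NDG2 L Q m)
    (hvar : VarConsistent L Q) (hLyap : Lyap2 L Q) :
    Tendsto (fun a : Σ n, Sample n (p n) =>
      dcrtVar (Q a.1) (m a.1) a.2 / gcmVar (Q a.1) (m a.1) a.2)
      (whp fun n => sampleLaw n (L n)) (𝓝 1) := by
  have hc := hB.c_pos
  have hG := hB.tendsto_gcmVar hSP1 hm hY hnull
  have hD := hB.tendsto_dcrtVar hSP1 hN hnull hvar hLyap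
  have hdiff := ((hD.sub hG).norm).div_const (c / 2)
  rw [sub_zero, norm_zero, zero_div] at hdiff
  rw [tendsto_iff_norm_sub_tendsto_zero]
  refine squeeze_zero' (Eventually.of_forall fun _ => norm_nonneg _) ?_ hdiff
  filter_upwards [(Metric.tendsto_nhds.1 hG) _ (half_pos hc), eventually_one_le_fst] with a ha hn
  rw [dist_zero_right, Real.norm_eq_abs] at ha
  have hle := hB.le_errVar a.1 hn
  have hlow : c / 2 ≤ gcmVar (Q a.1) (m a.1) a.2 := by
    have := (abs_lt.1 ha).1
    linarith
  have hpos : 0 < gcmVar (Q a.1) (m a.1) a.2 := (half_pos hc).trans_le hlow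
  rw [sub_sub_sub_cancel_right, div_sub_one hpos.ne', norm_div, Real.norm_of_nonneg hpos.le]
  gcongr

/-- If the tests disagree, the statistic lies between the two critical values. Both are close to the
same multiple of the standard deviation, and the statistic is asymptotically normal, so that this is
unlikely. -/
theorem ErrBounds.eventually_tests_eq (hB : ErrBounds L c C δ)
    (hm : ∀ n, Measurable (Function.uncurry (m n))) (hY : ∀ n ≥ 1, Integrable obsY (L n))
    (hnull : ∀ n ≥ 1, IsNull (L n)) (hSP1 : SP1' L Q m) (hN : NDG2 L Q m)
    (hvar : VarConsistent L Q) (hLyap : Lyap2 L Q) {α : ℝ} (hα₀ : 0 < α) (hα₁ : α < 1) :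
    ∀ᶠ a : Σ n, Sample n (p n) in whp fun n => sampleLaw n (L n),
      dcrtTest α (Q a.1) (m a.1) a.2 = gcmTest α (Q a.1) (m a.1) a.2 := by
  have hc := hB.c_pos
  set z := quantile (gaussianReal 0 1) (1 - α) with hz
  refine eventually_whp.2 (ENNReal.tendsto_nhds_zero.2 fun ε hε => ?_)
  obtain ⟨η, hη0, hηε⟩ : ∃ η : ℝ, 0 < η ∧ ENNReal.ofReal η < ε := by
    obtain ⟨r, hr0, hr⟩ := ENNReal.lt_iff_exists_nnreal_btwn.1 hε
    exact ⟨r, by exact_mod_cast hr0, by rwa [ENNReal.ofReal_coe_nnreal]⟩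
  set h := η / 4 with hh
  have hh0 : 0 < h := by positivity
  -- Up to a vanishing probability, a disagreement forces the normalised sum of the products of
  -- errors into an interval of length `4 h = η` around `z`.
  have hgood : ∀ᶠ a : Σ n, Sample n (p n) in whp fun n => sampleLaw n (L n),
      dcrtTest α (Q a.1) (m a.1) a.2 ≠ gcmTest α (Q a.1) (m a.1) a.2 →
      √(errVar (L a.1)) * (z - 2 * h) <
          (1 / √(a.1 : ℝ)) * ∑ i, epsX (L a.1) (a.2 i) * epsY (L a.1) (a.2 i) ∧
        (1 / √(a.1 : ℝ)) * ∑ i, epsX (L a.1) (a.2 i) * epsY (L a.1) (a.2 i) ≤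
          √(errVar (L a.1)) * (z + 2 * h) := by
    have hstat := (Metric.tendsto_nhds.1 (hSP1.tendsto_dcrtStat_sub hm hnull)) (√c * h)
      (mul_pos (Real.sqrt_pos.2 hc) hh0)
    filter_upwards [hstat, eventually_one_le_fst,
      hB.eventually_quantile_mem hSP1 hN hnull hvar hLyap (q := 1 - α) (by linarith) (by linarith)
        hh0, hB.eventually_gcm_critical hSP1 hm hY hnull z hh0] with a h3 hn h1 h2 hne
    rw [dist_zero_right, Real.norm_eq_abs, abs_lt] at h3
    rw [gcmTest_eq α (Q a.1) (m a.1) a.2 h2.1, dcrtTest, ← hz] at hne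
    rw [← hz] at h1
    obtain ⟨h1l, h1u⟩ := h1
    obtain ⟨-, h2l, h2u⟩ := h2
    have hs : √c * h ≤ √(errVar (L a.1)) * h := by
      gcongr
      exact hB.le_errVar a.1 hn
    by_cases hd : quantile ((resampleLaw (Q a.1) a.2).map (statAt (Q a.1) (m a.1) a.2)) (1 - α) <
        dcrtStat (Q a.1) (m a.1) a.2 <;>
      by_cases hg : √(gcmVar (Q a.1) (m a.1) a.2) * z < dcrtStat (Q a.1) (m a.1) a.2 <;>
      simp only [hd, hg, if_true, if_false, ne_eq, not_true_eq_false] at hne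
    · constructor <;> linarith
    · constructor <;> linarith
  have hlim := hB.tendsto_measure_between hY hnull (t := z - 2 * h) (u := z + 2 * h) (by linarith)
  have hsum := (eventually_whp.1 hgood).add hlim
  rw [zero_add] at hsum
  have hlt : gaussianReal 0 1 (Set.Ioc (z - 2 * h) (z + 2 * h)) < ε := by
    refine ((gaussianReal_Ioc_le _ _).trans_eq ?_).trans_lt hηε
    congr 1
    rw [hh]
    ring
  filter_upwards [hsum.eventually (gt_mem_nhds hlt)] with n hn
  refine le_trans (le_trans (measure_mono fun d hd => ?_) (measure_union_le _ _)) hn.le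
  by_cases hd' : √(errVar (L n)) * (z - 2 * h) <
        (1 / √(n : ℝ)) * ∑ i, epsX (L n) (d i) * epsY (L n) (d i) ∧
      (1 / √(n : ℝ)) * ∑ i, epsX (L n) (d i) * epsY (L n) (d i) ≤ √(errVar (L n)) * (z + 2 * h)
  · exact Or.inr hd'
  · exact Or.inl fun hcon => hd' (hcon hd)

/-- An event whose complement has vanishing probability has probability tending to one; it need not
be measurable. -/
theorem tendsto_measure_one_of_eventually_whp {Ω : ℕ → Type} [∀ n, MeasurableSpace (Ω n)]
    {P : ∀ n, Measure (Ω n)} [∀ n, IsProbabilityMeasure (P n)] {q : (Σ n, Ω n) → Prop}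
    (h : ∀ᶠ a in whp P, q a) : Tendsto (fun n => P n {ω | q ⟨n, ω⟩}) atTop (𝓝 1) := by
  have h1 := ENNReal.Tendsto.sub (tendsto_const_nhds (x := (1 : ℝ≥0∞))) (eventually_whp.1 h)
    (Or.inl ENNReal.one_ne_top)
  rw [tsub_zero] at h1
  refine tendsto_of_tendsto_of_tendsto_of_le_of_le h1 tendsto_const_nhds (fun n => ?_)
    fun n => prob_le_one
  rw [tsub_le_iff_right]
  calc (1 : ℝ≥0∞) = P n Set.univ := measure_univ.symm
    _ ≤ P n ({ω | q ⟨n, ω⟩} ∪ {ω | ¬ q ⟨n, ω⟩}) :=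
        measure_mono fun ω _ => (em (q ⟨n, ω⟩))
    _ ≤ _ := measure_union_le _ _

end Comparison

end DCRT

theorem theorem2 (α : ℝ) (hα₀ : 0 < α) (hα₁ : α < 1) (p : ℕ → ℕ)
    (L : ∀ n, Measure (Obs (p n))) [∀ n, IsProbabilityMeasure (L n)]
    (Q : ∀ n, LawHat n (p n)) [∀ n i, IsMarkovKernel (Q n i)]
    (m : ∀ n, RegHat n (p n)) (hm : ∀ n, Measurable (Function.uncurry (m n)))
    (hX : ∀ n ≥ 1, Integrable obsX (L n)) (hY : ∀ n ≥ 1, Integrable obsY (L n))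
    (hnull : ∀ n ≥ 1, IsNull (L n))
    (hSP1 : SP1' L Q m) (hSP2 : SP2 L) (hNDG2 : NDG2 L Q m)
    (hvar : VarConsistent L Q) (hLyap : Lyap2 L Q) :
    ConvInProb (fun n => sampleLaw n (L n))
        (fun n d => dcrtVar (Q n) (m n) d / gcmVar (Q n) (m n) d) 1 ∧
      Tendsto (fun n => sampleLaw n (L n)
        {d | dcrtTest α (Q n) (m n) d = gcmTest α (Q n) (m n) d}) atTop (𝓝 1) := by
  obtain ⟨c, C, δ, hB⟩ := hSP2.exists_errBounds
  refine ⟨convInProb_iff_tendsto.2 ?_, ?_⟩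
  · exact hB.tendsto_variance_ratio hm hY hnull hSP1 hNDG2 hvar hLyap
  · exact tendsto_measure_one_of_eventually_whp
      (hB.eventually_tests_eq hm hY hnull hSP1 hNDG2 hvar hLyap hα₀ hα₁)
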